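/- Let $M$ be a smooth (Hausdorff, finite-dimensional, boundaryless) manifold and $E\to M$ a Courant algebroid: a smooth finite-rank real vector bundle with an $\mathbb R$-bilinear bracket $[\cdot,\cdot]$ on $\Gamma(E)$, a fibrewise non-degenerate symmetric pairing $\langle\cdot,\cdot\rangle$ and a bundle map $\rho\colon E\to TM$ such that, for $u,v,w\in\Gamma(E)$ and $f\in C^\infty(M)$, $[u,[v,w]]=[[u,v],w]+[v,[u,w]]$, $[u,fv]=f[u,v]+(\rho(u)f)v$, $\rho(u)\langle v,w\rangle=\langle[u,v],w\rangle+\langle v,[u,w]\rangle$ and $[u,v]+[v,u]=\mathcal D\langle u,v\rangle$, where $\langle\mathcal Df,w\rangle=\rho(w)f$. Indices of local frames $e_\alpha$ of $E$ are raised and lowered with $\langle\cdot,\cdot\rangle$. Let $\mathcal G$ be a generalized pseudometric, i.e. a smooth endomorphism of $E$ with $\mathcal G^T=\mathcal G$ and $\mathcal G^2=\mathrm{Id}$, whose eigenbundles $V_\pm$ for the eigenvalues $\pm1$ have ranks different from $1$. Let $\sigma$ be an everywhere positive smooth half-density on $M$, with divergence operator $\mathrm{div}_\sigma u=\sigma^{-2}L_{\rho(u)}\sigma^2$.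 Let $D\colon\Gamma(E)\times\Gamma(E)\to\Gamma(E)$ be a Levi-Civita connection for $\mathcal G$ with divergence $\mathrm{div}_\sigma$. That is, $D$ is $\mathbb R$-bilinear, $D_{fu}v=fD_uv$, $D_u(fv)=fD_uv+(\rho(u)f)v$, $\rho(u)\langle v,w\rangle=\langle D_uv,w\rangle+\langle v,D_uw\rangle$, $D\mathcal G=0$, its torsion vanishes, $D_uv-D_vu-[u,v]+\langle Du,v\rangle=0$, and $D_\alpha u^\alpha=\mathrm{div}_\sigma u$ for all $u\in\Gamma(E)$. Define the Riemann tensor, for $w,z,x,y\in\Gamma(E)$, by $$\mathrm{Rm}(w,z,x,y)=\tfrac12w^\delta y^\beta\bigl(x^\alpha[D_\alpha,D_\beta]z_\delta+z^\alpha[D_\alpha,D_\delta]x_\beta-(D_\alpha x_\beta)(D^\alpha z_\delta)\bigr),$$ where $x^\alpha y^\beta D_\alpha D_\beta z=D_xD_yz-D_{D_xy}z$; the full Ricci tensor $\mathrm{FRc}\in\Gamma(\mathrm{End}\,E)$ by $\langle v,\mathrm{FRc}(u)\rangle=\mathrm{Rm}(e^\alpha,v,e_\alpha,u)$; the Ricci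 tensor $\mathrm{Rc}=\mathrm{FRc}-\mathcal G\,\mathrm{FRc}\,\mathcal G$; and the scalar curvature $\mathcal R=\mathrm{Tr}(\mathcal G\,\mathrm{FRc})$. Then $$\mathcal G^\alpha{}_\beta\,D_\alpha\mathrm{Rc}^\beta{}_\gamma=\tfrac12D_\gamma\mathcal R,$$ that is, $\langle e^\alpha,\mathcal G\,(D_{e_\alpha}\mathrm{Rc})(v)\rangle=\tfrac12\rho(v)\mathcal R$ for every $v\in\Gamma(E)$. -/

import Mathlib

open Bundle Manifold
open scoped ContDiff Topology

set_option linter.unusedSectionVars false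

noncomputable section

namespace Courant

section Sections

variable {n : ℕ} {M : Type*} [TopologicalSpace M]
  [ChartedSpace (EuclideanSpace ℝ (Fin n)) M]
  {F : Type*} [NormedAddCommGroup F] [NormedSpace ℝ F]
  {E : M → Type*} [TopologicalSpace (TotalSpace F E)]
  [∀ x, TopologicalSpace (E x)] [FiberBundle F E]
  [∀ x, AddCommGroup (E x)] [∀ x, Module ℝ (E x)] [VectorBundle ℝ F E]

/-- The differential of a real function `f` at `x`; `dirDeriv f x w` is the derivative of `f` along
the tangent vector `w`. -/
def dirDeriv (f : M → ℝ) (x : M) : TangentSpace (𝓡 n) x →L[ℝ] ℝ :=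
  (NormedSpace.fromTangentSpace (f x)).toContinuousLinearMap ∘L mfderiv (𝓡 n) 𝓘(ℝ, ℝ) f x

/-- The product `f u` of a smooth function and a smooth section. -/
instance : SMul C^∞⟮𝓡 n, M; ℝ⟯ Cₛ^∞⟮𝓡 n; F, E⟯ where
  smul f u := ⟨fun x => f x • u x, f.contMDiff.smul_section u.contMDiff⟩

@[simp]
theorem fsmul_apply (f : C^∞⟮𝓡 n, M; ℝ⟯) (u : Cₛ^∞⟮𝓡 n; F, E⟯) (x : M) :
    (f • u) x = f x • u x := rfl

theorem contMDiff_dirDeriv [IsManifold (𝓡 n) ∞ M] {f : M → ℝ} (hf : ContMDiff (𝓡 n) 𝓘(ℝ, ℝ) ∞ f)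
    {X : ∀ x : M, TangentSpace (𝓡 n) x}
    (hX : ContMDiff (𝓡 n) (𝓡 n).tangent ∞ fun x => (⟨x, X x⟩ : TangentBundle (𝓡 n) M)) :
    ContMDiff (𝓡 n) 𝓘(ℝ, ℝ) ∞ fun x => dirDeriv f x (X x) := by
  have h1 : ContMDiff (𝓡 n).tangent 𝓘(ℝ, ℝ).tangent ∞ (tangentMap (𝓡 n) 𝓘(ℝ, ℝ) f) :=
    hf.contMDiff_tangentMap le_rfl
  have h2 := h1.comp hX
  have h3 := (contMDiff_snd_tangentBundle_modelSpace ℝ 𝓘(ℝ, ℝ) (n := ∞)).comp h2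
  exact h3

variable [FiniteDimensional ℝ F]

theorem section_sum_apply {ι : Type*} (s : Finset ι) (u : ι → Cₛ^∞⟮𝓡 n; F, E⟯) (x : M) :
    (∑ i ∈ s, u i) x = ∑ i ∈ s, u i x := by
  have := map_sum (ContMDiffSection.coeAddHom (𝓡 n) F ∞ E) u s
  exact (congrFun this x).trans (Finset.sum_apply x s _)

/-- A basis of the fibre `E x`, coming from the preferred trivialization at `x`. -/
def fiberBasis (F : Type*) [NormedAddCommGroup F] [NormedSpace ℝ F] [FiniteDimensional ℝ F]
    (E : M → Type*) [TopologicalSpace (TotalSpace F E)]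
    [∀ x, TopologicalSpace (E x)] [FiberBundle F E]
    [∀ x, AddCommGroup (E x)] [∀ x, Module ℝ (E x)] [VectorBundle ℝ F E] (x : M) :
    Module.Basis (Fin (Module.finrank ℝ F)) ℝ (E x) :=
  (trivializationAt F E x).basisAt (Module.finBasis ℝ F)
    (FiberBundle.mem_baseSet_trivializationAt' x)

variable [T2Space M] [IsManifold (𝓡 n) ∞ M]

theorem exists_bump {x : M} {U : Set M} (hU : U ∈ 𝓝 x) :
    ∃ χ : C^∞⟮𝓡 n, M; ℝ⟯, (∀ᶠ y in 𝓝 x, χ y = 1) ∧ tsupport χ ⊆ U := by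
  obtain ⟨f, -, hf⟩ := (SmoothBumpFunction.nhds_basis_tsupport (I := 𝓡 n) x).mem_iff.1 hU
  exact ⟨⟨f, f.contMDiff⟩, f.eventuallyEq_one, hf⟩

variable [ContMDiffVectorBundle ∞ F E (𝓡 n)]

/-- Global sections that agree near `x` with the local frame of the preferred trivialization. -/
theorem exists_frame (x : M) :
    ∃ e : Fin (Module.finrank ℝ F) → Cₛ^∞⟮𝓡 n; F, E⟯, ∀ᶠ y in 𝓝 x, ∀ i,
      e i y = (trivializationAt F E x).localFrame (Module.finBasis ℝ F) i y := by
  obtain ⟨χ, h1, h2⟩ := exists_bump (n := n) (M := M) ((trivializationAt F E x).open_baseSet.mem_nhds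
    (FiberBundle.mem_baseSet_trivializationAt' x))
  refine ⟨fun i => ⟨(χ : M → ℝ) • (trivializationAt F E x).localFrame (Module.finBasis ℝ F) i, ?_⟩, ?_⟩
  · exact ContMDiffOn.smul_section_of_tsupport χ.contMDiff.contMDiffOn
      (trivializationAt F E x).open_baseSet h2
      ((trivializationAt F E x).contMDiffOn_localFrame_baseSet ∞ _ i)
  · filter_upwards [h1] with y hy i
    simp [hy]

/-- A choice of global sections forming a frame near `x`. -/
def frameAt (F : Type*) [NormedAddCommGroup F] [NormedSpace ℝ F] [FiniteDimensional ℝ F]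
    (E : M → Type*) [TopologicalSpace (TotalSpace F E)]
    [∀ x, TopologicalSpace (E x)] [FiberBundle F E]
    [∀ x, AddCommGroup (E x)] [∀ x, Module ℝ (E x)] [VectorBundle ℝ F E]
    [ContMDiffVectorBundle ∞ F E (𝓡 n)] (x : M) :
    Fin (Module.finrank ℝ F) → Cₛ^∞⟮𝓡 n; F, E⟯ :=
  (exists_frame (n := n) (F := F) (E := E) x).choose

/-- A linear choice of global smooth sections with prescribed value at `x`. -/
def extend (x : M) : E x →ₗ[ℝ] Cₛ^∞⟮𝓡 n; F, E⟯ :=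
  (fiberBasis F E x).constr ℝ (frameAt F E x)

@[simp]
theorem extend_apply (x : M) (a : E x) :
    (extend x a : Cₛ^∞⟮𝓡 n; F, E⟯) x = a := by
  have h := (exists_frame (n := n) (F := F) (E := E) x).choose_spec.self_of_nhds
  have hx := FiberBundle.mem_baseSet_trivializationAt' (F := F) (E := E) x
  rw [extend, Module.Basis.constr_apply_fintype, section_sum_apply]
  conv_rhs => rw [← (fiberBasis F E x).sum_equivFun a]
  refine Finset.sum_congr rfl fun i _ => ?_
  have h' := h i
  rw [Bundle.Trivialization.localFrame_apply_of_mem_baseSet _ _ hx] at h'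
  rw [ContMDiffSection.coe_smul, Pi.smul_apply]
  exact congrArg _ h'

/-- An operation on sections with values in functions that is linear over smooth functions. -/
structure IsTensorial (α : Cₛ^∞⟮𝓡 n; F, E⟯ → M → ℝ) : Prop where
  add : ∀ u v x, α (u + v) x = α u x + α v x
  smul : ∀ (f : C^∞⟮𝓡 n, M; ℝ⟯) u x, α (f • u) x = f x * α u x

namespace IsTensorial

variable {α : Cₛ^∞⟮𝓡 n; F, E⟯ → M → ℝ}

theorem const_smul (hα : IsTensorial α) (c : ℝ) (u : Cₛ^∞⟮𝓡 n; F, E⟯) (x : M) : α (c • u) x = c * α u x :=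
  hα.smul (ContMDiffMap.const c) u x

theorem sum (hα : IsTensorial α) {ι : Type*} (s : Finset ι) (u : ι → Cₛ^∞⟮𝓡 n; F, E⟯) (x : M) :
    α (∑ i ∈ s, u i) x = ∑ i ∈ s, α (u i) x := by
  classical
  induction s using Finset.induction_on with
  | empty => simpa using hα.const_smul 0 0 x
  | insert a s ha ih => rw [Finset.sum_insert ha, hα.add, ih, Finset.sum_insert ha]

theorem local_eq (hα : IsTensorial α) {u v : Cₛ^∞⟮𝓡 n; F, E⟯} {x : M} (h : ∀ᶠ y in 𝓝 x, u y = v y) :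
    α u x = α v x := by
  obtain ⟨χ, h1, h2⟩ := exists_bump (n := n) h
  have h3 : χ • u = χ • v := by
    ext y
    by_cases hy : y ∈ tsupport χ
    · have : u y = v y := h2 hy
      simp [this]
    · simp [image_eq_zero_of_notMem_tsupport hy]
  have h4 := hα.smul χ u x
  rw [h3, hα.smul, h1.self_of_nhds] at h4
  linarith

theorem pointwise (hα : IsTensorial α) {u v : Cₛ^∞⟮𝓡 n; F, E⟯} {x : M} (h : u x = v x) : α u x = α v x := by
  set t := trivializationAt F E x
  set b := Module.finBasis ℝ F
  have hx : x ∈ t.baseSet := FiberBundle.mem_baseSet_trivializationAt' x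
  obtain ⟨χ, h1, h2⟩ := exists_bump (n := n) (t.open_baseSet.mem_nhds hx)
  obtain ⟨e, he⟩ := exists_frame (n := n) (F := F) (E := E) x
  have key : ∀ w : Cₛ^∞⟮𝓡 n; F, E⟯,
      α w x = ∑ i, t.localFrameCoeff (𝓡 n) b i x (w x) * α (e i) x := by
    intro w
    have hsm : ∀ i, ContMDiff (𝓡 n) 𝓘(ℝ, ℝ) ∞
        fun y => χ y * t.localFrameCoeff (𝓡 n) b i y (w y) := by
      intro i
      refine contMDiff_of_tsupport fun y hy => ?_
      have hy' : y ∈ t.baseSet := h2 (tsupport_mul_subset_left hy)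
      exact χ.contMDiff.contMDiffAt.mul
        (contMDiffAt_localFrameCoeff b hy' (w.contMDiff y) i)
    let g : Fin (Module.finrank ℝ F) → C^∞⟮𝓡 n, M; ℝ⟯ := fun i => ⟨_, hsm i⟩
    have h3 : α w x = α (∑ i, g i • e i) x := by
      apply hα.local_eq
      filter_upwards [h1, he, t.open_baseSet.mem_nhds hx] with y hy1 hy2 hy3
      rw [section_sum_apply, t.eq_sum_localFrameCoeff_smul (I := 𝓡 n) (b := b) (s := w) hy3]
      refine Finset.sum_congr rfl fun i _ => ?_
      rw [fsmul_apply, hy2 i]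
      simp only [g, ContMDiffMap.coeFn_mk, hy1, one_mul]
      rfl
    rw [h3, hα.sum]
    refine Finset.sum_congr rfl fun i _ => ?_
    rw [hα.smul]
    simp only [g, ContMDiffMap.coeFn_mk, h1.self_of_nhds, one_mul]
  rw [key u, key v, h]

/-- The value at `x` as a linear form on the fibre. -/
def atPoint (hα : IsTensorial α) (x : M) : E x →ₗ[ℝ] ℝ where
  toFun a := α (extend x a) x
  map_add' a b := by rw [map_add, hα.add]
  map_smul' c a := by rw [map_smul, hα.const_smul]; rfl

theorem atPoint_apply (hα : IsTensorial α) (x : M) (u : Cₛ^∞⟮𝓡 n; F, E⟯) : hα.atPoint x (u x) = α u x :=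
  hα.pointwise (extend_apply x (u x))

end IsTensorial


theorem contMDiffAt_det {ι : Type*} [Fintype ι] [DecidableEq ι] {A : M → Matrix ι ι ℝ} {x : M}
    (hA : ∀ i j, ContMDiffAt (𝓡 n) 𝓘(ℝ, ℝ) ∞ (fun y => A y i j) x) :
    ContMDiffAt (𝓡 n) 𝓘(ℝ, ℝ) ∞ (fun y => (A y).det) x := by
  simp only [Matrix.det_apply']
  exact ContMDiffAt.sum fun σ _ => contMDiffAt_const.mul (ContMDiffAt.prod fun i _ => hA _ _)

theorem contMDiffAt_inv {ι : Type*} [Fintype ι] [DecidableEq ι] {A : M → Matrix ι ι ℝ} {x : M}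
    (hA : ∀ i j, ContMDiffAt (𝓡 n) 𝓘(ℝ, ℝ) ∞ (fun y => A y i j) x) (hx : (A x).det ≠ 0)
    (i j : ι) : ContMDiffAt (𝓡 n) 𝓘(ℝ, ℝ) ∞ (fun y => (A y)⁻¹ i j) x := by
  simp only [Matrix.inv_def, Ring.inverse_eq_inv', Matrix.smul_apply, smul_eq_mul,
    Matrix.adjugate_apply]
  refine ((contMDiffAt_det hA).inv₀ hx).mul (contMDiffAt_det fun k l => ?_)
  by_cases hk : k = j
  · subst hk; simpa using contMDiffAt_const
  · simpa [Matrix.updateRow_ne hk] using hA k l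

theorem sum_dualBasis {V W ι : Type*} [AddCommGroup V] [Module ℝ V] [AddCommGroup W] [Module ℝ W]
    [Fintype ι] [DecidableEq ι] (B : LinearMap.BilinForm ℝ V) (hB : B.Nondegenerate)
    (b e : Module.Basis ι ℝ V) (t : V →ₗ[ℝ] V →ₗ[ℝ] W) :
    (Matrix.of fun i j => B (e i) (e j)).det ≠ 0 ∧
    ∑ i, t (B.dualBasis hB b i) (b i)
      = ∑ k, ∑ j, (Matrix.of fun i j => B (e i) (e j))⁻¹ k j • t (e j) (e k) := by
  have hc : (Matrix.of fun k j => e.repr (B.dualBasis hB e k) j)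
      * (Matrix.of fun i j => B (e i) (e j)) = 1 := by
    ext k l
    have h1 := B.apply_dualBasis_left hB e k l
    conv at h1 => lhs; rw [← e.sum_repr (B.dualBasis hB e k)]
    simp only [map_sum, map_smul, LinearMap.sum_apply, LinearMap.smul_apply, smul_eq_mul] at h1
    simpa only [Matrix.mul_apply, Matrix.one_apply, Matrix.of_apply, eq_comm] using h1
  constructor
  · intro h0
    have := congrArg Matrix.det hc
    rw [Matrix.det_mul, h0] at this
    simp at this
  rw [Matrix.inv_eq_left_inv hc]
  have h2 : ∀ k, ∑ j, e.repr (B.dualBasis hB e k) j • t (e j) (e k)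
      = t (B.dualBasis hB e k) (e k) := by
    intro k
    conv_rhs => rw [← e.sum_repr (B.dualBasis hB e k)]
    simp only [map_sum, map_smul, LinearMap.sum_apply, LinearMap.smul_apply]
  simp only [Matrix.of_apply, h2]
  have h3 : ∀ k, B.dualBasis hB e k
      = ∑ i, B (B.dualBasis hB e k) (b i) • B.dualBasis hB b i := by
    intro k
    conv_lhs => rw [← (B.dualBasis hB b).sum_repr (B.dualBasis hB e k)]
    simp
  have h4 : ∀ i, b i = ∑ k, B (B.dualBasis hB e k) (b i) • e k := by
    intro i
    conv_lhs => rw [← e.sum_repr (b i)]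
    refine Finset.sum_congr rfl fun k _ => ?_
    congr 1
    conv_rhs => rw [← e.sum_repr (b i)]
    simp only [map_sum, map_smul, LinearMap.BilinForm.apply_dualBasis_left, smul_eq_mul]
    simp
  calc ∑ i, t (B.dualBasis hB b i) (b i)
      = ∑ i, ∑ k, B (B.dualBasis hB e k) (b i) • t (B.dualBasis hB b i) (e k) := by
        refine Finset.sum_congr rfl fun i _ => ?_
        conv_lhs => rw [h4 i]
        simp
    _ = ∑ k, t (B.dualBasis hB e k) (e k) := by
        rw [Finset.sum_comm]
        refine Finset.sum_congr rfl fun k _ => ?_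
        conv_rhs => arg 1; rw [h3 k]
        simp

end Sections

section Algebroid

variable {n : ℕ} {M : Type*} [TopologicalSpace M]
  [ChartedSpace (EuclideanSpace ℝ (Fin n)) M] [IsManifold (𝓡 n) ∞ M]

/-- A Courant algebroid structure on a vector bundle `E → M`.  The last axiom is
`[u, v] + [v, u] = 𝒟⟨u, v⟩`, tested against an arbitrary section `w`. Smoothness of the pairing and
of the anchor is tested on smooth sections. -/
structure CourantAlgebroid (n : ℕ) {M : Type*} [TopologicalSpace M]
    [ChartedSpace (EuclideanSpace ℝ (Fin n)) M] [IsManifold (𝓡 n) ∞ M]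
    (F : Type*) [NormedAddCommGroup F] [NormedSpace ℝ F]
    (E : M → Type*) [TopologicalSpace (TotalSpace F E)]
    [∀ x, TopologicalSpace (E x)] [FiberBundle F E]
    [∀ x, AddCommGroup (E x)] [∀ x, Module ℝ (E x)] [VectorBundle ℝ F E] where
  pairing (x : M) : LinearMap.BilinForm ℝ (E x)
  pairing_smooth (u v : Cₛ^∞⟮𝓡 n; F, E⟯) :
    ContMDiff (𝓡 n) 𝓘(ℝ, ℝ) ∞ fun x => pairing x (u x) (v x)
  pairing_symm (x : M) (a b : E x) : pairing x a b = pairing x b a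
  pairing_nondegenerate (x : M) : (pairing x).Nondegenerate
  anchor (x : M) : E x →ₗ[ℝ] TangentSpace (𝓡 n) x
  anchor_smooth (u : Cₛ^∞⟮𝓡 n; F, E⟯) :
    ContMDiff (𝓡 n) (𝓡 n).tangent ∞ fun x => (⟨x, anchor x (u x)⟩ : TangentBundle (𝓡 n) M)
  bracket : Cₛ^∞⟮𝓡 n; F, E⟯ →ₗ[ℝ] Cₛ^∞⟮𝓡 n; F, E⟯ →ₗ[ℝ] Cₛ^∞⟮𝓡 n; F, E⟯
  jacobi (u v w : Cₛ^∞⟮𝓡 n; F, E⟯) :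
    bracket u (bracket v w) = bracket (bracket u v) w + bracket v (bracket u w)
  leibniz (u v : Cₛ^∞⟮𝓡 n; F, E⟯) (f : C^∞⟮𝓡 n, M; ℝ⟯) (x : M) :
    bracket u (f • v) x = f x • bracket u v x + dirDeriv f x (anchor x (u x)) • v x
  invariant (u v w : Cₛ^∞⟮𝓡 n; F, E⟯) (x : M) :
    dirDeriv (fun y => pairing y (v y) (w y)) x (anchor x (u x))
      = pairing x (bracket u v x) (w x) + pairing x (v x) (bracket u w x)
  symmetric_part (u v w : Cₛ^∞⟮𝓡 n; F, E⟯) (x : M) :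
    pairing x (bracket u v x + bracket v u x) (w x)
      = dirDeriv (fun y => pairing y (u y) (v y)) x (anchor x (w x))

variable {F : Type*} [NormedAddCommGroup F] [NormedSpace ℝ F]
  {E : M → Type*} [TopologicalSpace (TotalSpace F E)]
  [∀ x, TopologicalSpace (E x)] [FiberBundle F E]
  [∀ x, AddCommGroup (E x)] [∀ x, Module ℝ (E x)] [VectorBundle ℝ F E]

namespace CourantAlgebroid

/-- The action `ρ(u) f` of a section on a smooth function. -/
def rho (A : CourantAlgebroid n F E) (u : Cₛ^∞⟮𝓡 n; F, E⟯) (f : C^∞⟮𝓡 n, M; ℝ⟯) :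
    C^∞⟮𝓡 n, M; ℝ⟯ :=
  ⟨fun x => dirDeriv f x (A.anchor x (u x)), contMDiff_dirDeriv f.contMDiff (A.anchor_smooth u)⟩

/-- The pairing `⟨u, v⟩` of two sections. -/
def pair (A : CourantAlgebroid n F E) (u v : Cₛ^∞⟮𝓡 n; F, E⟯) : C^∞⟮𝓡 n, M; ℝ⟯ :=
  ⟨fun x => A.pairing x (u x) (v x), A.pairing_smooth u v⟩

/-- A Courant algebroid connection. -/
structure Connection (A : CourantAlgebroid n F E) where
  cov : Cₛ^∞⟮𝓡 n; F, E⟯ →ₗ[ℝ] Cₛ^∞⟮𝓡 n; F, E⟯ →ₗ[ℝ] Cₛ^∞⟮𝓡 n; F, E⟯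
  smul_left (f : C^∞⟮𝓡 n, M; ℝ⟯) (u v : Cₛ^∞⟮𝓡 n; F, E⟯) : cov (f • u) v = f • cov u v
  leibniz (u v : Cₛ^∞⟮𝓡 n; F, E⟯) (f : C^∞⟮𝓡 n, M; ℝ⟯) (x : M) :
    cov u (f • v) x = f x • cov u v x + dirDeriv f x (A.anchor x (u x)) • v x
  metric (u v w : Cₛ^∞⟮𝓡 n; F, E⟯) (x : M) :
    dirDeriv (fun y => A.pairing y (v y) (w y)) x (A.anchor x (u x))
      = A.pairing x (cov u v x) (w x) + A.pairing x (v x) (cov u w x)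


theorem bracket_smul (A : CourantAlgebroid n F E) (u v : Cₛ^∞⟮𝓡 n; F, E⟯)
    (f : C^∞⟮𝓡 n, M; ℝ⟯) : A.bracket u (f • v) = f • A.bracket u v + A.rho u f • v := by
  ext x
  exact A.leibniz u v f x

theorem Connection.map_smul {A : CourantAlgebroid n F E} (D : A.Connection)
    (u v : Cₛ^∞⟮𝓡 n; F, E⟯) (f : C^∞⟮𝓡 n, M; ℝ⟯) :
    D.cov u (f • v) = f • D.cov u v + A.rho u f • v := by
  ext x
  exact D.leibniz u v f x

variable [FiniteDimensional ℝ F] [T2Space M] [ContMDiffVectorBundle ∞ F E (𝓡 n)]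

/-- The dual, with respect to the pairing, of the basis of the fibre at `x`. -/
def dualFiberBasis (A : CourantAlgebroid n F E) (x : M) :
    Module.Basis (Fin (Module.finrank ℝ F)) ℝ (E x) :=
  (A.pairing x).dualBasis (A.pairing_nondegenerate x) (fiberBasis F E x)

/-- The contraction `T(e^α, e_α)` of a bilinear operation on sections, where `e_α` is a frame and
`e^α` its dual with respect to the pairing. It is independent of the choice of frame, dual frame and
extensions whenever `T` is bilinear over the smooth functions. -/
def contract (A : CourantAlgebroid n F E)
    (T : Cₛ^∞⟮𝓡 n; F, E⟯ → Cₛ^∞⟮𝓡 n; F, E⟯ → M → ℝ) (x : M) : ℝ :=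
  ∑ i, T (extend x (A.dualFiberBasis x i)) (extend x (fiberBasis F E x i)) x

/-- The values at `x` of the section corresponding under the pairing to a linear form on
sections. -/
def sharp (A : CourantAlgebroid n F E) (α : Cₛ^∞⟮𝓡 n; F, E⟯ → M → ℝ) (x : M) : E x :=
  ∑ i, α (extend x (fiberBasis F E x i)) x • A.dualFiberBasis x i

theorem eventually_frame (A : CourantAlgebroid n F E) (x : M) :
    ∃ e : Fin (Module.finrank ℝ F) → Cₛ^∞⟮𝓡 n; F, E⟯,
      (∀ᶠ y in 𝓝 x, ∃ b : Module.Basis (Fin (Module.finrank ℝ F)) ℝ (E y), ∀ i, b i = e i y) ∧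
      ∀ i j, ContMDiffAt (𝓡 n) 𝓘(ℝ, ℝ) ∞
        (fun y => (Matrix.of fun i j => A.pairing y (e i y) (e j y))⁻¹ i j) x := by
  obtain ⟨e, he⟩ := exists_frame (n := n) (F := F) (E := E) x
  have hb : ∀ᶠ y in 𝓝 x, ∃ b : Module.Basis (Fin (Module.finrank ℝ F)) ℝ (E y),
      ∀ i, b i = e i y := by
    filter_upwards [he, (trivializationAt F E x).open_baseSet.mem_nhds
      (FiberBundle.mem_baseSet_trivializationAt' x)] with y hy hy'
    refine ⟨(trivializationAt F E x).basisAt (Module.finBasis ℝ F) hy', fun i => ?_⟩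
    rw [hy i, Bundle.Trivialization.localFrame_apply_of_mem_baseSet _ _ hy']
  refine ⟨e, hb, contMDiffAt_inv (fun i j => A.pairing_smooth (e i) (e j) x) ?_⟩
  obtain ⟨b, hb⟩ := hb.self_of_nhds
  have := (sum_dualBasis (A.pairing x) (A.pairing_nondegenerate x) b b
    (0 : E x →ₗ[ℝ] E x →ₗ[ℝ] ℝ)).1
  simpa only [hb] using this

theorem contMDiff_contract (A : CourantAlgebroid n F E)
    {T : Cₛ^∞⟮𝓡 n; F, E⟯ → Cₛ^∞⟮𝓡 n; F, E⟯ → M → ℝ}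
    (h1 : ∀ v, IsTensorial fun u => T u v) (h2 : ∀ u, IsTensorial (T u))
    (hs : ∀ u v, ContMDiff (𝓡 n) 𝓘(ℝ, ℝ) ∞ (T u v)) :
    ContMDiff (𝓡 n) 𝓘(ℝ, ℝ) ∞ (A.contract T) := by
  intro x
  obtain ⟨e, hb, hinv⟩ := A.eventually_frame x
  have hsm : ContMDiffAt (𝓡 n) 𝓘(ℝ, ℝ) ∞ (fun y => ∑ k, ∑ j,
      (Matrix.of fun i j => A.pairing y (e i y) (e j y))⁻¹ k j * T (e j) (e k) y) x :=
    ContMDiffAt.sum fun k _ => ContMDiffAt.sum fun j _ => (hinv k j).mul (hs _ _ x)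
  refine hsm.congr_of_eventuallyEq ?_
  filter_upwards [hb] with y ⟨b, hb⟩
  let t : E y →ₗ[ℝ] E y →ₗ[ℝ] ℝ := LinearMap.mk₂ ℝ (fun a b => T (extend y a) (extend y b) y)
    (fun a a' b => by rw [map_add]; exact (h1 _).add _ _ _)
    (fun c a b => by rw [map_smul]; exact (h1 _).const_smul _ _ _)
    (fun a b b' => by rw [map_add]; exact (h2 _).add _ _ _)
    (fun c a b => by rw [map_smul]; exact (h2 _).const_smul _ _ _)
  have ht : ∀ u v : Cₛ^∞⟮𝓡 n; F, E⟯, t (u y) (v y) = T u v y := fun u v =>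
    ((h1 _).pointwise (extend_apply y (u y))).trans ((h2 u).pointwise (extend_apply y (v y)))
  have := (sum_dualBasis (A.pairing y) (A.pairing_nondegenerate y) (fiberBasis F E y) b t).2
  simp only [hb, ht, smul_eq_mul] at this
  exact this

theorem contMDiff_sharp (A : CourantAlgebroid n F E) {α : Cₛ^∞⟮𝓡 n; F, E⟯ → M → ℝ}
    (h : IsTensorial α) (hs : ∀ u, ContMDiff (𝓡 n) 𝓘(ℝ, ℝ) ∞ (α u)) :
    ContMDiff (𝓡 n) ((𝓡 n).prod 𝓘(ℝ, F)) ∞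
      fun x => (TotalSpace.mk' F x (A.sharp α x) : TotalSpace F E) := by
  intro x
  obtain ⟨e, hb, hinv⟩ := A.eventually_frame x
  have hsm : ContMDiffAt (𝓡 n) ((𝓡 n).prod 𝓘(ℝ, F)) ∞ (fun y => (TotalSpace.mk' F y
      (∑ k, ∑ j, ((Matrix.of fun i j => A.pairing y (e i y) (e j y))⁻¹ k j * α (e k) y) • e j y)
        : TotalSpace F E)) x :=
    ContMDiffAt.sum_section fun k _ => ContMDiffAt.sum_section fun j _ =>
      ((hinv k j).mul (hs _ x)).smul_section ((e j).contMDiff x)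
  refine hsm.congr_of_eventuallyEq ?_
  filter_upwards [hb] with y ⟨b, hb⟩
  let t : E y →ₗ[ℝ] E y →ₗ[ℝ] E y := LinearMap.mk₂ ℝ (fun a b => h.atPoint y b • a)
    (fun a a' b => smul_add _ _ _)
    (fun c a b => smul_comm _ _ _)
    (fun a b b' => by rw [map_add, add_smul])
    (fun c a b => by rw [map_smul, smul_assoc])
  have ht : ∀ u v : Cₛ^∞⟮𝓡 n; F, E⟯, t (u y) (v y) = α v y • u y := fun u v => by
    simp only [t, LinearMap.mk₂_apply, h.atPoint_apply]
  have := (sum_dualBasis (A.pairing y) (A.pairing_nondegenerate y) (fiberBasis F E y) b t).2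
  simp only [hb, ht, smul_smul] at this
  exact congrArg _ this

theorem pairing_sharp (A : CourantAlgebroid n F E) {α : Cₛ^∞⟮𝓡 n; F, E⟯ → M → ℝ}
    (h : IsTensorial α) (u : Cₛ^∞⟮𝓡 n; F, E⟯) (x : M) :
    A.pairing x (A.sharp α x) (u x) = α u x := by
  rw [← h.atPoint_apply, ← (fiberBasis F E x).sum_repr (u x)]
  simp only [sharp, dualFiberBasis, map_sum, map_smul, LinearMap.sum_apply, LinearMap.smul_apply,
    LinearMap.BilinForm.apply_dualBasis_left, smul_eq_mul]
  simp only [mul_ite, mul_one, mul_zero, Finset.sum_ite_eq, Finset.mem_univ,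
    if_true]
  rfl

theorem rho_bracket (A : CourantAlgebroid n F E) (u v : Cₛ^∞⟮𝓡 n; F, E⟯)
    (f : C^∞⟮𝓡 n, M; ℝ⟯) (x : M) :
    A.rho (A.bracket u v) f x = A.rho u (A.rho v f) x - A.rho v (A.rho u f) x := by
  have key : ∀ w : Cₛ^∞⟮𝓡 n; F, E⟯, (A.rho u (A.rho v f) x - A.rho v (A.rho u f) x
      - A.rho (A.bracket u v) f x) • w x = 0 := by
    intro w
    have h := A.jacobi u v (f • w)
    have h0 := A.jacobi u v w
    simp only [bracket_smul, map_add, h0] at h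
    have h' := congrArg (fun s : Cₛ^∞⟮𝓡 n; F, E⟯ => s x) h
    simp only [ContMDiffSection.coe_add, Pi.add_apply, fsmul_apply, smul_add] at h'
    have h'' := sub_eq_zero.2 h'
    rw [← h'']
    module
  rcases subsingleton_or_nontrivial (E x) with hE | hE
  · have h0 : ∀ (w : Cₛ^∞⟮𝓡 n; F, E⟯) (g : C^∞⟮𝓡 n, M; ℝ⟯), A.rho w g x = 0 := by
      intro w g
      have : w x = 0 := Subsingleton.elim _ _
      change dirDeriv g x (A.anchor x (w x)) = 0
      rw [this, map_zero, map_zero]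
    simp [h0]
  · obtain ⟨a, ha⟩ := exists_ne (0 : E x)
    have h := key (extend x a)
    rw [extend_apply] at h
    have := (smul_eq_zero.1 h).resolve_right ha
    linarith

namespace Connection

variable {A : CourantAlgebroid n F E}

/-- The torsion `⟨T(u, v), w⟩`, where `T(u, v) = D_u v - D_v u - [u, v] + ⟨D u, v⟩`. -/
def torsion (D : A.Connection) (u v w : Cₛ^∞⟮𝓡 n; F, E⟯) : C^∞⟮𝓡 n, M; ℝ⟯ :=
  A.pair (D.cov u v - D.cov v u - A.bracket u v) w + A.pair (D.cov w u) v

/-- The commutator `x^α y^β [D_α, D_β] z` of second covariant derivatives, where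
`x^α y^β D_α D_β z = D_x D_y z - D_{D_x y} z`. -/
def comm (D : A.Connection) (x y z : Cₛ^∞⟮𝓡 n; F, E⟯) : Cₛ^∞⟮𝓡 n; F, E⟯ :=
  (D.cov x (D.cov y z) - D.cov (D.cov x y) z) - (D.cov y (D.cov x z) - D.cov (D.cov y x) z)

/-- The generalized Riemann tensor: `riemann D w z x y` is
`½ w^δ y^β (x^α [D_α, D_β] z_δ + z^α [D_α, D_δ] x_β - (D_α x_β) (D^α z_δ))`. -/
def riemann (D : A.Connection) (w z x y : Cₛ^∞⟮𝓡 n; F, E⟯) (p : M) : ℝ :=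
  1 / 2 * (A.pair w (D.comm x y z) p + A.pair y (D.comm z w x) p
    - A.contract (fun s t p => A.pair (D.cov t x) y p * A.pair (D.cov s z) w p) p)

theorem comm_smul_left (D : A.Connection) (f : C^∞⟮𝓡 n, M; ℝ⟯) (x y z : Cₛ^∞⟮𝓡 n; F, E⟯) :
    D.comm (f • x) y z = f • D.comm x y z := by
  ext p
  simp only [comm, D.smul_left, D.map_smul, map_add, LinearMap.add_apply,
    ContMDiffSection.coe_add, ContMDiffSection.coe_sub, Pi.add_apply, Pi.sub_apply, fsmul_apply]
  module

theorem comm_smul_mid (D : A.Connection) (f : C^∞⟮𝓡 n, M; ℝ⟯) (x y z : Cₛ^∞⟮𝓡 n; F, E⟯) :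
    D.comm x (f • y) z = f • D.comm x y z := by
  ext p
  simp only [comm, D.smul_left, D.map_smul, map_add, LinearMap.add_apply,
    ContMDiffSection.coe_add, ContMDiffSection.coe_sub, Pi.add_apply, Pi.sub_apply, fsmul_apply]
  module

theorem comm_smul_right (D : A.Connection) (f : C^∞⟮𝓡 n, M; ℝ⟯) (x y z : Cₛ^∞⟮𝓡 n; F, E⟯)
    (p : M) : D.comm x y (f • z) p = f p • D.comm x y z p
      + A.rho (A.bracket x y - D.cov x y + D.cov y x) f p • z p := by
  have h : A.rho (A.bracket x y - D.cov x y + D.cov y x) f p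
      = A.rho x (A.rho y f) p - A.rho y (A.rho x f) p - A.rho (D.cov x y) f p + A.rho (D.cov y x) f p := by
    rw [← rho_bracket]
    change dirDeriv f p (A.anchor p (A.bracket x y p - D.cov x y p + D.cov y x p)) = _
    rw [map_add, map_add, map_sub, map_sub]; rfl
  rw [h]
  simp only [comm, D.smul_left, D.map_smul, map_add, LinearMap.add_apply,
    ContMDiffSection.coe_add, ContMDiffSection.coe_sub, Pi.add_apply, Pi.sub_apply, fsmul_apply]
  module

theorem comm_add_left (D : A.Connection) (x x' y z : Cₛ^∞⟮𝓡 n; F, E⟯) :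
    D.comm (x + x') y z = D.comm x y z + D.comm x' y z := by
  simp only [comm, map_add, LinearMap.add_apply]; abel

theorem comm_add_mid (D : A.Connection) (x y y' z : Cₛ^∞⟮𝓡 n; F, E⟯) :
    D.comm x (y + y') z = D.comm x y z + D.comm x y' z := by
  simp only [comm, map_add, LinearMap.add_apply]; abel

theorem comm_add_right (D : A.Connection) (x y z z' : Cₛ^∞⟮𝓡 n; F, E⟯) :
    D.comm x y (z + z') = D.comm x y z + D.comm x y z' := by
  simp only [comm, map_add]; abel

/-- Vanishing torsion. -/
def IsTorsionFree (D : A.Connection) : Prop := ∀ u v w, D.torsion u v w = 0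

end Connection

theorem pair_apply (A : CourantAlgebroid n F E) (u v : Cₛ^∞⟮𝓡 n; F, E⟯) (p : M) :
    A.pair u v p = A.pairing p (u p) (v p) := rfl

theorem pair_symm (A : CourantAlgebroid n F E) (u v : Cₛ^∞⟮𝓡 n; F, E⟯) :
    A.pair u v = A.pair v u := by
  ext p; exact A.pairing_symm p _ _

theorem pair_add (A : CourantAlgebroid n F E) (u v v' : Cₛ^∞⟮𝓡 n; F, E⟯) (p : M) :
    A.pair u (v + v') p = A.pair u v p + A.pair u v' p := by
  simp [pair_apply]

theorem pair_smul (A : CourantAlgebroid n F E) (u v : Cₛ^∞⟮𝓡 n; F, E⟯)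
    (f : C^∞⟮𝓡 n, M; ℝ⟯) (p : M) : A.pair u (f • v) p = f p * A.pair u v p := by
  simp [pair_apply]

theorem pair_add_left (A : CourantAlgebroid n F E) (u u' v : Cₛ^∞⟮𝓡 n; F, E⟯) (p : M) :
    A.pair (u + u') v p = A.pair u v p + A.pair u' v p := by
  simp [pair_apply]

theorem pair_smul_left (A : CourantAlgebroid n F E) (u v : Cₛ^∞⟮𝓡 n; F, E⟯)
    (f : C^∞⟮𝓡 n, M; ℝ⟯) (p : M) : A.pair (f • u) v p = f p * A.pair u v p := by
  simp [pair_apply]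

theorem contract_add (A : CourantAlgebroid n F E)
    (T S : Cₛ^∞⟮𝓡 n; F, E⟯ → Cₛ^∞⟮𝓡 n; F, E⟯ → M → ℝ) (p : M) :
    A.contract (fun s t p => T s t p + S s t p) p = A.contract T p + A.contract S p := by
  simp only [contract, Finset.sum_add_distrib]

theorem contract_mul (A : CourantAlgebroid n F E) (f : M → ℝ)
    (T : Cₛ^∞⟮𝓡 n; F, E⟯ → Cₛ^∞⟮𝓡 n; F, E⟯ → M → ℝ) (p : M) :
    A.contract (fun s t p => f p * T s t p) p = f p * A.contract T p := by
  simp only [contract, Finset.mul_sum]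

theorem contract_rho_right (A : CourantAlgebroid n F E) (c : Cₛ^∞⟮𝓡 n; F, E⟯)
    (f : C^∞⟮𝓡 n, M; ℝ⟯) (p : M) :
    A.contract (fun s t p => A.rho t f p * A.pair c s p) p = A.rho c f p := by
  have hc : c p = ∑ i, A.pairing p (c p) (A.dualFiberBasis p i) • fiberBasis F E p i := by
    conv_lhs => rw [← (fiberBasis F E p).sum_repr (c p)]
    refine Finset.sum_congr rfl fun i _ => ?_
    congr 1
    conv_rhs => rw [A.pairing_symm, ← (fiberBasis F E p).sum_repr (c p)]
    simp only [dualFiberBasis, map_sum, _root_.map_smul,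
      LinearMap.BilinForm.apply_dualBasis_left, smul_eq_mul]
    simp
  change _ = dirDeriv f p (A.anchor p (c p))
  rw [hc]
  simp only [map_sum, _root_.map_smul, smul_eq_mul]
  refine Finset.sum_congr rfl fun i _ => ?_
  change dirDeriv f p (A.anchor p (extend p _ p)) * A.pairing p (c p) (extend p _ p) = _
  rw [extend_apply, extend_apply, mul_comm]

theorem contract_rho_left (A : CourantAlgebroid n F E) (c : Cₛ^∞⟮𝓡 n; F, E⟯)
    (f : C^∞⟮𝓡 n, M; ℝ⟯) (p : M) :
    A.contract (fun s t p => A.rho s f p * A.pair c t p) p = A.rho c f p := by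
  have hc : c p = ∑ i, A.pairing p (c p) (fiberBasis F E p i) • A.dualFiberBasis p i := by
    conv_lhs => rw [← (A.dualFiberBasis p).sum_repr (c p)]
    simp only [dualFiberBasis, LinearMap.BilinForm.dualBasis_repr_apply]
  change _ = dirDeriv f p (A.anchor p (c p))
  rw [hc]
  simp only [map_sum, _root_.map_smul, smul_eq_mul]
  refine Finset.sum_congr rfl fun i _ => ?_
  change dirDeriv f p (A.anchor p (extend p _ p)) * A.pairing p (c p) (extend p _ p) = _
  rw [extend_apply, extend_apply, mul_comm]

namespace Connection

variable {A : CourantAlgebroid n F E}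

theorem IsTorsionFree.pair_cov {D : A.Connection} (hD : D.IsTorsionFree)
    (u v w : Cₛ^∞⟮𝓡 n; F, E⟯) (p : M) :
    A.pair (D.cov w u) v p = A.pair (A.bracket u v - D.cov u v + D.cov v u) w p := by
  have h : (D.torsion u v w) p = 0 := by rw [hD]; rfl
  have h' : A.pairing p (D.cov u v p - D.cov v u p - A.bracket u v p) (w p)
    + A.pairing p (D.cov w u p) (v p) = 0 := h
  change A.pairing p (D.cov w u p) (v p)
    = A.pairing p (A.bracket u v p - D.cov u v p + D.cov v u p) (w p)
  simp only [map_sub, map_add, LinearMap.sub_apply, LinearMap.add_apply] at h' ⊢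
  linarith

theorem pair_cov_smul (D : A.Connection) (f : C^∞⟮𝓡 n, M; ℝ⟯) (t x y : Cₛ^∞⟮𝓡 n; F, E⟯) (p : M) :
    A.pair (D.cov t (f • x)) y p = f p * A.pair (D.cov t x) y p + A.pair x y p * A.rho t f p := by
  rw [D.map_smul, pair_add_left, pair_smul_left, pair_smul_left, mul_comm (A.pair x y p)]

theorem isTensorial_riemann_first (D : A.Connection) (z x y : Cₛ^∞⟮𝓡 n; F, E⟯) :
    IsTensorial fun w => D.riemann w z x y where
  add w w' p := by
    simp only [riemann, comm_add_mid, pair_add, pair_add_left, mul_add, contract_add]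
    ring
  smul f w p := by
    have h := fun s t p => mul_left_comm (A.pair (D.cov t x) y p) (f p) (A.pair (D.cov s z) w p)
    simp only [riemann, comm_smul_mid, pair_smul, pair_smul_left, h, contract_mul]
    ring

theorem isTensorial_riemann_fourth (D : A.Connection) (w z x : Cₛ^∞⟮𝓡 n; F, E⟯) :
    IsTensorial fun y => D.riemann w z x y where
  add w w' p := by
    simp only [riemann, comm_add_mid, pair_add, pair_add_left, add_mul, contract_add]
    ring
  smul f w p := by
    simp only [riemann, comm_smul_mid, pair_smul, pair_smul_left, mul_assoc, contract_mul]
    ring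

theorem isTensorial_riemann_third (D : A.Connection) (hD : D.IsTorsionFree)
    (w z y : Cₛ^∞⟮𝓡 n; F, E⟯) : IsTensorial fun x => D.riemann w z x y where
  add w w' p := by
    simp only [riemann, comm_add_left, comm_add_right, map_add, pair_add, pair_add_left, add_mul,
      contract_add]
    ring
  smul f x p := by
    have h1 : A.pair y (D.comm z w (f • x)) p = f p * A.pair y (D.comm z w x) p
        + A.pair x y p * A.rho (A.bracket z w - D.cov z w + D.cov w z) f p := by
      rw [pair_apply, comm_smul_right, map_add, _root_.map_smul, _root_.map_smul,
        A.pair_symm x y, mul_comm (A.pair y x p)]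
      rfl
    have h2 : A.contract (fun s t p => A.pair (D.cov t (f • x)) y p * A.pair (D.cov s z) w p) p
        = f p * A.contract (fun s t p => A.pair (D.cov t x) y p * A.pair (D.cov s z) w p) p
          + A.pair x y p * A.rho (A.bracket z w - D.cov z w + D.cov w z) f p := by
      simp only [pair_cov_smul, add_mul, contract_add, mul_assoc, contract_mul, hD.pair_cov z w,
        contract_rho_right]
    simp only [riemann, comm_smul_left, h1, h2, pair_smul]
    ring

theorem isTensorial_riemann_second (D : A.Connection) (hD : D.IsTorsionFree)
    (w x y : Cₛ^∞⟮𝓡 n; F, E⟯) : IsTensorial fun z => D.riemann w z x y where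
  add w w' p := by
    simp only [riemann, comm_add_left, comm_add_right, map_add, pair_add, pair_add_left, mul_add,
      contract_add]
    ring
  smul f z p := by
    have h1 : A.pair w (D.comm x y (f • z)) p = f p * A.pair w (D.comm x y z) p
        + A.pair z w p * A.rho (A.bracket x y - D.cov x y + D.cov y x) f p := by
      rw [pair_apply, comm_smul_right, map_add, _root_.map_smul, _root_.map_smul,
        A.pair_symm z w, mul_comm (A.pair w z p)]
      rfl
    have h2 : A.contract (fun s t p => A.pair (D.cov t x) y p * A.pair (D.cov s (f • z)) w p) p
        = f p * A.contract (fun s t p => A.pair (D.cov t x) y p * A.pair (D.cov s z) w p) p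
          + A.pair z w p * A.rho (A.bracket x y - D.cov x y + D.cov y x) f p := by
      have h : ∀ s t p, A.pair (D.cov t x) y p * A.pair (D.cov s (f • z)) w p
          = f p * (A.pair (D.cov t x) y p * A.pair (D.cov s z) w p) + A.pair z w p
            * (A.rho s f p * A.pair (A.bracket x y - D.cov x y + D.cov y x) t p) := by
        intro s t p
        rw [← hD.pair_cov x y, pair_cov_smul]
        ring
      simp only [h, contract_add, contract_mul, contract_rho_left]
    simp only [riemann, comm_smul_left, h1, h2, pair_smul]
    ring

theorem contMDiff_riemann (D : A.Connection) (w z x y : Cₛ^∞⟮𝓡 n; F, E⟯) :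
    ContMDiff (𝓡 n) 𝓘(ℝ, ℝ) ∞ (D.riemann w z x y) := by
  refine contMDiff_const.mul ((((A.pair w _).contMDiff.add (A.pair y _).contMDiff)).sub
    (A.contMDiff_contract ?_ ?_ ?_))
  · refine fun v => ⟨fun s s' p => ?_, fun f s p => ?_⟩
    · simp only [map_add, LinearMap.add_apply, pair_add_left, mul_add]
    · simp only [D.smul_left, pair_smul_left]; ring
  · refine fun v => ⟨fun s s' p => ?_, fun f s p => ?_⟩
    · simp only [map_add, LinearMap.add_apply, pair_add_left, add_mul]
    · simp only [D.smul_left, pair_smul_left]; ring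
  · exact fun s t => (A.pair _ _).contMDiff.mul (A.pair _ _).contMDiff

/-- The full Ricci tensor as a bilinear form, `⟨v, Ric(u)⟩ = riemann(e^α, v, e_α, u)`. -/
def fullRicciForm (D : A.Connection) (v u : Cₛ^∞⟮𝓡 n; F, E⟯) : M → ℝ :=
  A.contract fun s t => D.riemann s v t u

theorem isTensorial_fullRicciForm (D : A.Connection) (hD : D.IsTorsionFree)
    (u : Cₛ^∞⟮𝓡 n; F, E⟯) : IsTensorial fun v => D.fullRicciForm v u where
  add v v' p := by
    simp only [fullRicciForm, contract, (D.isTensorial_riemann_second hD _ _ _).add,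
      Finset.sum_add_distrib]
  smul f v p := by
    simp only [fullRicciForm, contract, (D.isTensorial_riemann_second hD _ _ _).smul,
      Finset.mul_sum]

theorem isTensorial_fullRicciForm_right (D : A.Connection)
    (v : Cₛ^∞⟮𝓡 n; F, E⟯) : IsTensorial fun u => D.fullRicciForm v u where
  add u u' p := by
    simp only [fullRicciForm, contract, (D.isTensorial_riemann_fourth _ _ _).add,
      Finset.sum_add_distrib]
  smul f u p := by
    simp only [fullRicciForm, contract, (D.isTensorial_riemann_fourth _ _ _).smul,
      Finset.mul_sum]

/-- The full Ricci tensor of a torsion-free connection as an endomorphism of sections. -/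
def fullRicci (D : A.Connection) (hD : D.IsTorsionFree) (u : Cₛ^∞⟮𝓡 n; F, E⟯) :
    Cₛ^∞⟮𝓡 n; F, E⟯ :=
  ⟨A.sharp fun v => D.fullRicciForm v u,
    A.contMDiff_sharp (D.isTensorial_fullRicciForm hD u) fun _ =>
      A.contMDiff_contract (fun _ => D.isTensorial_riemann_first _ _ _)
        (fun _ => D.isTensorial_riemann_third hD _ _ _) fun _ _ => D.contMDiff_riemann _ _ _ _⟩

theorem pair_fullRicci (D : A.Connection) (hD : D.IsTorsionFree) (v u : Cₛ^∞⟮𝓡 n; F, E⟯) (p : M) :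
    A.pair v (D.fullRicci hD u) p = D.fullRicciForm v u p := by
  rw [pair_symm]
  exact A.pairing_sharp (D.isTensorial_fullRicciForm hD u) v p

/-- The divergence of a connection, `D_α u^α`. -/
def div (D : A.Connection) (u : Cₛ^∞⟮𝓡 n; F, E⟯) : M → ℝ :=
  A.contract fun s t => A.pair s (D.cov t u)

end Connection

/-- A generalized pseudometric: a smooth symmetric endomorphism `G` of `E` with `G² = 1`, whose
eigenbundles `V_±` have ranks different from one. -/
structure Pseudometric (A : CourantAlgebroid n F E) where
  map (x : M) : E x →ₗ[ℝ] E x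
  map_smooth (u : Cₛ^∞⟮𝓡 n; F, E⟯) : ContMDiff (𝓡 n) ((𝓡 n).prod 𝓘(ℝ, F)) ∞
    fun x => (TotalSpace.mk' F x (map x (u x)) : TotalSpace F E)
  symmetric (x : M) (a b : E x) : A.pairing x (map x a) b = A.pairing x a (map x b)
  involutive (x : M) (a : E x) : map x (map x a) = a
  rank_plus (x : M) : Module.finrank ℝ (Module.End.eigenspace (map x) 1) ≠ 1
  rank_minus (x : M) : Module.finrank ℝ (Module.End.eigenspace (map x) (-1)) ≠ 1

/-- The action of a pseudometric on sections. -/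
def Pseudometric.act {A : CourantAlgebroid n F E} (G : A.Pseudometric)
    (u : Cₛ^∞⟮𝓡 n; F, E⟯) : Cₛ^∞⟮𝓡 n; F, E⟯ := ⟨fun x => G.map x (u x), G.map_smooth u⟩

namespace Connection

variable {A : CourantAlgebroid n F E}

/-- The covariant derivative `(D_u T) v` of an endomorphism `T`. -/
def covEnd (D : A.Connection) (T : Cₛ^∞⟮𝓡 n; F, E⟯ → Cₛ^∞⟮𝓡 n; F, E⟯)
    (u v : Cₛ^∞⟮𝓡 n; F, E⟯) : Cₛ^∞⟮𝓡 n; F, E⟯ :=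
  D.cov u (T v) - T (D.cov u v)

/-- `D` is a Levi-Civita connection of `G`: it is torsion-free and `D G = 0`. -/
structure IsLeviCivita (D : A.Connection) (G : A.Pseudometric) : Prop where
  torsionFree : D.IsTorsionFree
  compatible : ∀ u v, D.covEnd G.act u v = 0

/-- The generalized Ricci tensor `Ric - G Ric G`, where `Ric` is the full Ricci tensor. -/
def ricci (D : A.Connection) (hD : D.IsTorsionFree) (G : A.Pseudometric)
    (u : Cₛ^∞⟮𝓡 n; F, E⟯) : Cₛ^∞⟮𝓡 n; F, E⟯ :=
  D.fullRicci hD u - G.act (D.fullRicci hD (G.act u))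

/-- The generalized scalar curvature `Tr(G Ric)`, where `Ric` is the full Ricci tensor. -/
def scalar (D : A.Connection) (hD : D.IsTorsionFree) (G : A.Pseudometric) :
    C^∞⟮𝓡 n, M; ℝ⟯ :=
  ⟨A.contract fun s t => A.pair s (G.act (D.fullRicci hD t)), by
    have h : ∀ s t, (A.pair s (G.act (D.fullRicci hD t)) : M → ℝ)
        = D.fullRicciForm (G.act s) t := by
      intro s t
      funext p
      rw [← D.pair_fullRicci hD]
      exact (G.symmetric p _ _).symm
    refine A.contMDiff_contract (fun t => ?_) (fun s => ?_) fun s t => (A.pair _ _).contMDiff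
    · exact ⟨fun _ _ _ => A.pair_add_left _ _ _ _, fun _ _ _ => A.pair_smul_left _ _ _ _⟩
    · simp only [h]
      exact D.isTensorial_fullRicciForm_right (G.act s)⟩

end Connection
end CourantAlgebroid
end Algebroid

section Densities

/-- The tangent vector at `x` whose components in the chart at `x₀` are given by `a`. -/
def coordVec {n : ℕ} {M : Type*} [TopologicalSpace M]
    [ChartedSpace (EuclideanSpace ℝ (Fin n)) M] [IsManifold (𝓡 n) ∞ M]
    (x₀ x : M) (a : EuclideanSpace ℝ (Fin n)) : TangentSpace (𝓡 n) x :=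
  (trivializationAt (EuclideanSpace ℝ (Fin n)) (TangentSpace (𝓡 n)) x₀).symm x a

/-- The components of the tangent vector `v` at `x` in the chart at `x₀`. -/
def coordOf {n : ℕ} {M : Type*} [TopologicalSpace M]
    [ChartedSpace (EuclideanSpace ℝ (Fin n)) M] [IsManifold (𝓡 n) ∞ M]
    (x₀ x : M) (v : TangentSpace (𝓡 n) x) : EuclideanSpace ℝ (Fin n) :=
  (trivializationAt (EuclideanSpace ℝ (Fin n)) (TangentSpace (𝓡 n)) x₀
    (⟨x, v⟩ : TangentBundle (𝓡 n) M)).2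

/-- A smooth `w`-density on a manifold of dimension `n` (`w ≠ 0`): a function on `n`-tuples of
tangent vectors at each point that scales by `|det T| ^ w` under linear maps `T`. -/
structure Density (n : ℕ) (M : Type*) [TopologicalSpace M]
    [ChartedSpace (EuclideanSpace ℝ (Fin n)) M] [IsManifold (𝓡 n) ∞ M] (w : ℝ) where
  val (x : M) : (Fin n → TangentSpace (𝓡 n) x) → ℝ
  map_comp (x : M) (T : TangentSpace (𝓡 n) x →ₗ[ℝ] TangentSpace (𝓡 n) x)
    (v : Fin n → TangentSpace (𝓡 n) x) :
    val x (fun i => T (v i)) = |LinearMap.det T| ^ w * val x v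
  smooth (x₀ : M) : ContMDiffOn (𝓡 n) 𝓘(ℝ, ℝ) ∞
    (fun x => val x fun i => coordVec x₀ x (EuclideanSpace.single i 1))
    (chartAt (EuclideanSpace ℝ (Fin n)) x₀).source

variable {n : ℕ} {M : Type*} [TopologicalSpace M]
  [ChartedSpace (EuclideanSpace ℝ (Fin n)) M] [IsManifold (𝓡 n) ∞ M]

/-- The Lie derivative `L_X μ` of a `w`-density at `x₀`, computed in the chart at `x₀`:
`X(μ) + w (∂_i X^i) μ` on frames with constant components. -/
def Density.lieDeriv {w : ℝ} (μ : Density n M w) (X : ∀ x : M, TangentSpace (𝓡 n) x) (x₀ : M)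
    (v : Fin n → TangentSpace (𝓡 n) x₀) : ℝ :=
  dirDeriv (fun x => μ.val x fun i => coordVec x₀ x (coordOf x₀ x₀ (v i))) x₀ (X x₀)
    + w * LinearMap.trace ℝ (EuclideanSpace ℝ (Fin n))
        (fderiv ℝ (fun z => coordOf x₀ ((extChartAt (𝓡 n) x₀).symm z)
          (X ((extChartAt (𝓡 n) x₀).symm z))) (extChartAt (𝓡 n) x₀ x₀)).toLinearMap * μ.val x₀ v

/-- An everywhere positive half-density. -/
structure PositiveHalfDensity (n : ℕ) (M : Type*) [TopologicalSpace M]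
    [ChartedSpace (EuclideanSpace ℝ (Fin n)) M] [IsManifold (𝓡 n) ∞ M]
    extends Density n M (1 / 2) where
  pos (x : M) (v : Fin n → TangentSpace (𝓡 n) x) : LinearIndependent ℝ v → 0 < val x v

/-- The density `σ²`. -/
def PositiveHalfDensity.sq (σ : PositiveHalfDensity n M) : Density n M 1 where
  val x v := σ.val x v ^ 2
  map_comp x T v := by
    rw [σ.map_comp, mul_pow, ← Real.sqrt_eq_rpow, Real.sq_sqrt (abs_nonneg _), Real.rpow_one]
  smooth x₀ := (σ.smooth x₀).pow 2

/-- The function `σ⁻² L_X σ²`, evaluated on the coordinate frame of the chart at `x`. -/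
def PositiveHalfDensity.logLieDeriv (σ : PositiveHalfDensity n M)
    (X : ∀ x : M, TangentSpace (𝓡 n) x) (x : M) : ℝ :=
  σ.sq.lieDeriv X x (fun i => coordVec x x (EuclideanSpace.single i 1))
    / σ.sq.val x (fun i => coordVec x x (EuclideanSpace.single i 1))

/-- The divergence `u ↦ σ⁻² L_{ρ(u)} σ²` of a positive half-density. -/
def CourantAlgebroid.divOf {F : Type*} [NormedAddCommGroup F] [NormedSpace ℝ F]
    {E : M → Type*} [TopologicalSpace (TotalSpace F E)]
    [∀ x, TopologicalSpace (E x)] [FiberBundle F E]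
    [∀ x, AddCommGroup (E x)] [∀ x, Module ℝ (E x)] [VectorBundle ℝ F E]
    (A : CourantAlgebroid n F E) (σ : PositiveHalfDensity n M)
    (u : Cₛ^∞⟮𝓡 n; F, E⟯) : M → ℝ :=
  σ.logLieDeriv fun x => A.anchor x (u x)

end Densities

end Courant

end

/-! Near each point there is a frame e_i of eigensections of G, with eigenvalues s_i = ±1, that is
orthogonal with constant norms; its structure functions c_ijk = ⟨[e_i, e_j], e_k⟩ are therefore
totally antisymmetric. A Levi-Civita connection of G is not unique. Compatibility and vanishing
torsion nevertheless force its coefficients γ_ijk to vanish when s_j ≠ s_k and to equal c_ijk when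
s_i ≠ s_j = s_k, and the traces of γ are the divergences d_k of the e_k. The remaining freedom drops
out of the statement. Rc only has components between V_+ and V_-, and these are expressions in c, d
and their first derivatives (`ricci_mixed`, `pair_ricci`). The same holds for the partial traces R_±
of FRc over V_± (`sum_ricci_self`), and the scalar curvature is R_+ - R_-.

The theorem thus becomes an identity between the values at a point of c, d and their derivatives up
to second order, collected in `Jet`. The relations available are the Jacobi identity, the
commutation rule for derivatives along the frame (the anchor is a bracket morphism), and div[u,v] =
ρ(u) div v - ρ(v) div u, which holds for the divergence of a density. The right side of the last
relation is antisymmetric in u and v, so div annihilates [u,v] + [v,u] = 𝒟⟨u,v⟩; hence the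
second-order operator f ↦ div 𝒟f is zero (`laplacian_eq_zero`).

For e_k in V_s two identities carry the proof. First, the divergence of the mixed Ricci components
over V_{-s} is half of ∂_k R_{-s} (`div_mixedRicci`); this rests on a weighted contraction of the
Jacobi identity with c. Secondly, ∂_k (R_+ + R_-) = 0 (`derivScalar_total`). Rc is twice the mixed
part and G contributes the sign -s, so the left side of the theorem is -s ∂_k R_{-s}. By the second
identity the right side, ½ s ∂_k (R_s - R_{-s}), has the same value. Both sides are linear over
smooth functions in v, so the frame sections suffice. -/

set_option linter.unusedSectionVars false

noncomputable section

namespace Courant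

/-! ### Algebra of structure constants, their derivatives and a divergence. -/

namespace FrameAlgebra

variable {ι : Type*} [Fintype ι]

theorem sum_swap₁₂ (F : ι → ι → ι → ℝ) :
    ∑ a, ∑ b, ∑ e, F a b e = ∑ a, ∑ b, ∑ e, F b a e := Finset.sum_comm

theorem sum_swap₂₃ (F : ι → ι → ι → ℝ) :
    ∑ a, ∑ b, ∑ e, F a b e = ∑ a, ∑ b, ∑ e, F a e b :=
  Finset.sum_congr rfl fun _ _ => Finset.sum_comm

theorem sum_swap₁₃ (F : ι → ι → ι → ℝ) :
    ∑ a, ∑ b, ∑ e, F a b e = ∑ a, ∑ b, ∑ e, F e b a := by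
  rw [sum_swap₁₂, sum_swap₂₃, sum_swap₁₂]

theorem sum_eq_zero_of_antisymm {F : ι → ι → ℝ} (h : ∀ a b, F a b = -F b a) :
    ∑ a, ∑ b, F a b = 0 := by
  have h1 : ∑ a, ∑ b, F a b = ∑ a, ∑ b, F b a := Finset.sum_comm
  have h2 : ∑ a, ∑ b, F b a = -∑ a, ∑ b, F a b := by
    simp only [← Finset.sum_neg_distrib]
    exact Finset.sum_congr rfl fun a _ => Finset.sum_congr rfl fun b _ => h b a
  linarith

/-- A family of numbers with three indices is totally antisymmetric. -/
structure Alternating (c : ι → ι → ι → ℝ) : Prop where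
  swap₁₂ : ∀ i j k, c i j k = -c j i k
  swap₂₃ : ∀ i j k, c i j k = -c i k j

namespace Alternating

variable {c : ι → ι → ι → ℝ}

theorem rotate (hc : Alternating c) (i j k : ι) : c i j k = c j k i := by
  rw [hc.swap₁₂ i, hc.swap₂₃ j, neg_neg]

theorem swap₁₃ (hc : Alternating c) (i j k : ι) : c i j k = -c k j i := by
  rw [hc.rotate, hc.swap₁₂]

/-- Contraction of a four-index quantity, alternating in its last three indices, with `c`. -/
theorem sum_mul_jacobi (hc : Alternating c) {dc : ι → ι → ι → ι → ℝ}
    (hdc : ∀ l, Alternating (dc l)) (k : ι)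
    (w m : ι → ℝ) :
    ∑ a, ∑ b, ∑ e, w a * m b * m e * c a b e
        * (dc k a b e - dc a k b e + dc b k a e - dc e k a b)
      = ∑ a, ∑ b, ∑ e, w a * m b * m e * c a b e * dc k a b e
        - ∑ a, ∑ b, ∑ e, m a * m b * w e * c a b e * dc e k a b
        - 2 * ∑ a, ∑ b, ∑ e, m a * m b * w e * c a b e * dc a k b e := by
  have h2 : ∑ a, ∑ b, ∑ e, m a * m b * w e * c a b e * dc e k a b
      = ∑ a, ∑ b, ∑ e, w a * m b * m e * c a b e * dc a k b e := by
    rw [sum_swap₁₃, sum_swap₂₃]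
    refine Finset.sum_congr rfl fun a _ => Finset.sum_congr rfl fun b _ =>
      Finset.sum_congr rfl fun e _ => ?_
    rw [← hc.rotate a b e]; ring
  have h3 : ∑ a, ∑ b, ∑ e, m a * m b * w e * c a b e * dc a k b e
      = -∑ a, ∑ b, ∑ e, w a * m b * m e * c a b e * dc b k a e := by
    simp only [← Finset.sum_neg_distrib]
    rw [sum_swap₁₃, sum_swap₂₃, sum_swap₂₃, sum_swap₂₃]
    refine Finset.sum_congr rfl fun a _ => Finset.sum_congr rfl fun b _ =>
      Finset.sum_congr rfl fun e _ => ?_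
    rw [← hc.rotate a b e, (hdc b).swap₂₃ k a e]; ring
  -- Both b and e carry the weight m, so exchanging them identifies the last two derivative terms;
  -- this is the origin of the factor 2.
  have h4 : ∑ a, ∑ b, ∑ e, w a * m b * m e * c a b e * dc b k a e
      = -∑ a, ∑ b, ∑ e, w a * m b * m e * c a b e * dc e k a b := by
    simp only [← Finset.sum_neg_distrib]
    rw [sum_swap₂₃]
    refine Finset.sum_congr rfl fun a _ => Finset.sum_congr rfl fun b _ =>
      Finset.sum_congr rfl fun e _ => ?_
    rw [hc.swap₂₃ a b e]; ring
  have h5 : ∑ a, ∑ b, ∑ e, w a * m b * m e * c a b e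
        * (dc k a b e - dc a k b e + dc b k a e - dc e k a b)
      = ∑ a, ∑ b, ∑ e, w a * m b * m e * c a b e * dc k a b e
        - ∑ a, ∑ b, ∑ e, w a * m b * m e * c a b e * dc a k b e
        + ∑ a, ∑ b, ∑ e, w a * m b * m e * c a b e * dc b k a e
        - ∑ a, ∑ b, ∑ e, w a * m b * m e * c a b e * dc e k a b := by
    simp only [← Finset.sum_add_distrib, ← Finset.sum_sub_distrib]
    refine Finset.sum_congr rfl fun a _ => Finset.sum_congr rfl fun b _ =>
      Finset.sum_congr rfl fun e _ => ?_
    ring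
  rw [h5, h2, h3]
  linarith

/-- Cubic expressions of the form `c_{abe} c_{kan} c_{ben}` change sign when the weights of `a` and
`n` are exchanged. -/
theorem sum_cubic_swap (hc : Alternating c) (k : ι) (w m u : ι → ℝ) :
    ∑ a, ∑ b, ∑ e, w a * m b * m e * ∑ n, u n * (c a b e * c k a n * c b e n)
      = -∑ a, ∑ b, ∑ e, u a * m b * m e * ∑ n, w n * (c a b e * c k a n * c b e n) := by
  have key : ∀ w u : ι → ℝ, ∑ a, ∑ b, ∑ e, w a * m b * m e * ∑ n, u n * (c a b e * c k a n * c b e n)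
      = ∑ a, ∑ n, ∑ b, ∑ e, w a * u n * m b * m e * (c a b e * c k a n * c b e n) := by
    intro w u
    refine Finset.sum_congr rfl fun a _ => ?_
    simp only [Finset.mul_sum]
    rw [Finset.sum_comm]
    have : ∀ e b, ∑ n, w a * m b * m e * (u n * (c a b e * c k a n * c b e n))
      = ∑ n, w a * u n * m b * m e * (c a b e * c k a n * c b e n) :=
      fun e b => Finset.sum_congr rfl fun n _ => by ring
    simp only [this]
    rw [sum_swap₁₃]
  rw [key, key, Finset.sum_comm]
  simp only [← Finset.sum_neg_distrib]
  refine Finset.sum_congr rfl fun a _ => Finset.sum_congr rfl fun n _ =>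
      Finset.sum_congr rfl fun b _ => Finset.sum_congr rfl fun e _ => ?_
  -- Under a ↔ n the product c_abe c_ben is invariant, being c_abe c_nbe, while c_kan changes sign.
  rw [hc.rotate a b e, ← hc.rotate n b e, hc.swap₂₃ k a n]; ring

/-- The quadratic right-hand side of the Jacobi identity, contracted with `c`. -/
theorem sum_mul_quadratic (hc : Alternating c) (k : ι) (w m η : ι → ℝ) :
    ∑ a, ∑ b, ∑ e, w a * m b * m e * c a b e
        * ∑ n, η n * (c a b n * c k e n + c k a n * c b e n - c k b n * c a e n)
      = ∑ a, ∑ b, ∑ e, w a * m b * m e * ∑ n, η n * (c a b e * c k a n * c b e n)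
        + 2 * ∑ a, ∑ b, ∑ e, m a * m b * w e * ∑ n, η n * (c a b e * c k a n * c b e n) := by
  have h1 : ∑ a, ∑ b, ∑ e, m a * m b * w e * ∑ n, η n * (c a b e * c k a n * c b e n)
      = ∑ a, ∑ b, ∑ e, w a * m b * m e * ∑ n, η n * (c a b e * c a b n * c k e n) := by
    rw [sum_swap₁₃]
    refine Finset.sum_congr rfl fun a _ => Finset.sum_congr rfl fun b _ =>
      Finset.sum_congr rfl fun e _ => ?_
    simp only [Finset.mul_sum]
    refine Finset.sum_congr rfl fun n _ => ?_
    rw [hc.swap₁₃ e b a, hc.swap₁₂ b a n]; ring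
  -- Exchanging b and e, which have equal weights, shows that the first and third quadratic terms
  -- contribute equally.
  have h2 : ∑ a, ∑ b, ∑ e, w a * m b * m e * ∑ n, η n * (c a b e * c a b n * c k e n)
      = -∑ a, ∑ b, ∑ e, w a * m b * m e * ∑ n, η n * (c a b e * c k b n * c a e n) := by
    simp only [← Finset.sum_neg_distrib]
    rw [sum_swap₂₃]
    refine Finset.sum_congr rfl fun a _ => Finset.sum_congr rfl fun b _ =>
      Finset.sum_congr rfl fun e _ => ?_
    rw [← mul_neg, ← Finset.sum_neg_distrib]
    simp only [Finset.mul_sum]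
    refine Finset.sum_congr rfl fun n _ => ?_
    rw [hc.swap₂₃ a e b]; ring
  have h3 : ∑ a, ∑ b, ∑ e, w a * m b * m e * c a b e
        * ∑ n, η n * (c a b n * c k e n + c k a n * c b e n - c k b n * c a e n)
      = ∑ a, ∑ b, ∑ e, w a * m b * m e * ∑ n, η n * (c a b e * c k a n * c b e n)
        + ∑ a, ∑ b, ∑ e, w a * m b * m e * ∑ n, η n * (c a b e * c a b n * c k e n)
        - ∑ a, ∑ b, ∑ e, w a * m b * m e * ∑ n, η n * (c a b e * c k b n * c a e n) := by
    simp only [Finset.mul_sum, ← Finset.sum_add_distrib, ← Finset.sum_sub_distrib]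
    refine Finset.sum_congr rfl fun a _ => Finset.sum_congr rfl fun b _ =>
      Finset.sum_congr rfl fun e _ => Finset.sum_congr rfl fun n _ => ?_
    ring
  rw [h3, h1]
  linarith

/-- The contracted Jacobi identity with all weights equal. -/
theorem jacobi_contract (hc : Alternating c) {dc : ι → ι → ι → ι → ℝ}
    (hdc : ∀ l, Alternating (dc l)) (k : ι)
    (η : ι → ℝ) (hJ : ∀ a b e, dc k a b e - dc a k b e + dc b k a e - dc e k a b
      = ∑ n, η n * (c a b n * c k e n + c k a n * c b e n - c k b n * c a e n)) :
    ∑ a, ∑ b, ∑ e, η a * η b * η e * c a b e * dc k a b e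
      = 3 * ∑ a, ∑ b, ∑ e, η a * η b * η e * c a b e * dc e k a b := by
  have h := hc.sum_mul_jacobi hdc k η η
  simp only [hJ, hc.sum_mul_quadratic] at h
  -- With equal weights the cubic sum is its own negative, so the whole quadratic side vanishes.
  have h0 := hc.sum_cubic_swap k η η η
  have h1 : ∑ a, ∑ b, ∑ e, η a * η b * η e * c a b e * dc a k b e
      = ∑ a, ∑ b, ∑ e, η a * η b * η e * c a b e * dc e k a b := by
    rw [sum_swap₁₃, sum_swap₁₂]
    refine Finset.sum_congr rfl fun a _ => Finset.sum_congr rfl fun b _ =>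
      Finset.sum_congr rfl fun e _ => ?_
    rw [hc.rotate e a b]; ring
  linarith

/-- The contracted Jacobi identity with mixed weights. -/
theorem jacobi_contract_mixed (hc : Alternating c) {dc : ι → ι → ι → ι → ℝ}
    (hdc : ∀ l, Alternating (dc l)) (k : ι)
    (p m : ι → ℝ) (hJ : ∀ a b e, dc k a b e - dc a k b e + dc b k a e - dc e k a b
      = ∑ n, (p n + m n) * (c a b n * c k e n + c k a n * c b e n - c k b n * c a e n)) :
    1 / 6 * ∑ a, ∑ b, ∑ e, m a * m b * m e * c a b e * dc k a b e
        + 1 / 2 * ∑ a, ∑ b, ∑ e, p a * m b * m e * c a b e * dc k a b e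
      = 1 / 2 * ∑ a, ∑ b, ∑ e, m a * m b * m e * c a b e * dc e k a b
        + 1 / 2 * ∑ a, ∑ b, ∑ e, m a * m b * p e * c a b e * dc e k a b
        + ∑ a, ∑ b, ∑ e, m a * m b * p e * c a b e * dc a k b e
        + ∑ a, ∑ b, ∑ e, m a * m b * p e * ∑ n, p n * (c a b e * c k a n * c b e n) := by
  have hsplit : ∀ u v w : ι → ℝ,
      ∑ a, ∑ b, ∑ e, u a * v b * w e * ∑ n, (p n + m n) * (c a b e * c k a n * c b e n)
      = ∑ a, ∑ b, ∑ e, u a * v b * w e * ∑ n, p n * (c a b e * c k a n * c b e n)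
        + ∑ a, ∑ b, ∑ e, u a * v b * w e * ∑ n, m n * (c a b e * c k a n * c b e n) := by
    intro u v w
    simp only [add_mul, mul_add, Finset.sum_add_distrib]
  -- The claim is 1/6 of the contraction with weights (m, m, m) plus 1/2 of the one with weights (p,
  -- m, m). These factors make the cubic sums with three weights m and one weight p cancel, by `h3`;
  -- of the cubic sums only the one with p on both e and n survives.
  have hm := hc.sum_mul_jacobi hdc k m m
  have hp := hc.sum_mul_jacobi hdc k p m
  simp only [hJ, hc.sum_mul_quadratic, hsplit] at hm hp
  have h1 : ∑ a, ∑ b, ∑ e, m a * m b * m e * c a b e * dc a k b e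
      = ∑ a, ∑ b, ∑ e, m a * m b * m e * c a b e * dc e k a b := by
    rw [sum_swap₁₃, sum_swap₁₂]
    refine Finset.sum_congr rfl fun a _ => Finset.sum_congr rfl fun b _ =>
      Finset.sum_congr rfl fun e _ => ?_
    rw [hc.rotate e a b]; ring
  have h2 := hc.sum_cubic_swap k m m m
  have h3 := hc.sum_cubic_swap k p m m
  have h4 := hc.sum_cubic_swap k p m p
  -- Here a and n have the same weight, and the summand is antisymmetric in them.
  have h5 : ∑ a, ∑ b, ∑ e, m a * m b * p e * ∑ n, m n * (c a b e * c k a n * c b e n) = 0 := by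
    have : ∀ a b e, m a * m b * p e * ∑ n, m n * (c a b e * c k a n * c b e n)
      = ∑ n, m a * m b * p e * m n * (c a b e * c k a n * c b e n) := fun a b e => by
        rw [Finset.mul_sum]; exact Finset.sum_congr rfl fun n _ => by ring
    simp only [this]
    rw [Finset.sum_comm]
    refine Finset.sum_eq_zero fun b _ => ?_
    rw [Finset.sum_comm]
    refine Finset.sum_eq_zero fun e _ => ?_
    refine sum_eq_zero_of_antisymm fun a n => ?_
    rw [hc.swap₂₃ k n a, ← hc.rotate n b e, ← hc.rotate a b e]; ring
  linarith

end Alternating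

/-- The values, at a point, of the structure functions of a Courant algebroid in an orthonormal
frame with `⟨e_i, e_i⟩ = η_i`, of the components `d` of a divergence, and of their derivatives along
the frame, together with the identities satisfied by the structure functions. -/
structure Jet (η : ι → ℝ) where
  c : ι → ι → ι → ℝ
  dc : ι → ι → ι → ι → ℝ
  ddc : ι → ι → ι → ι → ι → ℝ
  d : ι → ℝ
  dd : ι → ι → ℝ
  ddd : ι → ι → ι → ℝ
  alt : Alternating c
  alt_dc : ∀ l, Alternating (dc l)
  alt_ddc : ∀ i l, Alternating (ddc i l)
  comm_c : ∀ i j a b e, ddc i j a b e - ddc j i a b e = ∑ n, η n * (c i j n * dc n a b e)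
  comm_d : ∀ i j a, ddd i j a - ddd j i a = ∑ n, η n * (c i j n * dd n a)
  jacobi : ∀ k a b e, dc k a b e - dc a k b e + dc b k a e - dc e k a b
    = ∑ n, η n * (c a b n * c k e n + c k a n * c b e n - c k b n * c a e n)

namespace Jet

variable {η : ι → ℝ} (J : Jet η)

/-- Since c_kab is antisymmetric in a and b, only the commutator of the two derivatives survives,
and it is again a first derivative along [e_a, e_b]. -/
theorem sum_ddc (m : ι → ℝ) (k : ι) :
    ∑ a, ∑ b, m a * m b * J.ddc a b k a b
      = 1 / 2 * ∑ a, ∑ b, m a * m b * ∑ n, η n * (J.c a b n * J.dc n k a b) := by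
  have h : ∑ a, ∑ b, m a * m b * J.ddc a b k a b = -∑ a, ∑ b, m a * m b * J.ddc b a k a b := by
    rw [Finset.sum_comm]
    simp only [← Finset.sum_neg_distrib]
    refine Finset.sum_congr rfl fun a _ => Finset.sum_congr rfl fun b _ => ?_
    rw [(J.alt_ddc _ _).swap₂₃]; ring
  simp only [← J.comm_c, mul_sub, Finset.sum_sub_distrib]
  linarith

/-- The components `⟨e_a, Ric e_b⟩` of the generalized Ricci tensor (up to a factor), `a` and `b`
belonging to different eigenbundles; `m` and `p` are the weights of the eigenbundles of `e_a` and
`e_b`. -/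
def mixedRicci (p m : ι → ℝ) (a b : ι) : ℝ :=
  -J.dd b a + ∑ e, m e * J.dc e b a e + ∑ e, m e * (J.c b a e * J.d e)
    + ∑ e, ∑ f, m e * p f * (J.c b e f * J.c a e f)

/-- The derivative of `mixedRicci` along the frame. -/
def derivMixedRicci (p m : ι → ℝ) (l a b : ι) : ℝ :=
  -J.ddd l b a + ∑ e, m e * J.ddc l e b a e
    + ∑ e, m e * (J.dc l b a e * J.d e + J.c b a e * J.dd l e)
    + ∑ e, ∑ f, m e * p f * (J.dc l b e f * J.c a e f + J.c b e f * J.dc l a e f)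

/-- The derivative of the partial scalar curvature. -/
def derivScalar (p m : ι → ℝ) (k : ι) : ℝ :=
  -2 * ∑ a, m a * J.ddd k a a - 2 * ∑ a, m a * (J.d a * J.dd k a)
    + 1 / 3 * ∑ a, ∑ b, ∑ e, m a * m b * m e * J.c a b e * J.dc k a b e
    + ∑ a, ∑ b, ∑ e, p a * m b * m e * J.c a b e * J.dc k a b e

/-- The divergence of `mixedRicci` is half the derivative of the partial scalar curvature. -/
theorem div_mixedRicci {p m : ι → ℝ} (hη : ∀ i, η i = p i + m i) (k : ι) :
    2 * (∑ a, m a * J.derivMixedRicci p m a a k + ∑ a, m a * J.d a * J.mixedRicci p m a k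
      - ∑ a, ∑ b, m a * p b * J.c a k b * J.mixedRicci p m a b) = J.derivScalar p m k := by
  have hmix := J.alt.jacobi_contract_mixed J.alt_dc k p m
    (fun a b e => by simpa only [hη] using J.jacobi k a b e)
  set S1 := ∑ a, m a * J.ddd a k a with hS1
  set S2 := ∑ a, ∑ b, m a * m b * J.ddc a b k a b with hS2
  set S3 := ∑ a, ∑ b, m a * m b * (J.dc a k a b * J.d b) with hS3
  set S4 := ∑ a, ∑ b, m a * m b * (J.c k a b * J.dd a b) with hS4
  set S5 := ∑ a, ∑ b, ∑ f, m a * m b * p f * J.c a b f * J.dc a k b f with hS5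
  set S6 := ∑ a, ∑ b, ∑ f, m a * m b * p f * (J.c k b f * J.dc a a b f) with hS6
  set S7 := ∑ a, m a * (J.d a * J.dd k a) with hS7
  set S8 := ∑ a, ∑ e, m a * m e * (J.d a * J.dc e k a e) with hS8
  set S9 := ∑ a, ∑ e, m a * m e * (J.d a * J.c k a e * J.d e) with hS9
  set S10 := ∑ a, ∑ e, ∑ f, m a * m e * p f * (J.d a * J.c k e f * J.c a e f) with hS10
  set S11 := ∑ a, ∑ b, m a * p b * (J.c a k b * J.dd b a) with hS11
  set S12 := ∑ a, ∑ b, ∑ e, m a * p b * m e * (J.c a k b * J.dc e b a e) with hS12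
  set S13 := ∑ a, ∑ b, ∑ e, m a * p b * m e * (J.c a k b * J.c b a e * J.d e) with hS13
  set S14 := ∑ a, ∑ b, ∑ e, ∑ f, m a * p b * m e * p f
    * (J.c a k b * J.c b e f * J.c a e f) with hS14
  have hA : ∑ a, m a * J.derivMixedRicci p m a a k = -S1 + S2 + S3 + S4 + S5 + S6 := by
    simp only [hS1, hS2, hS3, hS4, hS5, hS6, derivMixedRicci, Finset.mul_sum, mul_add,
      Finset.sum_add_distrib, ← Finset.sum_neg_distrib, mul_neg,
      mul_assoc, mul_comm, mul_left_comm]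
    ring
  have hB : ∑ a, m a * J.d a * J.mixedRicci p m a k = -S7 + S8 + S9 + S10 := by
    simp only [hS7, hS8, hS9, hS10, mixedRicci, Finset.mul_sum, mul_add,
      Finset.sum_add_distrib, ← Finset.sum_neg_distrib, mul_neg,
      mul_assoc, mul_comm, mul_left_comm]
  have hC : ∑ a, ∑ b, m a * p b * J.c a k b * J.mixedRicci p m a b = -S11 + S12 + S13 + S14 := by
    simp only [hS11, hS12, hS13, hS14, mixedRicci, Finset.mul_sum, mul_add,
      Finset.sum_add_distrib, ← Finset.sum_neg_distrib, mul_neg,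
      mul_assoc, mul_comm, mul_left_comm]
  -- Commuting ∂_a with ∂_k on d_a produces derivatives along [e_a, e_k]. Its component with weight
  -- p is the term `S11` of `hC`, the one with weight m cancels `S4` of `hA`.
  have h1 : S1 = ∑ a, m a * J.ddd k a a + S11 + S4 := by
    have h : ∀ a, J.ddd a k a = J.ddd k a a + ∑ n, η n * (J.c a k n * J.dd n a) := fun a => by
      rw [← J.comm_d]; ring
    have h' : S4 = ∑ a, ∑ n, m a * m n * (J.c a k n * J.dd n a) := by
      rw [hS4, Finset.sum_comm]
      refine Finset.sum_congr rfl fun a _ => Finset.sum_congr rfl fun b _ => ?_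
      rw [J.alt.rotate a k b]; ring
    rw [h']
    simp only [hS1, h, hS11, hη, Finset.mul_sum, mul_add, add_mul, Finset.sum_add_distrib, add_assoc]
    ring_nf
  have h2 : S2 = 1 / 2 * ∑ a, ∑ b, ∑ e, m a * m b * m e * J.c a b e * J.dc e k a b
        + 1 / 2 * ∑ a, ∑ b, ∑ e, m a * m b * p e * J.c a b e * J.dc e k a b := by
    rw [hS2, J.sum_ddc]
    simp only [hη, Finset.mul_sum, mul_add, add_mul, Finset.sum_add_distrib]
    ring_nf
  have h3 : S3 + S8 = 0 := by
    have : S8 = -S3 := by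
      rw [hS8, Finset.sum_comm]
      simp only [hS3, ← Finset.sum_neg_distrib]
      refine Finset.sum_congr rfl fun a _ => Finset.sum_congr rfl fun b _ => ?_
      rw [(J.alt_dc _).swap₂₃ k b a]; ring
    rw [this]; ring
  have h9 : S9 = 0 := sum_eq_zero_of_antisymm fun a b => by rw [J.alt.swap₂₃ k a b]; ring
  have h10 : S10 = S13 := by
    rw [hS10, sum_swap₁₃, sum_swap₁₂]
    refine Finset.sum_congr rfl fun a _ => Finset.sum_congr rfl fun b _ =>
      Finset.sum_congr rfl fun e _ => ?_
    rw [J.alt.swap₁₂ a k b, J.alt.rotate e a b, J.alt.swap₁₂ b a e]; ring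
  have h6 : S6 = S12 := by
    rw [hS6, sum_swap₁₃, sum_swap₁₂]
    refine Finset.sum_congr rfl fun a _ => Finset.sum_congr rfl fun b _ =>
      Finset.sum_congr rfl fun e _ => ?_
    rw [J.alt.swap₁₂ a k b, (J.alt_dc e).swap₁₃ b a e]; ring
  have h14 : S14 = -∑ a, ∑ b, ∑ e, m a * m b * p e
      * ∑ n, p n * (J.c a b e * J.c k a n * J.c b e n) := by
    simp only [hS14, ← Finset.sum_neg_distrib]
    refine Finset.sum_congr rfl fun a _ => ?_
    rw [sum_swap₁₂, sum_swap₂₃]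
    refine Finset.sum_congr rfl fun b _ => Finset.sum_congr rfl fun e _ => ?_
    rw [Finset.mul_sum, ← Finset.sum_neg_distrib]
    refine Finset.sum_congr rfl fun n _ => ?_
    rw [J.alt.swap₁₂ a k n, J.alt.rotate n b e]; ring
  -- After the cancellations, the terms without d are S2 + S5 - S14, which is the right side of the
  -- mixed contracted Jacobi identity `hmix`.
  rw [hA, hB, hC, derivScalar]
  linarith

/-- The total scalar curvature is constant along the frame. -/
theorem derivScalar_total (k : ι)
    (hdiv : ∀ i j, J.dd i j - J.dd j i = ∑ n, η n * (J.dc n i j n + J.c i j n * J.d n))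
    (hddiv : ∀ l i j, J.ddd l i j - J.ddd l j i
      = ∑ n, η n * (J.ddc l n i j n + (J.dc l i j n * J.d n + J.c i j n * J.dd l n)))
    (hlap : ∑ n, η n * (J.ddd n n k + J.d n * J.dd n k) = 0) :
    -2 * ∑ a, η a * J.ddd k a a - 2 * ∑ a, η a * (J.d a * J.dd k a)
      + 1 / 3 * ∑ a, ∑ b, ∑ e, η a * η b * η e * J.c a b e * J.dc k a b e = 0 := by
  have h1 := J.alt.jacobi_contract J.alt_dc k η (J.jacobi k)
  have h2 := J.sum_ddc η k
  -- The index k is moved from the outer derivative onto d: first by commuting ∂_k and ∂_a, then by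
  -- the formula for the divergence of a bracket. The traced second derivative then acts on d_k,
  -- where `hlap` removes it.
  have e1 : ∀ a, J.ddd k a a = J.ddd a a k
      + ∑ n, η n * (J.ddc a n k a n + (J.dc a k a n * J.d n + J.c k a n * J.dd a n))
      + ∑ n, η n * (J.c k a n * J.dd n a) := fun a => by
    rw [← J.comm_d, ← hddiv]; ring
  have e2 : ∀ a, J.dd k a = J.dd a k + ∑ n, η n * (J.dc n k a n + J.c k a n * J.d n) := fun a => by
    rw [← hdiv]; ring
  have h3 : ∑ a, ∑ n, η a * η n * (J.d a * J.dc n k a n)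
      = -∑ a, ∑ n, η a * η n * (J.dc a k a n * J.d n) := by
    rw [Finset.sum_comm]
    simp only [← Finset.sum_neg_distrib]
    refine Finset.sum_congr rfl fun a _ => Finset.sum_congr rfl fun b _ => ?_
    rw [(J.alt_dc _).swap₂₃ k b a]; ring
  have h4 : ∑ a, ∑ n, η a * η n * (J.c k a n * J.dd n a)
      = -∑ a, ∑ n, η a * η n * (J.c k a n * J.dd a n) := by
    rw [Finset.sum_comm]
    simp only [← Finset.sum_neg_distrib]
    refine Finset.sum_congr rfl fun a _ => Finset.sum_congr rfl fun b _ => ?_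
    rw [J.alt.swap₂₃ k b a]; ring
  have h5 : ∑ a, ∑ n, η a * η n * (J.d a * J.c k a n * J.d n) = 0 :=
    sum_eq_zero_of_antisymm fun a b => by rw [J.alt.swap₂₃ k a b]; ring
  have hX : ∑ a, η a * J.ddd k a a = ∑ a, η a * J.ddd a a k
      + ∑ a, ∑ n, η a * η n * J.ddc a n k a n
      + ∑ a, ∑ n, η a * η n * (J.dc a k a n * J.d n)
      + ∑ a, ∑ n, η a * η n * (J.c k a n * J.dd a n)
      + ∑ a, ∑ n, η a * η n * (J.c k a n * J.dd n a) := by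
    simp only [e1, Finset.mul_sum, mul_add, Finset.sum_add_distrib]
    ring_nf
  have hY : ∑ a, η a * (J.d a * J.dd k a) = ∑ a, η a * (J.d a * J.dd a k)
      + ∑ a, ∑ n, η a * η n * (J.d a * J.dc n k a n)
      + ∑ a, ∑ n, η a * η n * (J.d a * J.c k a n * J.d n) := by
    simp only [e2, Finset.mul_sum, mul_add, Finset.sum_add_distrib, mul_assoc, mul_comm,
      mul_left_comm]
    ring
  have h6 : ∑ a, ∑ b, η a * η b * ∑ n, η n * (J.c a b n * J.dc n k a b)
      = ∑ a, ∑ b, ∑ e, η a * η b * η e * J.c a b e * J.dc e k a b := by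
    simp only [Finset.mul_sum]
    ring_nf
  simp only [mul_add, Finset.sum_add_distrib] at hlap
  -- The remaining terms are -2 Σ ∂_a ∂_n c_kan and the cubic sum. By `h2` the former is -Σ c_abe
  -- ∂_e c_kab, and by `h1` the latter is 1/3 · 3 times the same sum with the opposite sign.
  rw [hX, hY]
  linarith

/-- In the expansion of the cubic sum with η = p + m, the three positions of the index with the odd
weight agree by antisymmetry. Hence the coefficient 1/3 becomes 1 on the mixed terms, as in
`derivScalar`. -/
theorem derivScalar_add_swap {p m : ι → ℝ} (hη : ∀ i, η i = p i + m i) (k : ι) :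
    J.derivScalar p m k + J.derivScalar m p k
      = -2 * ∑ a, η a * J.ddd k a a - 2 * ∑ a, η a * (J.d a * J.dd k a)
        + 1 / 3 * ∑ a, ∑ b, ∑ e, η a * η b * η e * J.c a b e * J.dc k a b e := by
  have h₁ : ∀ u v : ι → ℝ, ∑ a, ∑ b, ∑ e, v a * u b * v e * J.c a b e * J.dc k a b e
      = ∑ a, ∑ b, ∑ e, u a * v b * v e * J.c a b e * J.dc k a b e := fun u v => by
    rw [sum_swap₁₂]
    refine Finset.sum_congr rfl fun a _ => Finset.sum_congr rfl fun b _ =>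
      Finset.sum_congr rfl fun e _ => ?_
    rw [J.alt.swap₁₂ b a e, (J.alt_dc k).swap₁₂ b a e]; ring
  have h₂ : ∀ u v : ι → ℝ, ∑ a, ∑ b, ∑ e, v a * v b * u e * J.c a b e * J.dc k a b e
      = ∑ a, ∑ b, ∑ e, u a * v b * v e * J.c a b e * J.dc k a b e := fun u v => by
    rw [sum_swap₁₃]
    refine Finset.sum_congr rfl fun a _ => Finset.sum_congr rfl fun b _ =>
      Finset.sum_congr rfl fun e _ => ?_
    rw [J.alt.swap₁₃ e b a, (J.alt_dc k).swap₁₃ e b a]; ring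
  have h₃ : ∑ a, ∑ b, ∑ e, η a * η b * η e * J.c a b e * J.dc k a b e
      = ∑ a, ∑ b, ∑ e, m a * m b * m e * J.c a b e * J.dc k a b e
      + ∑ a, ∑ b, ∑ e, p a * p b * p e * J.c a b e * J.dc k a b e
      + 3 * ∑ a, ∑ b, ∑ e, p a * m b * m e * J.c a b e * J.dc k a b e
      + 3 * ∑ a, ∑ b, ∑ e, m a * p b * p e * J.c a b e * J.dc k a b e := by
    simp only [hη, add_mul, mul_add, Finset.sum_add_distrib]
    rw [h₁ m p, h₁ p m, h₂ m p, h₂ p m]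
    ring
  rw [h₃]
  simp only [derivScalar, hη, add_mul, Finset.sum_add_distrib]
  ring

end Jet
end FrameAlgebra

/-! ### Determinants and divergences on a vector space. -/

section Calculus

variable {V : Type*} [NormedAddCommGroup V] [NormedSpace ℝ V] [FiniteDimensional ℝ V]

/-- The trace as a continuous linear form on continuous endomorphisms. -/
def traceCLM (V : Type*) [NormedAddCommGroup V] [NormedSpace ℝ V] [FiniteDimensional ℝ V] :
    (V →L[ℝ] V) →L[ℝ] ℝ :=
  LinearMap.toContinuousLinearMap
    (LinearMap.trace ℝ V ∘ₗ ContinuousLinearMap.coeLM ℝ)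

theorem traceCLM_apply (T : V →L[ℝ] V) : traceCLM V T = LinearMap.trace ℝ V T.toLinearMap := rfl

theorem traceCLM_comp_comm (S T : V →L[ℝ] V) : traceCLM V (S ∘L T) = traceCLM V (T ∘L S) :=
  LinearMap.trace_mul_comm ℝ S.toLinearMap T.toLinearMap

theorem differentiable_det : Differentiable ℝ fun T : V →L[ℝ] V => LinearMap.det T.toLinearMap := by
  classical
  let b := Module.finBasis ℝ V
  have h : (fun T : V →L[ℝ] V => LinearMap.det T.toLinearMap)
      = fun T : V →L[ℝ] V => ∑ σ : Equiv.Perm (Fin (Module.finrank ℝ V)), (Equiv.Perm.sign σ : ℝ)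
        * ∏ i, b.repr (T (b i)) (σ i) := by
    funext T
    rw [← LinearMap.det_toMatrix b, Matrix.det_apply']
    simp [LinearMap.toMatrix_apply]
  rw [h]
  have h1 : ∀ i j, Differentiable ℝ fun T : V →L[ℝ] V => b.repr (T (b i)) j := by
    intro i j
    let ℓ : (V →L[ℝ] V) →ₗ[ℝ] ℝ := (b.coord j) ∘ₗ LinearMap.applyₗ (b i) ∘ₗ ContinuousLinearMap.coeLM ℝ
    exact ℓ.toContinuousLinearMap.differentiable
  refine Differentiable.fun_sum fun σ _ => (differentiable_const _).mul ?_
  exact fun T => (HasFDerivAt.finsetProd fun i _ => (h1 i (σ i) T).hasFDerivAt).differentiableAt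

theorem fderiv_det_one (T : V →L[ℝ] V) :
    fderiv ℝ (fun T : V →L[ℝ] V => LinearMap.det T.toLinearMap) (ContinuousLinearMap.id ℝ V) T
      = traceCLM V T := by
  classical
  have h1 : HasDerivAt (fun r : ℝ => ContinuousLinearMap.id ℝ V + r • T) T 0 := by
    simpa using ((hasDerivAt_id (0 : ℝ)).smul_const T).const_add (ContinuousLinearMap.id ℝ V)
  have h2 := ((differentiable_det (V := V)) (ContinuousLinearMap.id ℝ V + (0 : ℝ) • T)).hasFDerivAt.comp_hasDerivAt 0 h1
  let b := Module.finBasis ℝ V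
  let m := LinearMap.toMatrix b b T.toLinearMap
  let q := Polynomial.divX (Polynomial.divX
    (1 + (Polynomial.X : Polynomial ℝ) • m.map Polynomial.C).det)
  have h3 : (fun T : V →L[ℝ] V => LinearMap.det T.toLinearMap) ∘
      (fun r : ℝ => ContinuousLinearMap.id ℝ V + r • T)
      = fun r => 1 + m.trace * r + q.eval r * r ^ 2 := by
    funext r
    rw [← Matrix.det_one_add_smul, Function.comp, ← LinearMap.det_toMatrix b]
    congr 1
    rw [← LinearMap.toMatrix_id b, ← map_smul, ← map_add]
    rfl
  have h4 : HasDerivAt (fun r => 1 + m.trace * r + q.eval r * r ^ 2) m.trace 0 := by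
    simpa using (((hasDerivAt_id (0 : ℝ)).const_mul m.trace).const_add 1).fun_add
      ((q.hasDerivAt 0).fun_mul (hasDerivAt_pow 2 (0 : ℝ)))
  rw [h3] at h2
  have h5 := h2.unique h4
  simp only [zero_smul, add_zero] at h5
  rw [h5, traceCLM_apply, LinearMap.trace_eq_matrix_trace ℝ b]

/-- Jacobi's formula: det T = det S · det(T R) reduces the derivative at S to the one at the
identity. In finite dimension the right inverse R is two-sided. -/
theorem fderiv_det (S R : V →L[ℝ] V) (hRS : S ∘L R = ContinuousLinearMap.id ℝ V) (T : V →L[ℝ] V) :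
    fderiv ℝ (fun T : V →L[ℝ] V => LinearMap.det T.toLinearMap) S T
      = LinearMap.det S.toLinearMap * traceCLM V (T ∘L R) := by
  have hSR : R ∘L S = ContinuousLinearMap.id ℝ V := by
    have h : S.toLinearMap * R.toLinearMap = 1 := congrArg ContinuousLinearMap.toLinearMap hRS
    ext x
    exact LinearMap.congr_fun (mul_eq_one_comm.1 h) x
  have h : (fun T : V →L[ℝ] V => LinearMap.det T.toLinearMap)
      = fun T : V →L[ℝ] V => LinearMap.det S.toLinearMap * LinearMap.det (T ∘L R).toLinearMap := by
    funext T
    rw [mul_comm, ← LinearMap.det_comp]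
    congr 1
    ext x
    exact congrArg T (DFunLike.congr_fun hSR x).symm
  have h1 : HasFDerivAt (fun T : V →L[ℝ] V => T ∘L R)
      ((ContinuousLinearMap.compL ℝ V V V).flip R) S :=
    ((ContinuousLinearMap.compL ℝ V V V).flip R).hasFDerivAt
  have h2 : HasFDerivAt (fun T : V →L[ℝ] V => LinearMap.det T.toLinearMap)
      (fderiv ℝ (fun T : V →L[ℝ] V => LinearMap.det T.toLinearMap) (ContinuousLinearMap.id ℝ V))
      (S ∘L R) := hRS ▸ (differentiable_det _).hasFDerivAt
  have h3 := (h2.comp S h1).const_mul (LinearMap.det S.toLinearMap)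
  have h4 : HasFDerivAt (fun T : V →L[ℝ] V => LinearMap.det T.toLinearMap) _ S :=
    h3.congr_of_eventuallyEq (Filter.Eventually.of_forall fun T => congrFun h T)
  rw [h4.fderiv]
  simp [fderiv_det_one]

/-- The trace of the derivative of a vector field, under a change of coordinates `κ`. -/
theorem trace_fderiv_of_transition {κ X Y : V → V} {z : V} {R : V →L[ℝ] V} (hκ : ContDiffAt ℝ 2 κ z)
    (hR : fderiv ℝ κ z ∘L R = ContinuousLinearMap.id ℝ V) (hX : DifferentiableAt ℝ X z)
    (hY : DifferentiableAt ℝ Y (κ z)) (hYX : ∀ᶠ y in 𝓝 z, Y (κ y) = fderiv ℝ κ y (X y)) :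
    traceCLM V (fderiv ℝ Y (κ z)) = traceCLM V (fderiv ℝ X z)
      + fderiv ℝ (fun y => Real.log |LinearMap.det (fderiv ℝ κ y).toLinearMap|) z (X z) := by
  have hκ1 : DifferentiableAt ℝ κ z := hκ.differentiableAt (by simp)
  have hκ2 : DifferentiableAt ℝ (fderiv ℝ κ) z :=
    (hκ.fderiv_right (m := 1) (by norm_num)).differentiableAt (by simp)
  have hsymm : ∀ a b, fderiv ℝ (fderiv ℝ κ) z a b = fderiv ℝ (fderiv ℝ κ) z b a :=
    fun a b => (hκ.isSymmSndFDerivAt (by simp)).eq a b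
  -- Y ∘ κ = Dκ · X is differentiated in a direction w. Symmetry of D²κ turns D²κ(w, X) into the
  -- derivative of Dκ along X, whose trace against R is the derivative of log |det Dκ|.
  have h1 : fderiv ℝ Y (κ z) ∘L fderiv ℝ κ z
      = (fderiv ℝ κ z) ∘L fderiv ℝ X z + fderiv ℝ (fderiv ℝ κ) z (X z) := by
    have e1 := Filter.EventuallyEq.fderiv_eq (𝕜 := ℝ) hYX
    rw [show (fun y => Y (κ y)) = Y ∘ κ from rfl, fderiv_comp z hY hκ1,
      (hκ2.hasFDerivAt.clm_apply hX.hasFDerivAt).fderiv] at e1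
    rw [e1]
    ext w
    simp [hsymm w (X z)]
  have h2 : fderiv ℝ Y (κ z) = (fderiv ℝ κ z ∘L fderiv ℝ X z) ∘L R + fderiv ℝ (fderiv ℝ κ) z (X z) ∘L R := by
    rw [← ContinuousLinearMap.add_comp, ← h1, ContinuousLinearMap.comp_assoc, hR]
    rfl
  have hdet : LinearMap.det (fderiv ℝ κ z).toLinearMap ≠ 0 := by
    intro h0
    have := congrArg (fun T : V →L[ℝ] V => LinearMap.det T.toLinearMap) hR
    simp [LinearMap.det_comp, h0] at this
  have h3 : fderiv ℝ (fun y => Real.log |LinearMap.det (fderiv ℝ κ y).toLinearMap|) z (X z)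
      = traceCLM V (fderiv ℝ (fderiv ℝ κ) z (X z) ∘L R) := by
    simp only [Real.log_abs]
    have e1 := (((differentiable_det (fderiv ℝ κ z)).hasFDerivAt.comp z hκ2.hasFDerivAt).log hdet).fderiv
    rw [show (fun y => Real.log (LinearMap.det (fderiv ℝ κ y).toLinearMap))
      = fun y => Real.log (((fun T : V →L[ℝ] V => LinearMap.det T.toLinearMap) ∘ fderiv ℝ κ) y) from rfl,
      e1]
    simp only [Function.comp, _root_.smul_apply, ContinuousLinearMap.comp_apply,
      fderiv_det _ R hR, smul_eq_mul]
    field_simp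
  rw [h2, map_add, h3, traceCLM_comp_comm, ← ContinuousLinearMap.comp_assoc]
  congr 2
  have hSR : R ∘L fderiv ℝ κ z = ContinuousLinearMap.id ℝ V := by
    have h : (fderiv ℝ κ z).toLinearMap * R.toLinearMap = 1 :=
      congrArg ContinuousLinearMap.toLinearMap hR
    ext x
    exact LinearMap.congr_fun (mul_eq_one_comm.1 h) x
  rw [hSR]
  rfl

/-- The divergence `X(h) + ∂_i X^i` of a vector field on a vector space. -/
def flatDiv (h : V → ℝ) (X : V → V) (z : V) : ℝ := fderiv ℝ h z (X z) + traceCLM V (fderiv ℝ X z)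

theorem hasFDerivAt_flatDiv {h : V → ℝ} {X : V → V} {z : V} (hh : ContDiffAt ℝ 2 h z)
    (hX : ContDiffAt ℝ 2 X z) : HasFDerivAt (flatDiv h X)
      (((fderiv ℝ h z) ∘L fderiv ℝ X z + (fderiv ℝ (fderiv ℝ h) z).flip (X z))
        + traceCLM V ∘L fderiv ℝ (fderiv ℝ X) z) z := by
  have h1 : DifferentiableAt ℝ X z := hX.differentiableAt (by simp)
  have h2 : DifferentiableAt ℝ (fderiv ℝ X) z :=
    (hX.fderiv_right (m := 1) (by norm_num)).differentiableAt (by simp)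
  have h3 : DifferentiableAt ℝ (fderiv ℝ h) z :=
    (hh.fderiv_right (m := 1) (by norm_num)).differentiableAt (by simp)
  exact (h3.hasFDerivAt.clm_apply h1.hasFDerivAt).add
    ((traceCLM V).hasFDerivAt.comp z h2.hasFDerivAt)

/-- The divergence of a commutator of vector fields. -/
theorem flatDiv_commutator {h : V → ℝ} {X Y Z : V → V} {z : V} (hh : ContDiffAt ℝ 2 h z)
    (hX : ContDiffAt ℝ 2 X z) (hY : ContDiffAt ℝ 2 Y z)
    (hZ : ∀ᶠ y in 𝓝 z, Z y = fderiv ℝ Y y (X y) - fderiv ℝ X y (Y y)) :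
    flatDiv h Z z = fderiv ℝ (flatDiv h Y) z (X z) - fderiv ℝ (flatDiv h X) z (Y z) := by
  rw [(hasFDerivAt_flatDiv hh hX).fderiv, (hasFDerivAt_flatDiv hh hY).fderiv, flatDiv]
  have hX1 : DifferentiableAt ℝ X z := hX.differentiableAt (by simp)
  have hY1 : DifferentiableAt ℝ Y z := hY.differentiableAt (by simp)
  have hX2 : DifferentiableAt ℝ (fderiv ℝ X) z :=
    (hX.fderiv_right (m := 1) (by norm_num)).differentiableAt (by simp)
  have hY2 : DifferentiableAt ℝ (fderiv ℝ Y) z :=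
    (hY.fderiv_right (m := 1) (by norm_num)).differentiableAt (by simp)
  have sX : ∀ a b, fderiv ℝ (fderiv ℝ X) z a b = fderiv ℝ (fderiv ℝ X) z b a :=
    fun a b => (hX.isSymmSndFDerivAt (by simp)).eq a b
  have sY : ∀ a b, fderiv ℝ (fderiv ℝ Y) z a b = fderiv ℝ (fderiv ℝ Y) z b a :=
    fun a b => (hY.isSymmSndFDerivAt (by simp)).eq a b
  have sh : ∀ a b, fderiv ℝ (fderiv ℝ h) z a b = fderiv ℝ (fderiv ℝ h) z b a :=
    fun a b => (hh.isSymmSndFDerivAt (by simp)).eq a b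
  -- Once the second derivatives are symmetrized, those of X and Y are exactly the ones occurring in
  -- the derivatives of the divergences. The two mixed traces agree since tr(ST) = tr(TS), and the
  -- Hessian of h cancels.
  have h1 : fderiv ℝ Z z = (fderiv ℝ Y z ∘L fderiv ℝ X z + fderiv ℝ (fderiv ℝ Y) z (X z))
      - (fderiv ℝ X z ∘L fderiv ℝ Y z + fderiv ℝ (fderiv ℝ X) z (Y z)) := by
    have e1 := (Filter.EventuallyEq.fderiv_eq hZ).trans
      ((hY2.hasFDerivAt.clm_apply hX1.hasFDerivAt).sub
        (hX2.hasFDerivAt.clm_apply hY1.hasFDerivAt)).fderiv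
    rw [e1]
    ext w
    simp [sX w, sY w]
  rw [h1, hZ.self_of_nhds]
  simp only [map_sub, map_add, traceCLM_comp_comm (fderiv ℝ Y z), _root_.add_apply,
    ContinuousLinearMap.comp_apply, ContinuousLinearMap.flip_apply, sh (X z)]
  ring

end Calculus

/-! ### Coordinate expressions of tangent vectors and directional derivatives. -/

section Chart

variable {n : ℕ} {M : Type*} [TopologicalSpace M]
  [ChartedSpace (EuclideanSpace ℝ (Fin n)) M] [IsManifold (𝓡 n) ∞ M]

theorem coordOf_eq {x₀ y : M} (hy : y ∈ (chartAt (EuclideanSpace ℝ (Fin n)) x₀).source)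
    (v : TangentSpace (𝓡 n) y) :
    coordOf x₀ y v = tangentCoordChange (𝓡 n) y x₀ y v := by
  have h := TangentBundle.continuousLinearMapAt_trivializationAt_eq_core (I := 𝓡 n) hy
  have h2 := congrArg (fun T => T v) h
  rw [Bundle.Trivialization.continuousLinearMapAt_apply,
    Bundle.Trivialization.coe_linearMapAt_of_mem _ (by simpa using hy)] at h2
  exact h2

theorem coordVec_eq {x₀ y : M} (hy : y ∈ (chartAt (EuclideanSpace ℝ (Fin n)) x₀).source)
    (a : EuclideanSpace ℝ (Fin n)) :
    coordVec x₀ y a = tangentCoordChange (𝓡 n) x₀ y y a := by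
  have h := congrArg (fun T => T a) (TangentBundle.symmL_trivializationAt_eq_core (I := 𝓡 n) hy)
  exact (Bundle.Trivialization.symmL_apply (R := ℝ) (trivializationAt (EuclideanSpace ℝ (Fin n))
    (TangentSpace (𝓡 n)) x₀) (by simpa using hy) a).symm.trans h

theorem coordOf_coordVec {x₀ y : M} (hy : y ∈ (chartAt (EuclideanSpace ℝ (Fin n)) x₀).source)
    (a : EuclideanSpace ℝ (Fin n)) : coordOf x₀ y (coordVec x₀ y a) = a := by
  rw [coordOf_eq hy, coordVec_eq hy, tangentCoordChange_comp, tangentCoordChange_self]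
  · simpa using hy
  · simpa using hy

/-- The directional derivative of a function, computed in a chart. -/
theorem dirDeriv_eq_fderiv {f : M → ℝ} {x₀ y : M}
    (hy : y ∈ (chartAt (EuclideanSpace ℝ (Fin n)) x₀).source)
    (hf : MDifferentiableAt (𝓡 n) 𝓘(ℝ, ℝ) f y) (v : TangentSpace (𝓡 n) y) :
    dirDeriv f y v = fderiv ℝ (f ∘ (extChartAt (𝓡 n) x₀).symm) (extChartAt (𝓡 n) x₀ y)
      (coordOf x₀ y v) := by
  have hy' : y ∈ (extChartAt (𝓡 n) x₀).source := by simpa using hy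
  have hsymm : MDifferentiableAt 𝓘(ℝ, EuclideanSpace ℝ (Fin n)) (𝓡 n) (extChartAt (𝓡 n) x₀).symm
      (extChartAt (𝓡 n) x₀ y) :=
    (mdifferentiableOn_extChartAt_symm (I := 𝓡 n) (x := x₀)).mdifferentiableAt
      ((isOpen_extChartAt_target x₀).mem_nhds ((extChartAt (𝓡 n) x₀).map_source hy'))
  have hf' : MDifferentiableAt (𝓡 n) 𝓘(ℝ, ℝ) f ((extChartAt (𝓡 n) x₀).symm
      (extChartAt (𝓡 n) x₀ y)) := by
    rwa [(extChartAt (𝓡 n) x₀).left_inv hy']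
  have hg : MDifferentiableAt 𝓘(ℝ, EuclideanSpace ℝ (Fin n)) 𝓘(ℝ, ℝ)
      (f ∘ (extChartAt (𝓡 n) x₀).symm) (extChartAt (𝓡 n) x₀ y) :=
    hf'.comp _ hsymm
  have h1 : mfderiv (𝓡 n) 𝓘(ℝ, ℝ) f y
      = (mfderiv 𝓘(ℝ, EuclideanSpace ℝ (Fin n)) 𝓘(ℝ, ℝ) (f ∘ (extChartAt (𝓡 n) x₀).symm)
          (extChartAt (𝓡 n) x₀ y)) ∘L mfderiv (𝓡 n) 𝓘(ℝ, EuclideanSpace ℝ (Fin n))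
            (extChartAt (𝓡 n) x₀) y := by
    have e : f =ᶠ[𝓝 y] (f ∘ (extChartAt (𝓡 n) x₀).symm) ∘ extChartAt (𝓡 n) x₀ := by
      filter_upwards [(isOpen_extChartAt_source x₀).mem_nhds hy'] with w hw
      simp only [Function.comp, (extChartAt (𝓡 n) x₀).left_inv hw]
    rw [e.mfderiv_eq]
    exact mfderiv_comp y hg (mdifferentiableAt_extChartAt hy)
  have h2 : coordOf x₀ y v = mfderiv (𝓡 n) 𝓘(ℝ, EuclideanSpace ℝ (Fin n))
      (extChartAt (𝓡 n) x₀) y v :=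
    (coordOf_eq hy v).trans (congrArg (fun T => T v)
      ((TangentBundle.continuousLinearMapAt_trivializationAt_eq_core hy).symm.trans
        (TangentBundle.continuousLinearMapAt_trivializationAt hy)))
  rw [h2]
  change (mfderiv (𝓡 n) 𝓘(ℝ, ℝ) f y) v = _
  rw [h1, mfderiv_eq_fderiv]
  rfl

end Chart

/-! ### The divergence of a half-density in a fixed chart, and its value on brackets. -/

section Divergence

variable {n : ℕ} {M : Type*} [TopologicalSpace M]
  [ChartedSpace (EuclideanSpace ℝ (Fin n)) M] [IsManifold (𝓡 n) ∞ M]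

/-- The components of a vector field in the chart at `x₀`. -/
def chartField (x₀ : M) (X : ∀ x : M, TangentSpace (𝓡 n) x) (z : EuclideanSpace ℝ (Fin n)) :
    EuclideanSpace ℝ (Fin n) :=
  coordOf x₀ ((extChartAt (𝓡 n) x₀).symm z) (X ((extChartAt (𝓡 n) x₀).symm z))

theorem eventually_extChartAt_symm_mem {x₀ y : M} {U : Set M}
    (hy : y ∈ (chartAt (EuclideanSpace ℝ (Fin n)) x₀).source) (hU : U ∈ 𝓝 y) :
    ∀ᶠ z in 𝓝 (extChartAt (𝓡 n) x₀ y), z ∈ (extChartAt (𝓡 n) x₀).target ∧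
      (extChartAt (𝓡 n) x₀).symm z ∈ U := by
  have hy' : y ∈ (extChartAt (𝓡 n) x₀).source := by simpa using hy
  refine Filter.Eventually.and
    ((isOpen_extChartAt_target x₀).mem_nhds ((extChartAt (𝓡 n) x₀).map_source hy')) ?_
  have hc := continuousAt_extChartAt_symm' (I := 𝓡 n) hy'
  refine hc.eventually ?_
  rwa [(extChartAt (𝓡 n) x₀).left_inv hy']

theorem contDiffAt_comp_extChartAt_symm {V : Type*} [NormedAddCommGroup V] [NormedSpace ℝ V]
    {f : M → V} {x₀ y : M} (hy : y ∈ (chartAt (EuclideanSpace ℝ (Fin n)) x₀).source)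
    (hf : ContMDiffAt (𝓡 n) 𝓘(ℝ, V) ∞ f y) :
    ContDiffAt ℝ ∞ (fun z => f ((extChartAt (𝓡 n) x₀).symm z)) (extChartAt (𝓡 n) x₀ y) := by
  have hy' : y ∈ (extChartAt (𝓡 n) x₀).source := by simpa using hy
  rw [← contMDiffAt_iff_contDiffAt]
  have h1 : ContMDiffAt 𝓘(ℝ, EuclideanSpace ℝ (Fin n)) (𝓡 n) ∞ (extChartAt (𝓡 n) x₀).symm
      (extChartAt (𝓡 n) x₀ y) :=
    (contMDiffOn_extChartAt_symm x₀).contMDiffAt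
      ((isOpen_extChartAt_target x₀).mem_nhds ((extChartAt (𝓡 n) x₀).map_source hy'))
  refine ContMDiffAt.comp _ ?_ h1
  rwa [(extChartAt (𝓡 n) x₀).left_inv hy']

theorem contDiffAt_chartField {x₀ y : M} (hy : y ∈ (chartAt (EuclideanSpace ℝ (Fin n)) x₀).source)
    {X : ∀ x : M, TangentSpace (𝓡 n) x}
    (hX : ContMDiff (𝓡 n) (𝓡 n).tangent ∞ fun x => (⟨x, X x⟩ : TangentBundle (𝓡 n) M)) :
    ContDiffAt ℝ ∞ (chartField x₀ X) (extChartAt (𝓡 n) x₀ y) := by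
  refine contDiffAt_comp_extChartAt_symm (f := fun w => coordOf x₀ w (X w)) hy ?_
  exact (Bundle.Trivialization.contMDiffAt_section_iff (trivializationAt (EuclideanSpace ℝ (Fin n))
    (TangentSpace (𝓡 n)) x₀) (by simpa using hy)).1 (hX y)

theorem chartField_apply {x₀ y : M} (hy : y ∈ (chartAt (EuclideanSpace ℝ (Fin n)) x₀).source)
    (X : ∀ x : M, TangentSpace (𝓡 n) x) :
    chartField x₀ X (extChartAt (𝓡 n) x₀ y) = coordOf x₀ y (X y) := by
  rw [chartField, (extChartAt (𝓡 n) x₀).left_inv (by simpa using hy)]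

theorem linearIndependent_coordVec {x₀ y : M}
    (hy : y ∈ (chartAt (EuclideanSpace ℝ (Fin n)) x₀).source) :
    LinearIndependent ℝ fun i : Fin n => coordVec x₀ y (EuclideanSpace.single i (1 : ℝ)) := by
  have h1 : LinearIndependent ℝ fun i : Fin n => EuclideanSpace.single i (1 : ℝ) := by
    have := (EuclideanSpace.basisFun (Fin n) ℝ).toBasis.linearIndependent
    have e : (fun i : Fin n => EuclideanSpace.single i (1 : ℝ))
        = (EuclideanSpace.basisFun (Fin n) ℝ).toBasis := by
      funext i
      simp
    rwa [e]
  have h2 := h1.map' (tangentCoordChange (𝓡 n) x₀ y y).toLinearMap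
    (LinearMap.ker_eq_bot_of_injective fun a b hab => ?_)
  · have h3 : (fun i => coordVec x₀ y (EuclideanSpace.single i (1 : ℝ)))
      = fun i => tangentCoordChange (𝓡 n) x₀ y y (EuclideanSpace.single i (1 : ℝ)) :=
      funext fun i => coordVec_eq hy _
    rw [h3]
    exact h2
  · have hab' : coordVec x₀ y a = coordVec x₀ y b := by
      rw [coordVec_eq hy, coordVec_eq hy]; exact hab
    rw [← coordOf_coordVec hy a, hab', coordOf_coordVec hy]

/-- The value of a density on the coordinate frame of the chart at `x₀`. -/
def Density.onChart {w : ℝ} (μ : Density n M w) (x₀ y : M) : ℝ :=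
  μ.val y fun i => coordVec x₀ y (EuclideanSpace.single i 1)

theorem PositiveHalfDensity.onChart_pos (σ : PositiveHalfDensity n M) {x₀ y : M}
    (hy : y ∈ (chartAt (EuclideanSpace ℝ (Fin n)) x₀).source) : 0 < σ.sq.onChart x₀ y :=
  pow_pos (σ.pos y _ (linearIndependent_coordVec hy)) 2

/-- The scaling law of a density concerns endomorphisms of one tangent space, so the transition J
between coordinates is conjugated into the endomorphism B J B' of that space, which has the same
determinant. -/
theorem Density.onChart_eq (μ : Density n M 1) {x₀ x₁ y : M}
    (h₀ : y ∈ (chartAt (EuclideanSpace ℝ (Fin n)) x₀).source)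
    (h₁ : y ∈ (chartAt (EuclideanSpace ℝ (Fin n)) x₁).source) :
    μ.onChart x₀ y = |LinearMap.det (tangentCoordChange (𝓡 n) x₀ x₁ y).toLinearMap|
      * μ.onChart x₁ y := by
  let B := (tangentCoordChange (𝓡 n) x₁ y y).toLinearMap
  let B' := (tangentCoordChange (𝓡 n) y x₁ y).toLinearMap
  let J := (tangentCoordChange (𝓡 n) x₀ x₁ y).toLinearMap
  have hB : B ∘ₗ B' = LinearMap.id := by
    ext1 a
    exact (tangentCoordChange_comp (I := 𝓡 n) (by simpa using h₁)).trans
      (tangentCoordChange_self (I := 𝓡 n) (by simp))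
  have hB' : B' ∘ₗ B = LinearMap.id := by
    ext1 a
    exact (tangentCoordChange_comp (I := 𝓡 n) (by simpa using h₁)).trans
      (tangentCoordChange_self (I := 𝓡 n) (by simpa using h₁))
  have hdet : LinearMap.det (B ∘ₗ J ∘ₗ B') = LinearMap.det J := by
    have h2 := congrArg LinearMap.det hB
    rw [LinearMap.det_comp, LinearMap.det_id] at h2
    rw [LinearMap.det_comp, LinearMap.det_comp]
    linear_combination LinearMap.det J * h2
  have h := μ.map_comp y (B ∘ₗ J ∘ₗ B') fun i => coordVec x₁ y (EuclideanSpace.single i 1)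
  have hv : (fun i => (B ∘ₗ J ∘ₗ B') (coordVec x₁ y (EuclideanSpace.single i 1)))
      = fun i => coordVec x₀ y (EuclideanSpace.single i 1) := by
    funext i
    rw [coordVec_eq h₀, coordVec_eq h₁]
    change B (J ((B' ∘ₗ B) (EuclideanSpace.single i 1))) = _
    rw [hB']
    exact tangentCoordChange_comp (I := 𝓡 n) (by simpa using ⟨h₀, h₁⟩)
  rw [Real.rpow_one] at h
  refine (congrArg (μ.val y) hv).symm.trans (h.trans ?_)
  exact congrArg (fun r => |r| * μ.onChart x₁ y) hdet

theorem Density.contMDiffAt_onChart {w : ℝ} (μ : Density n M w) {x₀ y : M}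
    (hy : y ∈ (chartAt (EuclideanSpace ℝ (Fin n)) x₀).source) :
    ContMDiffAt (𝓡 n) 𝓘(ℝ, ℝ) ∞ (μ.onChart x₀) y :=
  (μ.smooth x₀).contMDiffAt ((chartAt (EuclideanSpace ℝ (Fin n)) x₀).open_source.mem_nhds hy)

/-- The logarithm of `σ²` in the chart at `x₀`. -/
def PositiveHalfDensity.chartLog (σ : PositiveHalfDensity n M) (x₀ : M)
    (z : EuclideanSpace ℝ (Fin n)) : ℝ :=
  Real.log (σ.sq.onChart x₀ ((extChartAt (𝓡 n) x₀).symm z))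

theorem PositiveHalfDensity.contDiffAt_chartLog (σ : PositiveHalfDensity n M) {x₀ y : M}
    (hy : y ∈ (chartAt (EuclideanSpace ℝ (Fin n)) x₀).source) :
    ContDiffAt ℝ ∞ (σ.chartLog x₀) (extChartAt (𝓡 n) x₀ y) := by
  refine (contDiffAt_comp_extChartAt_symm hy (σ.sq.contMDiffAt_onChart hy)).log ?_
  rw [(extChartAt (𝓡 n) x₀).left_inv (by simpa using hy)]
  exact (σ.onChart_pos hy).ne'

/-- The function `σ⁻² L_X σ²`, computed in an arbitrary chart. -/
theorem PositiveHalfDensity.logLieDeriv_eq (σ : PositiveHalfDensity n M) {x₀ y : M}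
    (hy : y ∈ (chartAt (EuclideanSpace ℝ (Fin n)) x₀).source)
    {X : ∀ x : M, TangentSpace (𝓡 n) x}
    (hX : ContMDiff (𝓡 n) (𝓡 n).tangent ∞ fun x => (⟨x, X x⟩ : TangentBundle (𝓡 n) M)) :
    σ.logLieDeriv X y
      = flatDiv (σ.chartLog x₀) (chartField x₀ X) (extChartAt (𝓡 n) x₀ y) := by
  have hyy := mem_chart_source (EuclideanSpace ℝ (Fin n)) y
  have hy' : y ∈ (extChartAt (𝓡 n) x₀).source := by simpa using hy
  set z := extChartAt (𝓡 n) x₀ y with hz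
  let κ : EuclideanSpace ℝ (Fin n) → EuclideanSpace ℝ (Fin n) :=
    fun z => extChartAt (𝓡 n) y ((extChartAt (𝓡 n) x₀).symm z)
  have hκz : κ z = extChartAt (𝓡 n) y y := by
    simp only [κ, hz, (extChartAt (𝓡 n) x₀).left_inv hy']
  have hκ : ContDiffAt ℝ ∞ κ z :=
    contDiffAt_comp_extChartAt_symm hy (contMDiffAt_extChartAt' hyy)
  have hnear := eventually_extChartAt_symm_mem hy
    ((chartAt (EuclideanSpace ℝ (Fin n)) y).open_source.mem_nhds hyy)
  have hnear₀ : ∀ z' ∈ (extChartAt (𝓡 n) x₀).target,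
      (extChartAt (𝓡 n) x₀).symm z' ∈ (chartAt (EuclideanSpace ℝ (Fin n)) x₀).source := by
    intro z' hz'
    simpa using (extChartAt (𝓡 n) x₀).map_target hz'
  have hfd : ∀ z' ∈ (extChartAt (𝓡 n) x₀).target,
      (extChartAt (𝓡 n) x₀).symm z' ∈ (chartAt (EuclideanSpace ℝ (Fin n)) y).source →
      fderiv ℝ κ z' = tangentCoordChange (𝓡 n) x₀ y ((extChartAt (𝓡 n) x₀).symm z') := by
    intro z' hz' hz''
    have h := hasFDerivWithinAt_tangentCoordChange (I := 𝓡 n) (x := x₀) (y := y)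
      (z := (extChartAt (𝓡 n) x₀).symm z') (by simpa using ⟨hnear₀ z' hz', hz''⟩)
    rw [(extChartAt (𝓡 n) x₀).right_inv hz'] at h
    simp only [ModelWithCorners.range_eq_univ, hasFDerivWithinAt_univ] at h
    exact h.fderiv
  have hR : fderiv ℝ κ z ∘L tangentCoordChange (𝓡 n) y x₀ y = ContinuousLinearMap.id ℝ _ := by
    rw [hfd z ((extChartAt (𝓡 n) x₀).map_source hy')
      (by rw [(extChartAt (𝓡 n) x₀).left_inv hy']; exact hyy), (extChartAt (𝓡 n) x₀).left_inv hy']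
    ext1 a
    exact (tangentCoordChange_comp (I := 𝓡 n) (by simpa using hy)).trans
      (tangentCoordChange_self (I := 𝓡 n) (by simp))
  have hYX : ∀ᶠ z' in 𝓝 z, chartField y X (κ z') = fderiv ℝ κ z' (chartField x₀ X z') := by
    filter_upwards [hnear] with z' ⟨h1, h2⟩
    rw [hfd z' h1 h2]
    simp only [κ]
    rw [chartField_apply h2, chartField, coordOf_eq h2, coordOf_eq (hnear₀ z' h1)]
    exact (tangentCoordChange_comp (I := 𝓡 n) (by simpa using ⟨hnear₀ z' h1, h2⟩)).symm
  have htr := trace_fderiv_of_transition (by exact_mod_cast contDiffAt_infty.1 hκ 2) hR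
    ((contDiffAt_chartField hy hX).differentiableAt (by simp))
    (by rw [hκz]; exact (contDiffAt_chartField hyy hX).differentiableAt (by simp)) hYX
  rw [hκz] at htr
  have hμ : ContDiffAt ℝ ∞ (fun z => σ.sq.onChart y ((extChartAt (𝓡 n) x₀).symm z)) z :=
    contDiffAt_comp_extChartAt_symm hy (σ.sq.contMDiffAt_onChart hyy)
  have hμz : σ.sq.onChart y ((extChartAt (𝓡 n) x₀).symm z) = σ.sq.onChart y y := by
    rw [hz, (extChartAt (𝓡 n) x₀).left_inv hy']
  have hpos := σ.onChart_pos hyy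
  have hμd := (hμ.differentiableAt (by simp)).hasFDerivAt.log (by rw [hμz]; exact hpos.ne')
  -- By the transformation law, log |det Dκ| is the difference of the logarithms of σ² in the two
  -- charts. So the extra term in the trace of the derivative compensates the change of σ².
  have hlog : (fun z => Real.log |LinearMap.det (fderiv ℝ κ z).toLinearMap|)
      =ᶠ[𝓝 z] fun z => σ.chartLog x₀ z
        - Real.log (σ.sq.onChart y ((extChartAt (𝓡 n) x₀).symm z)) := by
    filter_upwards [hnear] with z' ⟨h1, h2⟩
    have hp := σ.onChart_pos (hnear₀ z' h1)
    have hq := σ.onChart_pos h2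
    rw [hfd z' h1 h2, PositiveHalfDensity.chartLog, σ.sq.onChart_eq (hnear₀ z' h1) h2, Real.log_mul _ hq.ne']
    · ring
    · intro h0
      rw [σ.sq.onChart_eq (hnear₀ z' h1) h2, h0, zero_mul] at hp
      exact lt_irrefl _ hp
  have hlog' := hlog.fderiv_eq.trans
    (((σ.contDiffAt_chartLog hy).differentiableAt (by simp)).hasFDerivAt.sub hμd).fderiv
  rw [hlog'] at htr
  have hdir : dirDeriv (σ.sq.onChart y) y (X y)
      = fderiv ℝ (fun z => σ.sq.onChart y ((extChartAt (𝓡 n) x₀).symm z)) z (chartField x₀ X z) := by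
    rw [dirDeriv_eq_fderiv hy ((σ.sq.contMDiffAt_onChart hyy).mdifferentiableAt (by simp)),
      hz, chartField_apply hy]
    rfl
  have hL : σ.logLieDeriv X y = (dirDeriv (σ.sq.onChart y) y (X y)
      + 1 * traceCLM _ (fderiv ℝ (chartField y X) (extChartAt (𝓡 n) y y)) * σ.sq.onChart y y)
        / σ.sq.onChart y y := by
    rw [PositiveHalfDensity.logLieDeriv, Density.lieDeriv]
    simp only [coordOf_coordVec hyy]
    rfl
  rw [hL, htr, hdir, flatDiv]
  simp only [_root_.sub_apply, _root_.smul_apply, smul_eq_mul, hμz]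
  field_simp
  ring

variable [T2Space M] {F : Type*} [NormedAddCommGroup F] [NormedSpace ℝ F] [FiniteDimensional ℝ F]
  {E : M → Type*} [TopologicalSpace (TotalSpace F E)]
  [∀ x, TopologicalSpace (E x)] [FiberBundle F E]
  [∀ x, AddCommGroup (E x)] [∀ x, Module ℝ (E x)] [VectorBundle ℝ F E]
  [ContMDiffVectorBundle ∞ F E (𝓡 n)]

namespace CourantAlgebroid

variable (A : CourantAlgebroid n F E)

/-- The components of the anchor of a section in the chart at `x₀`. -/
def chartAnchor (x₀ : M) (u : Cₛ^∞⟮𝓡 n; F, E⟯) :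
    EuclideanSpace ℝ (Fin n) → EuclideanSpace ℝ (Fin n) :=
  chartField x₀ fun x => A.anchor x (u x)

theorem rho_eq_fderiv {x₀ y : M} (hy : y ∈ (chartAt (EuclideanSpace ℝ (Fin n)) x₀).source)
    (u : Cₛ^∞⟮𝓡 n; F, E⟯) (f : C^∞⟮𝓡 n, M; ℝ⟯) :
    A.rho u f y = fderiv ℝ (f ∘ (extChartAt (𝓡 n) x₀).symm) (extChartAt (𝓡 n) x₀ y)
      (A.chartAnchor x₀ u (extChartAt (𝓡 n) x₀ y)) := by
  rw [chartAnchor, chartField_apply hy]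
  exact dirDeriv_eq_fderiv hy (f.contMDiff.mdifferentiableAt (by simp)) _

/-- In coordinates, ρ([u, v]) is the commutator of vector fields. Each component follows by applying
`rho_bracket` to a coordinate function, multiplied by a bump function to make it global. -/
theorem chartAnchor_bracket {x₀ y : M} (hy : y ∈ (chartAt (EuclideanSpace ℝ (Fin n)) x₀).source)
    (u v : Cₛ^∞⟮𝓡 n; F, E⟯) :
    A.chartAnchor x₀ (A.bracket u v) (extChartAt (𝓡 n) x₀ y)
      = fderiv ℝ (A.chartAnchor x₀ v) (extChartAt (𝓡 n) x₀ y)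
          (A.chartAnchor x₀ u (extChartAt (𝓡 n) x₀ y))
        - fderiv ℝ (A.chartAnchor x₀ u) (extChartAt (𝓡 n) x₀ y)
          (A.chartAnchor x₀ v (extChartAt (𝓡 n) x₀ y)) := by
  ext i
  obtain ⟨χ, h1, h2⟩ := exists_bump (n := n) (M := M)
    ((chartAt (EuclideanSpace ℝ (Fin n)) x₀).open_source.mem_nhds hy)
  let p : EuclideanSpace ℝ (Fin n) →L[ℝ] ℝ := EuclideanSpace.proj i
  have hf : ContMDiff (𝓡 n) 𝓘(ℝ, ℝ) ∞ fun w => χ w * p (extChartAt (𝓡 n) x₀ w) := by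
    refine contMDiff_of_tsupport fun w hw => ?_
    have hw' := h2 (tsupport_mul_subset_left hw)
    exact χ.contMDiff.contMDiffAt.mul
      (p.contDiff.contMDiff.contMDiffAt.comp w (contMDiffAt_extChartAt' hw'))
  let f : C^∞⟮𝓡 n, M; ℝ⟯ := ⟨_, hf⟩
  have hsrc := (chartAt (EuclideanSpace ℝ (Fin n)) x₀).open_source.mem_nhds hy
  have hrho : ∀ᶠ w in 𝓝 y, ∀ s : Cₛ^∞⟮𝓡 n; F, E⟯,
      A.rho s f w = p (A.chartAnchor x₀ s (extChartAt (𝓡 n) x₀ w)) := by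
    filter_upwards [h1.eventually_nhds, hsrc] with w hw hw' s
    rw [A.rho_eq_fderiv hw']
    have e : f ∘ (extChartAt (𝓡 n) x₀).symm =ᶠ[𝓝 (extChartAt (𝓡 n) x₀ w)] p := by
      filter_upwards [eventually_extChartAt_symm_mem hw' hw] with z ⟨hz1, hz2⟩
      have hz3 : χ ((extChartAt (𝓡 n) x₀).symm z) = 1 := hz2
      change χ ((extChartAt (𝓡 n) x₀).symm z)
        * p (extChartAt (𝓡 n) x₀ ((extChartAt (𝓡 n) x₀).symm z)) = p z
      rw [hz3, one_mul, (extChartAt (𝓡 n) x₀).right_inv hz1]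
    rw [e.fderiv_eq, p.fderiv]
  have hrho2 : ∀ s t : Cₛ^∞⟮𝓡 n; F, E⟯, A.rho s (A.rho t f) y
      = p (fderiv ℝ (A.chartAnchor x₀ t) (extChartAt (𝓡 n) x₀ y)
          (A.chartAnchor x₀ s (extChartAt (𝓡 n) x₀ y))) := by
    intro s t
    rw [A.rho_eq_fderiv hy]
    have e : A.rho t f ∘ (extChartAt (𝓡 n) x₀).symm =ᶠ[𝓝 (extChartAt (𝓡 n) x₀ y)]
        fun z => p (A.chartAnchor x₀ t z) := by
      filter_upwards [eventually_extChartAt_symm_mem hy hrho] with z ⟨hz1, hz2⟩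
      have := hz2 t
      rw [(extChartAt (𝓡 n) x₀).right_inv hz1] at this
      exact this
    have hd : DifferentiableAt ℝ (A.chartAnchor x₀ t) (extChartAt (𝓡 n) x₀ y) :=
      (contDiffAt_chartField hy (A.anchor_smooth t)).differentiableAt (by simp)
    rw [e.fderiv_eq]
    exact congrArg (fun T : EuclideanSpace ℝ (Fin n) →L[ℝ] ℝ =>
      T (A.chartAnchor x₀ s (extChartAt (𝓡 n) x₀ y))) (p.hasFDerivAt.comp _ hd.hasFDerivAt).fderiv
  have h := A.rho_bracket u v f y
  rw [hrho2, hrho2, hrho.self_of_nhds] at h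
  exact h

/-- The divergence of a half-density, applied to a bracket. -/
theorem divOf_bracket (σ : PositiveHalfDensity n M) (u v : Cₛ^∞⟮𝓡 n; F, E⟯) (x : M) :
    A.divOf σ (A.bracket u v) x = dirDeriv (A.divOf σ v) x (A.anchor x (u x))
      - dirDeriv (A.divOf σ u) x (A.anchor x (v x)) := by
  have hx := mem_chart_source (EuclideanSpace ℝ (Fin n)) x
  have hx' : x ∈ (extChartAt (𝓡 n) x).source := by simp
  have hdiv : ∀ (s : Cₛ^∞⟮𝓡 n; F, E⟯), ∀ y ∈ (chartAt (EuclideanSpace ℝ (Fin n)) x).source,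
      A.divOf σ s y = flatDiv (σ.chartLog x) (A.chartAnchor x s) (extChartAt (𝓡 n) x y) :=
    fun s y hy => σ.logLieDeriv_eq hy (A.anchor_smooth s)
  have hh : ContDiffAt ℝ 2 (σ.chartLog x) (extChartAt (𝓡 n) x x) :=
    by exact_mod_cast contDiffAt_infty.1 (σ.contDiffAt_chartLog hx) 2
  have hs : ∀ s : Cₛ^∞⟮𝓡 n; F, E⟯, ContDiffAt ℝ 2 (A.chartAnchor x s) (extChartAt (𝓡 n) x x) :=
    fun s => by exact_mod_cast contDiffAt_infty.1 (contDiffAt_chartField hx (A.anchor_smooth s)) 2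
  have hdir : ∀ s t : Cₛ^∞⟮𝓡 n; F, E⟯, dirDeriv (A.divOf σ s) x (A.anchor x (t x))
      = fderiv ℝ (flatDiv (σ.chartLog x) (A.chartAnchor x s)) (extChartAt (𝓡 n) x x)
        (A.chartAnchor x t (extChartAt (𝓡 n) x x)) := by
    intro s t
    have hd := (hasFDerivAt_flatDiv hh (hs s)).differentiableAt
    -- `logLieDeriv` uses a different chart at each point, so differentiability is read off from the
    -- formula in the fixed chart at x.
    have hm : MDifferentiableAt (𝓡 n) 𝓘(ℝ, ℝ) (A.divOf σ s) x := by
      have h1 : MDifferentiableAt (𝓡 n) 𝓘(ℝ, ℝ)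
          (flatDiv (σ.chartLog x) (A.chartAnchor x s) ∘ extChartAt (𝓡 n) x) x :=
        hd.mdifferentiableAt.comp x (mdifferentiableAt_extChartAt hx)
      refine h1.congr_of_eventuallyEq ?_
      filter_upwards [(chartAt (EuclideanSpace ℝ (Fin n)) x).open_source.mem_nhds hx] with y hy
      exact hdiv s y hy
    rw [dirDeriv_eq_fderiv hx hm, chartAnchor, chartAnchor,
      chartField_apply (X := fun x => A.anchor x (t x)) hx]
    refine congrArg (fun T : EuclideanSpace ℝ (Fin n) →L[ℝ] ℝ =>
      T (coordOf x x (A.anchor x (t x)))) ?_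
    refine Filter.EventuallyEq.fderiv_eq ?_
    filter_upwards [eventually_extChartAt_symm_mem hx Filter.univ_mem] with z ⟨hz, _⟩
    rw [Function.comp, hdiv s _ (by simpa using (extChartAt (𝓡 n) x).map_target hz),
      (extChartAt (𝓡 n) x).right_inv hz]
    rfl
  rw [hdir, hdir, hdiv _ x hx]
  refine flatDiv_commutator hh (hs u) (hs v) ?_
  filter_upwards [eventually_extChartAt_symm_mem hx Filter.univ_mem] with z ⟨hz, _⟩
  have := A.chartAnchor_bracket (x₀ := x) (y := (extChartAt (𝓡 n) x).symm z)
    (by simpa using (extChartAt (𝓡 n) x).map_target hz) u v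
  rwa [(extChartAt (𝓡 n) x).right_inv hz] at this

end CourantAlgebroid
end Divergence

/-- A symmetric involution of a nondegenerate quadratic space has an orthogonal eigenbasis. -/
theorem exists_orthogonal_eigenbasis {V : Type*} [AddCommGroup V] [Module ℝ V]
    [FiniteDimensional ℝ V] (B : LinearMap.BilinForm ℝ V) (hB : B.Nondegenerate)
    (hs : ∀ a b, B a b = B b a) (G : V →ₗ[ℝ] V) (hG : ∀ a b, B (G a) b = B a (G b))
    (hGG : ∀ a, G (G a) = a) :
    ∃ (ι : Type) (_ : Fintype ι) (b : Module.Basis ι ℝ V) (s : ι → ℝ),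
      (∀ i, s i * s i = 1) ∧ (∀ i, G (b i) = s i • b i) ∧
      (∀ i j, i ≠ j → B (b i) (b j) = 0) ∧ ∀ i, B (b i) (b i) ≠ 0 := by
  let P : Submodule ℝ V := LinearMap.ker (G - LinearMap.id)
  let N : Submodule ℝ V := LinearMap.ker (G + LinearMap.id)
  have hP : ∀ a ∈ P, G a = a := fun a ha => sub_eq_zero.1 (LinearMap.mem_ker.1 ha)
  have hN : ∀ a ∈ N, G a = -a := fun a ha => eq_neg_of_add_eq_zero_left (LinearMap.mem_ker.1 ha)
  have hPN : ∀ a ∈ P, ∀ b ∈ N, B a b = 0 := by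
    intro a ha b hb
    have := hG a b
    rw [hP a ha, hN b hb, map_neg] at this
    linarith
  have hc : IsCompl P N := by
    refine IsCompl.of_eq ?_ ?_
    · rw [eq_bot_iff]
      intro a ⟨ha, ha'⟩
      have h1 := hP a ha
      rw [hN a ha'] at h1
      have h2 : (2 : ℝ) • a = 0 := by
        calc (2 : ℝ) • a = a - -a := by module
          _ = 0 := by rw [h1, sub_self]
      exact (Submodule.mem_bot ℝ).2 ((smul_eq_zero.1 h2).resolve_left two_ne_zero)
    · rw [eq_top_iff]
      intro a _
      refine Submodule.mem_sup.2 ⟨(1 / 2 : ℝ) • (a + G a), ?_, (1 / 2 : ℝ) • (a - G a), ?_, ?_⟩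
      · simp only [P, LinearMap.mem_ker, LinearMap.sub_apply, LinearMap.id_apply, map_smul, map_add,
          hGG]
        module
      · simp only [N, LinearMap.mem_ker, LinearMap.add_apply, LinearMap.id_apply, map_smul, map_sub,
          hGG]
        module
      · module
  obtain ⟨bP, hbP⟩ := LinearMap.BilinForm.exists_orthogonal_basis (B := B.restrict P)
    ⟨fun a b => hs a b⟩
  obtain ⟨bN, hbN⟩ := LinearMap.BilinForm.exists_orthogonal_basis (B := B.restrict N)
    ⟨fun a b => hs a b⟩
  let b := (bP.prod bN).map (Submodule.prodEquivOfIsCompl P N hc)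
  have hl : ∀ i, b (Sum.inl i) = bP i := fun i => by simp [b]
  have hr : ∀ i, b (Sum.inr i) = bN i := fun i => by simp [b]
  have hortho : ∀ i j, i ≠ j → B (b i) (b j) = 0 := by
    rintro (i | i) (j | j) hij
    · rw [hl, hl]
      exact hbP (fun h => hij (congrArg _ h))
    · rw [hl, hr]
      exact hPN _ (bP i).2 _ (bN j).2
    · rw [hl, hr, hs]
      exact hPN _ (bP j).2 _ (bN i).2
    · rw [hr, hr]
      exact hbN (fun h => hij (congrArg _ h))
  refine ⟨_, inferInstance, b, Sum.elim (fun _ => 1) (fun _ => -1), ?_, ?_, hortho, ?_⟩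
  · rintro (i | i) <;> simp
  · rintro (i | i)
    · rw [hl, hP _ (bP i).2]; simp
    · rw [hr, hN _ (bN i).2]; simp
  · intro i h0
    have h1 : B (b i) = 0 := by
      refine b.ext fun j => ?_
      by_cases hij : i = j
      · rw [← hij, h0]; rfl
      · rw [hortho i j hij]; rfl
    exact b.ne_zero i (hB.1 _ fun a => LinearMap.congr_fun h1 a)

/-! ### Orthogonal frames of eigensections of a pseudometric. -/

section Frames

variable {n : ℕ} {M : Type*} [TopologicalSpace M] [T2Space M]
  [ChartedSpace (EuclideanSpace ℝ (Fin n)) M] [IsManifold (𝓡 n) ∞ M]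
  {F : Type*} [NormedAddCommGroup F] [NormedSpace ℝ F] [FiniteDimensional ℝ F]
  {E : M → Type*} [TopologicalSpace (TotalSpace F E)]
  [∀ x, TopologicalSpace (E x)] [FiberBundle F E]
  [∀ x, AddCommGroup (E x)] [∀ x, Module ℝ (E x)] [VectorBundle ℝ F E]
  [ContMDiffVectorBundle ∞ F E (𝓡 n)]

namespace CourantAlgebroid

variable {A : CourantAlgebroid n F E}

theorem pair_smul_const (u v : Cₛ^∞⟮𝓡 n; F, E⟯) (c : ℝ) (p : M) :
    A.pair u (c • v) p = c * A.pair u v p := by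
  simp [pair_apply]

theorem pair_sub (u v v' : Cₛ^∞⟮𝓡 n; F, E⟯) (p : M) :
    A.pair u (v - v') p = A.pair u v p - A.pair u v' p := by
  simp [pair_apply]

theorem pair_sub_left (u u' v : Cₛ^∞⟮𝓡 n; F, E⟯) (p : M) :
    A.pair (u - u') v p = A.pair u v p - A.pair u' v p := by
  simp [pair_apply]

namespace Pseudometric

variable (G : A.Pseudometric)

theorem act_add (u v : Cₛ^∞⟮𝓡 n; F, E⟯) : G.act (u + v) = G.act u + G.act v := by
  ext y
  exact map_add (G.map y) _ _

theorem act_sub (u v : Cₛ^∞⟮𝓡 n; F, E⟯) : G.act (u - v) = G.act u - G.act v := by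
  ext y
  exact map_sub (G.map y) _ _

theorem act_smul (f : C^∞⟮𝓡 n, M; ℝ⟯) (u : Cₛ^∞⟮𝓡 n; F, E⟯) : G.act (f • u) = f • G.act u := by
  ext y
  exact map_smul (G.map y) _ _

theorem act_const_smul (c : ℝ) (u : Cₛ^∞⟮𝓡 n; F, E⟯) : G.act (c • u) = c • G.act u := by
  ext y
  exact map_smul (G.map y) _ _

theorem act_act (u : Cₛ^∞⟮𝓡 n; F, E⟯) : G.act (G.act u) = u := by
  ext y
  exact G.involutive y _

theorem pair_act_left (u v : Cₛ^∞⟮𝓡 n; F, E⟯) (p : M) :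
    A.pair (G.act u) v p = A.pair u (G.act v) p :=
  G.symmetric p _ _

end Pseudometric

/-- A frame near `x`, orthogonal with constant norms `(w i)⁻¹`, of eigensections of a
pseudometric. -/
structure AdaptedFrame (G : A.Pseudometric) (x : M) where
  e : Fin (Module.finrank ℝ F) → Cₛ^∞⟮𝓡 n; F, E⟯
  s : Fin (Module.finrank ℝ F) → ℝ
  w : Fin (Module.finrank ℝ F) → ℝ
  U : Set M
  isOpen : IsOpen U
  mem : x ∈ U
  s_mul_self : ∀ i, s i * s i = 1
  w_ne : ∀ i, w i ≠ 0
  act : ∀ i, G.act (e i) = s i • e i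
  pair_self : ∀ i, ∀ y ∈ U, A.pair (e i) (e i) y = (w i)⁻¹
  pair_ne : ∀ i j, i ≠ j → ∀ y ∈ U, A.pair (e i) (e j) y = 0
  basis : ∀ y ∈ U, ∃ b : Module.Basis (Fin (Module.finrank ℝ F)) ℝ (E y), ∀ i, b i = e i y

/-- A smooth function that rescales `g` to a constant near `x`. -/
theorem exists_normalizing (g : C^∞⟮𝓡 n, M; ℝ⟯) {x : M} (hg : g x ≠ 0) :
    ∃ f : C^∞⟮𝓡 n, M; ℝ⟯, f x = 1 ∧ ∀ᶠ y in 𝓝 x, f y * f y * g y = g x := by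
  -- The function sought is √(g(x)/g), cut off to the set where g has the sign of g(x). Openness is
  -- checked on g x * g y, which is continuous also where g vanishes.
  have hU : IsOpen {y | 0 < g x * (g y)⁻¹} := by
    have : {y | 0 < g x * (g y)⁻¹} = {y | 0 < g x * g y} := by
      ext y
      constructor
      · intro h
        have h' : 0 < g x * (g y)⁻¹ := h
        have hy : g y ≠ 0 := by intro h0; simp [h0] at h'
        have := mul_pos h' (mul_self_pos.2 hy)
        have e : g x * (g y)⁻¹ * (g y * g y) = g x * g y := by field_simp
        rwa [e] at this
      · intro h
        have h' : 0 < g x * g y := h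
        have hy : g y ≠ 0 := by intro h0; simp [h0] at h'
        have := mul_pos h' (mul_self_pos.2 (inv_ne_zero hy))
        have e : g x * g y * ((g y)⁻¹ * (g y)⁻¹) = g x * (g y)⁻¹ := by field_simp
        rwa [e] at this
    rw [this]
    exact isOpen_lt continuous_const (continuous_const.mul g.contMDiff.continuous)
  have hx : x ∈ {y | 0 < g x * (g y)⁻¹} := by
    change 0 < g x * (g x)⁻¹
    rw [mul_inv_cancel₀ hg]; exact one_pos
  obtain ⟨χ, h1, h2⟩ := exists_bump (n := n) (hU.mem_nhds hx)
  have hf : ContMDiff (𝓡 n) 𝓘(ℝ, ℝ) ∞ fun y => χ y * √(g x * (g y)⁻¹) := by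
    refine contMDiff_of_tsupport fun y hy => ?_
    have hy' : 0 < g x * (g y)⁻¹ := h2 (tsupport_mul_subset_left hy)
    have hgy : g y ≠ 0 := by intro h0; simp [h0] at hy'
    refine χ.contMDiff.contMDiffAt.mul ?_
    exact (Real.contDiffAt_sqrt hy'.ne').contMDiffAt.comp y
      (contMDiffAt_const.mul (g.contMDiff.contMDiffAt.inv₀ hgy))
  refine ⟨⟨_, hf⟩, ?_, ?_⟩
  · simp [h1.self_of_nhds, hg]
  · filter_upwards [h1, hU.mem_nhds hx] with y hy hy'
    have hy'' : 0 < g x * (g y)⁻¹ := hy'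
    have hgy : g y ≠ 0 := by intro h0; simp [h0] at hy''
    simp only [ContMDiffMap.coeFn_mk, hy, one_mul]
    rw [Real.mul_self_sqrt hy''.le]
    field_simp

/-- The Gram–Schmidt process for eigensections of a pseudometric. -/
theorem exists_gramSchmidt (G : A.Pseudometric) {x : M} {ι : Type} [Fintype ι] [DecidableEq ι]
    (e : ι → Cₛ^∞⟮𝓡 n; F, E⟯) (s η : ι → ℝ) (hG : ∀ i, G.act (e i) = s i • e i)
    (h0 : ∀ i j, i ≠ j → A.pair (e i) (e j) x = 0) (h1 : ∀ i, A.pair (e i) (e i) x = η i)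
    (hη : ∀ i, η i ≠ 0) (S : Finset ι) :
    ∃ e' : ι → Cₛ^∞⟮𝓡 n; F, E⟯, (∀ i, G.act (e' i) = s i • e' i) ∧
      (∀ i, e' i x = e i x) ∧ ∀ᶠ y in 𝓝 x, ∀ i ∈ S, A.pair (e' i) (e' i) y = η i ∧
        ∀ j, i ≠ j → A.pair (e' i) (e' j) y = 0 := by
  induction S using Finset.induction_on with
  | empty => exact ⟨e, hG, fun _ => rfl, by simp⟩
  | insert a S ha ih =>
    obtain ⟨e', hG', hx', he'⟩ := ih
    have hpx : ∀ i j, A.pair (e' i) (e' j) x = A.pair (e i) (e j) x := by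
      intro i j
      rw [pair_apply, pair_apply, hx', hx']
    obtain ⟨f, hf1, hf2⟩ := exists_normalizing (A.pair (e' a) (e' a)) (x := x)
      (by rw [hpx, h1]; exact hη a)
    rw [hpx, h1] at hf2
    -- The projection coefficient onto f e'_a, which has constant norm η_a near x; dividing by the
    -- constant keeps it globally smooth.
    let c : ι → C^∞⟮𝓡 n, M; ℝ⟯ := fun j => (η a)⁻¹ • A.pair (f • e' a) (e' j)
    have hc : ∀ j y, c j y = (η a)⁻¹ * (f y * A.pair (e' a) (e' j) y) := by
      intro j y
      change (η a)⁻¹ * A.pair (f • e' a) (e' j) y = _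
      rw [pair_smul_left]
    let e'' : ι → Cₛ^∞⟮𝓡 n; F, E⟯ := fun j => if j = a then f • e' a else e' j - c j • (f • e' a)
    have ea : e'' a = f • e' a := if_pos rfl
    have ej : ∀ j, j ≠ a → e'' j = e' j - c j • (f • e' a) := fun j hj => if_neg hj
    refine ⟨e'', fun j => ?_, fun j => ?_, ?_⟩
    · by_cases hj : j = a
      · subst hj
        rw [ea, G.act_smul, hG']
        ext y
        simp only [ContMDiffSection.coe_smul, Pi.smul_apply, fsmul_apply]
        module
      · rw [ej j hj, G.act_sub, G.act_smul, G.act_smul, hG', hG']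
        ext y
        -- Eigensections for different eigenvalues are orthogonal because G is symmetric. Hence the
        -- projection only mixes sections of the same eigenvalue, and the result is still an
        -- eigensection.
        have h2 : (s a - s j) * A.pair (e' a) (e' j) y = 0 := by
          have h3 := G.pair_act_left (e' a) (e' j) y
          rw [hG', hG', pair_smul_const, pair_symm, pair_smul_const, pair_symm] at h3
          linarith
        have h4 : (s a - s j) * c j y = 0 := by
          rw [hc]; linear_combination (η a)⁻¹ * f y * h2
        have h5 : (c j y * s a) • e' a y = (c j y * s j) • e' a y := by
          congr 1; linarith
        simp only [ContMDiffSection.coe_sub, ContMDiffSection.coe_smul, Pi.sub_apply, Pi.smul_apply,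
          fsmul_apply, smul_sub, smul_smul] at h5 ⊢
        congr 1
        calc (c j y * (f y * s a)) • e' a y = f y • ((c j y * s a) • e' a y) := by module
          _ = (s j * (c j y * f y)) • e' a y := by rw [h5]; module
    · by_cases hj : j = a
      · subst hj
        rw [ea, fsmul_apply, hf1, one_smul, hx']
      · rw [ej j hj]
        have : c j x = 0 := by rw [hc, hpx, h0 a j (Ne.symm hj)]; ring
        simp [this, hx']
    · filter_upwards [he', hf2] with y hy hfy
      -- Sections already treated are orthogonal to e'_a near x, so this stage leaves them unchanged
      -- there.
      have hca : ∀ j ∈ S, j ≠ a → c j y = 0 := by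
        intro j hj hja
        rw [hc, pair_symm, (hy j hj).2 a hja]; ring
      have hvalS : ∀ j ∈ S, e'' j y = e' j y := by
        intro j hj
        have hja : j ≠ a := fun h => ha (h ▸ hj)
        rw [ej j hja]
        simp [hca j hj hja]
      have hself : A.pair (e'' a) (e'' a) y = η a := by
        rw [ea, pair_smul, pair_smul_left, ← mul_assoc, hfy]
      intro i hi
      rcases Finset.mem_insert.1 hi with rfl | hiS
      · refine ⟨hself, fun j hj => ?_⟩
        rw [ea] at hself ⊢
        rw [ej j (Ne.symm hj), pair_sub, pair_smul, hself, hc, pair_smul_left]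
        field_simp [hη i]
        ring
      · have hia : i ≠ a := fun h => ha (h ▸ hiS)
        refine ⟨?_, fun j hj => ?_⟩
        · rw [pair_apply, hvalS i hiS]
          exact (hy i hiS).1
        · rw [pair_apply, hvalS i hiS]
          by_cases hja : j = a
          · subst hja
            have := (hy i hiS).2 j hj
            rw [ea, fsmul_apply, map_smul, ← pair_apply, this, smul_zero]
          · rw [ej j hja]
            have h6 := (hy i hiS).2 j hj
            have h7 := (hy i hiS).2 a hia
            have h8 : A.pair (e' i) (e' j - c j • f • e' a) y = 0 := by
              rw [pair_sub, pair_smul, pair_smul, h6, h7]; ring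
            exact h8

/-- An orthogonal eigenbasis at x is extended to sections, projected to the eigenbundles by ½(1 +
s_i G), which fixes the values at x, and orthogonalized. Orthogonality with nonzero norms makes the
sections independent near x, and their number equals the rank. -/
theorem exists_adaptedFrame (G : A.Pseudometric) (x : M) :
    Nonempty (AdaptedFrame G x) := by
  classical
  have hfin : ∀ y : M, FiniteDimensional ℝ (E y) := fun y =>
    (fiberBasis F E y).finiteDimensional_of_finite
  obtain ⟨κ, _, b₀, s₀, hs₀, hG₀, hb₀, hb₀'⟩ := exists_orthogonal_eigenbasis (A.pairing x)
    (A.pairing_nondegenerate x) (A.pairing_symm x) (G.map x) (G.symmetric x) (G.involutive x)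
  let φ := b₀.indexEquiv (fiberBasis F E x)
  let b := b₀.reindex φ
  let s : Fin (Module.finrank ℝ F) → ℝ := fun i => s₀ (φ.symm i)
  let e : Fin (Module.finrank ℝ F) → Cₛ^∞⟮𝓡 n; F, E⟯ := fun i =>
    (1 / 2 : ℝ) • (extend x (b i) + s i • G.act (extend x (b i)))
  have hs : ∀ i, s i * s i = 1 := fun i => hs₀ _
  have hb : ∀ i, b i = b₀ (φ.symm i) := fun i => by simp [b]
  have hGb : ∀ i, G.map x (b i) = s i • b i := fun i => by rw [hb]; exact hG₀ _
  have hex : ∀ i, e i x = b i := by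
    intro i
    change (1 / 2 : ℝ) • (extend x (b i) x + s i • G.map x (extend x (b i) x)) = b i
    rw [extend_apply, hGb, smul_smul, hs]
    module
  obtain ⟨e', h1, h2, h3⟩ := exists_gramSchmidt G (x := x) e s
    (fun i => A.pairing x (b i) (b i)) (fun i => by
      ext y
      simp only [e, G.act_const_smul, G.act_add, G.act_act]
      simp only [ContMDiffSection.coe_add, ContMDiffSection.coe_smul, Pi.add_apply, Pi.smul_apply]
      have key : ∀ a b : E y, (1 / 2 : ℝ) • (a + s i • b) = s i • ((1 / 2 : ℝ) • (b + s i • a)) := by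
        intro a b
        have h : (s i * s i) • a = a := by rw [hs, one_smul]
        calc (1 / 2 : ℝ) • (a + s i • b) = (1 / 2 : ℝ) • ((s i * s i) • a + s i • b) := by rw [h]
          _ = _ := by module
      exact key _ _)
    (fun i j hij => by
      rw [pair_apply, hex, hex, hb, hb]
      exact hb₀ _ _ (fun h => hij (φ.symm.injective h)))
    (fun i => by rw [pair_apply, hex])
    (fun i => by rw [hb]; exact hb₀' _) Finset.univ
  obtain ⟨U, hU, hUo, hUx⟩ := eventually_nhds_iff.1 h3
  have hne : ∀ i, A.pairing x (b i) (b i) ≠ 0 := fun i => by rw [hb]; exact hb₀' _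
  refine ⟨⟨e', s, fun i => (A.pairing x (b i) (b i))⁻¹, U, hUo, hUx, hs,
    fun i => inv_ne_zero (hne i), h1,
    fun i y hy => ?_, fun i j hij y hy => (hU y hy i (Finset.mem_univ _)).2 j hij, fun y hy => ?_⟩⟩
  · rw [inv_inv]
    exact (hU y hy i (Finset.mem_univ _)).1
  · have hli : LinearIndependent ℝ fun i => e' i y := by
      refine LinearMap.linearIndependent_of_isOrthoᵢ (B := A.pairing y) (fun i j hij => ?_)
        fun i hi => ?_
      · exact (hU y hy i (Finset.mem_univ _)).2 j hij
      · have h4 := (hU y hy i (Finset.mem_univ _)).1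
        exact hne i (h4.symm.trans hi)
    have := hfin y
    exact ⟨Module.Basis.mk hli (hli.span_eq_top_of_card_eq_finrank'
      (Module.finrank_eq_card_basis (fiberBasis F E y)).symm).ge, fun i => by simp⟩

end CourantAlgebroid
end Frames

/-! ### Curvature of a Levi-Civita connection in components. -/

namespace FrameAlgebra
namespace Jet

variable {ι : Type*} [Fintype ι] {η : ι → ℝ} (J : Jet η)

/-- The quadratic term is symmetric once the weights are exchanged as well, and the antisymmetric
part of the other terms is the formula for the divergence of a bracket. -/
theorem mixedRicci_symm {p m : ι → ℝ} (hη : ∀ i, η i = p i + m i)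
    (hdiv : ∀ i j, J.dd i j - J.dd j i = ∑ n, η n * (J.dc n i j n + J.c i j n * J.d n)) (a b : ι) :
    J.mixedRicci p m a b = J.mixedRicci m p b a := by
  have h := hdiv a b
  have h1 : ∑ e, ∑ f, p e * m f * (J.c a e f * J.c b e f)
      = ∑ e, ∑ f, m e * p f * (J.c b e f * J.c a e f) := by
    rw [Finset.sum_comm]
    refine Finset.sum_congr rfl fun e _ => Finset.sum_congr rfl fun f _ => ?_
    rw [J.alt.swap₂₃ a f e, J.alt.swap₂₃ b f e]; ring
  have h2 : ∑ e, m e * J.dc e b a e = -∑ e, m e * J.dc e a b e := by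
    rw [← Finset.sum_neg_distrib]
    exact Finset.sum_congr rfl fun e _ => by rw [(J.alt_dc e).swap₁₂ b a]; ring
  have h3 : ∑ e, m e * (J.c b a e * J.d e) = -∑ e, m e * (J.c a b e * J.d e) := by
    rw [← Finset.sum_neg_distrib]
    exact Finset.sum_congr rfl fun e _ => by rw [J.alt.swap₁₂ b a]; ring
  simp only [hη, add_mul, mul_add, Finset.sum_add_distrib] at h
  rw [mixedRicci, mixedRicci, h1, h2, h3]
  linarith

/-- The components of a torsion-free connection preserving a pairing and an involution with
eigenvalues `s i`, and their derivatives. -/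
structure LeviCivita (s : ι → ℝ) where
  g : ι → ι → ι → ℝ
  dg : ι → ι → ι → ι → ℝ
  antisymm : ∀ i j k, g i j k = -g i k j
  dantisymm : ∀ l i j k, dg l i j k = -dg l i k j
  compat : ∀ i j k, s j ≠ s k → g i j k = 0
  dcompat : ∀ l i j k, s j ≠ s k → dg l i j k = 0
  torsion : ∀ i j k, J.c i j k = g i j k + g j k i + g k i j
  dtorsion : ∀ l i j k, J.dc l i j k = dg l i j k + dg l j k i + dg l k i j
  d_eq : ∀ k, J.d k = ∑ i, η i * g i k i
  dd_eq : ∀ l k, J.dd l k = ∑ i, η i * dg l i k i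

/-- The weight of the eigenbundle with eigenvalue `σ`. -/
def weight (η s : ι → ℝ) (σ : ℝ) (i : ι) : ℝ := if s i = σ then η i else 0

namespace LeviCivita

variable {J} {s : ι → ℝ} (L : J.LeviCivita s)

/-- The other two cyclic terms of the torsion identity pair different eigenbundles, so they vanish.
These coefficients are therefore the same for every Levi-Civita connection. -/
theorem g_eq_c {i j k : ι} (hij : s i ≠ s j) (hjk : s j = s k) : L.g i j k = J.c i j k := by
  rw [L.torsion, L.compat j k i (by rw [← hjk]; exact hij.symm), L.compat k i j hij]
  ring

theorem dg_eq_dc {l i j k : ι} (hij : s i ≠ s j) (hjk : s j = s k) :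
    L.dg l i j k = J.dc l i j k := by
  rw [L.dtorsion, L.dcompat l j k i (by rw [← hjk]; exact hij.symm), L.dcompat l k i j hij]
  ring

/-- The components `⟨[D_i, D_j] e_k, e_l⟩`. -/
def curv (i j k l : ι) : ℝ :=
  L.dg i j k l - L.dg j i k l - ∑ m, η m * (L.g j k m * L.g i l m)
    + ∑ m, η m * (L.g i k m * L.g j l m) - ∑ m, η m * ((L.g i j m - L.g j i m) * L.g m k l)

theorem curv_swap₁₂ (i j k l : ι) : L.curv i j k l = -L.curv j i k l := by
  have h : ∑ m, η m * ((L.g i j m - L.g j i m) * L.g m k l)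
      = -∑ m, η m * ((L.g j i m - L.g i j m) * L.g m k l) := by
    rw [← Finset.sum_neg_distrib]
    exact Finset.sum_congr rfl fun m _ => by ring
  rw [curv, curv, h]; ring

theorem curv_swap₃₄ (i j k l : ι) : L.curv i j k l = -L.curv i j l k := by
  have h : ∑ m, η m * ((L.g i j m - L.g j i m) * L.g m k l)
      = -∑ m, η m * ((L.g i j m - L.g j i m) * L.g m l k) := by
    rw [← Finset.sum_neg_distrib]
    exact Finset.sum_congr rfl fun m _ => by rw [L.antisymm m k l]; ring
  have h1 : ∑ m, η m * (L.g j k m * L.g i l m) = ∑ m, η m * (L.g i l m * L.g j k m) :=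
    Finset.sum_congr rfl fun m _ => by ring
  have h2 : ∑ m, η m * (L.g i k m * L.g j l m) = ∑ m, η m * (L.g j l m * L.g i k m) :=
    Finset.sum_congr rfl fun m _ => by ring
  rw [curv, curv, h, h1, h2, L.dantisymm i j k l, L.dantisymm j i k l]; ring

/-- The components of the full Ricci tensor. -/
def ricci (q r : ι) : ℝ :=
  ∑ i, η i * (1 / 2 * (L.curv i r q i + L.curv q i i r - ∑ m, η m * (L.g m i r * L.g m q i)))

theorem sum_g_self (m : ι) : ∑ i, η i * L.g i i m = -J.d m := by
  rw [L.d_eq, ← Finset.sum_neg_distrib]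
  exact Finset.sum_congr rfl fun i _ => by rw [L.antisymm]; ring

theorem sum_dg_self (l m : ι) : ∑ i, η i * L.dg l i i m = -J.dd l m := by
  rw [L.dd_eq, ← Finset.sum_neg_distrib]
  exact Finset.sum_congr rfl fun i _ => by rw [L.dantisymm]; ring

/-- When e_q and e_r lie in different eigenbundles, every coefficient left in this trace is either
of mixed type, hence a structure function, or traced, hence a divergence. -/
theorem sum_curv_mixed {q r : ι} (hqr : s q ≠ s r) :
    ∑ i, η i * L.curv i r q i = J.mixedRicci (weight η s (s r)) (weight η s (s q)) q r := by
  have t1 : ∑ i, η i * L.dg i r q i = ∑ e, weight η s (s q) e * J.dc e r q e := by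
    refine Finset.sum_congr rfl fun i _ => ?_
    rw [weight]
    split_ifs with h
    · rw [L.dg_eq_dc (Ne.symm hqr) h.symm]
    · rw [L.dcompat _ _ _ _ (Ne.symm h)]; ring
  have t2 : ∑ i, η i * L.dg r i q i = J.dd r q := (L.dd_eq r q).symm
  have t3 : ∑ i, η i * ∑ m, η m * (L.g r q m * L.g i i m)
      = -∑ e, weight η s (s q) e * (J.c r q e * J.d e) := by
    simp only [Finset.mul_sum]
    rw [Finset.sum_comm, ← Finset.sum_neg_distrib]
    refine Finset.sum_congr rfl fun m _ => ?_
    have h1 : ∑ i, η i * (η m * (L.g r q m * L.g i i m)) = -(η m * L.g r q m * J.d m) := by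
      rw [← mul_neg, ← L.sum_g_self, Finset.mul_sum]
      exact Finset.sum_congr rfl fun i _ => by ring
    rw [h1, weight]
    split_ifs with h
    · rw [L.g_eq_c (Ne.symm hqr) h.symm]; ring
    · rw [L.compat _ _ _ (Ne.symm h)]; ring
  -- These sums contain coefficients within one eigenbundle, which c does not determine. By
  -- antisymmetry they cancel against one half of the D_{D_i e_r - D_r e_i} term.
  have t4 : ∑ i, η i * ∑ m, η m * (L.g i q m * L.g r i m)
      = -∑ i, η i * ∑ m, η m * (L.g r i m * L.g m q i) := by
    simp only [Finset.mul_sum]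
    rw [Finset.sum_comm, ← Finset.sum_neg_distrib]
    refine Finset.sum_congr rfl fun i _ => ?_
    rw [← Finset.sum_neg_distrib]
    refine Finset.sum_congr rfl fun m _ => ?_
    rw [L.antisymm r m i]; ring
  have t5 : ∑ i, η i * ∑ m, η m * (L.g i r m * L.g m q i)
      = -∑ e, ∑ f, weight η s (s q) e * weight η s (s r) f * (J.c r e f * J.c q e f) := by
    rw [← Finset.sum_neg_distrib]
    refine Finset.sum_congr rfl fun i _ => ?_
    rw [Finset.mul_sum, ← Finset.sum_neg_distrib]
    refine Finset.sum_congr rfl fun m _ => ?_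
    by_cases hi : s i = s q
    · by_cases hm : s m = s r
      · rw [weight, weight, if_pos hi, if_pos hm, L.g_eq_c (by rw [hi]; exact hqr) hm.symm,
          L.g_eq_c (by rw [hm]; exact hqr.symm) hi.symm, J.alt.swap₁₂ i r m, J.alt.rotate m q i]
        ring
      · rw [L.compat i r m (Ne.symm hm), weight, weight, if_neg hm]; ring
    · rw [L.compat m q i (Ne.symm hi), weight, if_neg hi]; ring
  simp only [curv, mul_add, mul_sub, sub_mul, Finset.sum_add_distrib, Finset.sum_sub_distrib]
  rw [t1, t2, t3, t4, t5, mixedRicci]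
  ring

/-- The product of connection coefficients drops out, because e_i would have to lie in both
eigenbundles. What remains is the mean of two mixed curvature traces, which agree by
`mixedRicci_symm`. -/
theorem ricci_mixed {q r : ι} (hqr : s q ≠ s r)
    (hη : ∀ i, η i = weight η s (s r) i + weight η s (s q) i)
    (hdiv : ∀ i j, J.dd i j - J.dd j i = ∑ n, η n * (J.dc n i j n + J.c i j n * J.d n)) :
    L.ricci q r = J.mixedRicci (weight η s (s r)) (weight η s (s q)) q r := by
  have h1 := L.sum_curv_mixed hqr
  have h2 := L.sum_curv_mixed hqr.symm
  rw [← J.mixedRicci_symm hη hdiv] at h2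
  have h3 : L.ricci q r = 1 / 2 * (∑ i, η i * L.curv i r q i + ∑ i, η i * L.curv i q r i) := by
    rw [ricci, ← Finset.sum_add_distrib, Finset.mul_sum]
    refine Finset.sum_congr rfl fun i _ => ?_
    have h4 : ∑ m, η m * (L.g m i r * L.g m q i) = 0 := by
      refine Finset.sum_eq_zero fun m _ => ?_
      by_cases hi : s i = s r
      · rw [L.compat m q i (by rw [hi]; exact hqr)]; ring
      · rw [L.compat m i r hi]; ring
    rw [h4, L.curv_swap₁₂ q i, L.curv_swap₃₄ i q i r]
    ring
  rw [h3, h1, h2]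
  ring

/-- The partial trace of the full Ricci tensor over an eigenbundle. -/
theorem sum_ricci_self {σ : ℝ} {p m : ι → ℝ} (hm : m = weight η s σ) (hp : p = η - m) :
    ∑ q, m q * L.ricci q q
      = -2 * ∑ a, m a * J.dd a a - ∑ a, m a * (J.d a * J.d a)
        + 1 / 6 * ∑ a, ∑ b, ∑ e, m a * m b * m e * (J.c a b e * J.c a b e)
        + 1 / 2 * ∑ a, ∑ b, ∑ e, p a * m b * m e * (J.c a b e * J.c a b e) := by
  have hη : ∀ i, η i = p i + m i := fun i => by rw [hp]; simp
  have hmσ : ∀ i, m i ≠ 0 → s i = σ := by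
    intro i hi
    rw [hm, weight] at hi
    by_contra h
    rw [if_neg h] at hi
    exact hi rfl
  have hpσ : ∀ i, p i ≠ 0 → s i ≠ σ := by
    intro i hi h
    apply hi
    rw [hp, hm, Pi.sub_apply, weight, if_pos h, sub_self]
  -- D preserves the eigenbundles, so if the second index of g lies in the chosen one, the sum over
  -- the third may be restricted to it as well.
  have hlink : ∀ (X : ℝ) (i j k : ι), m j * η k * (X * L.g i j k) = m j * m k * (X * L.g i j k) := by
    intro X i j k
    by_cases hj : m j = 0
    · rw [hj]; ring
    by_cases hk : p k = 0
    · rw [hη, hk, zero_add]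
    · rw [L.compat i j k (by rw [hmσ j hj]; exact (hpσ k hk).symm)]; ring
  have hlinkd : ∀ (l i j k : ι), m j * η k * L.dg l i j k = m j * m k * L.dg l i j k := by
    intro l i j k
    by_cases hj : m j = 0
    · rw [hj]; ring
    by_cases hk : p k = 0
    · rw [hη, hk, zero_add]
    · rw [L.dcompat l i j k (by rw [hmσ j hj]; exact (hpσ k hk).symm)]; ring
  have hA : ∑ q, m q * L.ricci q q = ∑ q, ∑ i, m q * η i * L.curv i q q i
      + 1 / 2 * ∑ q, ∑ i, ∑ l, m q * η i * η l * (L.g l q i * L.g l q i) := by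
    simp only [ricci, Finset.mul_sum, ← Finset.sum_add_distrib]
    refine Finset.sum_congr rfl fun q _ => Finset.sum_congr rfl fun i _ => ?_
    have h : ∑ l, η l * (L.g l i q * L.g l q i) = -∑ l, η l * (L.g l q i * L.g l q i) := by
      rw [← Finset.sum_neg_distrib]
      exact Finset.sum_congr rfl fun l _ => by rw [L.antisymm l i q]; ring
    rw [L.curv_swap₁₂ q i, L.curv_swap₃₄ i q i q, h, ← Finset.mul_sum]
    simp only [mul_assoc, ← Finset.mul_sum]
    ring
  have u1 : ∑ q, ∑ i, m q * η i * L.dg i q q i = -∑ a, m a * J.dd a a := by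
    simp only [hlinkd]
    rw [Finset.sum_comm, ← Finset.sum_neg_distrib]
    refine Finset.sum_congr rfl fun i _ => ?_
    rw [← mul_neg, ← L.sum_dg_self, Finset.mul_sum]
    refine Finset.sum_congr rfl fun q _ => ?_
    have := hlinkd i q i q
    rw [L.dantisymm i q i q] at this
    linarith
  have u2 : ∑ q, ∑ i, m q * η i * L.dg q i q i = ∑ a, m a * J.dd a a := by
    refine Finset.sum_congr rfl fun q _ => ?_
    rw [L.dd_eq, Finset.mul_sum]
    exact Finset.sum_congr rfl fun i _ => by ring
  have u3 : ∑ q, ∑ i, m q * η i * ∑ l, η l * (L.g q q l * L.g i i l)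
      = ∑ a, m a * (J.d a * J.d a) := by
    have e1 : ∀ q, ∑ i, m q * η i * ∑ l, η l * (L.g q q l * L.g i i l)
        = ∑ l, m q * η l * (-J.d l * L.g q q l) := by
      intro q
      simp only [Finset.mul_sum]
      rw [Finset.sum_comm]
      refine Finset.sum_congr rfl fun l _ => ?_
      rw [← L.sum_g_self, Finset.sum_mul, Finset.mul_sum]
      exact Finset.sum_congr rfl fun i _ => by ring
    simp only [e1, hlink]
    rw [Finset.sum_comm]
    refine Finset.sum_congr rfl fun l _ => ?_
    have e2 : ∑ q, m q * m l * (-J.d l * L.g q q l) = m l * -J.d l * ∑ q, η q * L.g q q l := by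
      rw [Finset.mul_sum]
      refine Finset.sum_congr rfl fun q _ => ?_
      have := hlink (-J.d l) q l q
      rw [L.antisymm q l q] at this
      linarith
    rw [e2, L.sum_g_self]
    ring
  have hmmm : ∀ X : ι → ι → ι → ℝ, (∀ q i l, m q ≠ 0 → p i ≠ 0 → X q i l = 0) →
      (∀ q i l, m q ≠ 0 → m i ≠ 0 → p l ≠ 0 → X q i l = 0) →
      ∑ q, ∑ i, m q * η i * ∑ l, η l * X q i l = ∑ q, ∑ i, ∑ l, m q * m i * m l * X q i l := by
    intro X h1 h2
    refine Finset.sum_congr rfl fun q _ => Finset.sum_congr rfl fun i _ => ?_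
    rw [Finset.mul_sum]
    refine Finset.sum_congr rfl fun l _ => ?_
    by_cases hq : m q = 0
    · rw [hq]; ring
    by_cases hi : p i = 0
    · by_cases hi' : m i = 0
      · rw [hη i, hi, hi']; ring
      by_cases hl : p l = 0
      · rw [hη i, hη l, hi, hl]; ring
      · rw [h2 q i l hq hi' hl]; ring
    · rw [h1 q i l hq hi]; ring
  -- A and B are built from the undetermined coefficients within the eigenbundle. They enter only as
  -- A + B/2, and squaring the torsion identity gives Σ c² = 3B + 6A in `c7`; this explains the
  -- factor 1/6.
  set A := ∑ a, ∑ b, ∑ e, m a * m b * m e * (L.g a b e * L.g b e a) with hAdef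
  set B := ∑ a, ∑ b, ∑ e, m a * m b * m e * (L.g a b e * L.g a b e) with hBdef
  have cA : ∑ a, ∑ b, ∑ e, m a * m b * m e * (L.g a b e * L.g e a b) = A := by
    simp only [hAdef]
    rw [sum_swap₁₂, sum_swap₁₃]
    refine Finset.sum_congr rfl fun a _ => Finset.sum_congr rfl fun b _ =>
      Finset.sum_congr rfl fun e _ => ?_
    ring
  have c4 : ∑ q, ∑ i, m q * η i * ∑ l, η l * (L.g i q l * L.g q i l) = -A := by
    rw [hmmm]
    · simp only [hAdef, ← Finset.sum_neg_distrib]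
      rw [sum_swap₁₂]
      refine Finset.sum_congr rfl fun a _ => Finset.sum_congr rfl fun b _ =>
        Finset.sum_congr rfl fun e _ => ?_
      rw [L.antisymm b a e]; ring
    · intro q i l hq hi
      by_cases hl : s l = σ
      · rw [L.compat q i l (by rw [hl]; exact hpσ i hi)]; ring
      · rw [L.compat i q l (by rw [hmσ q hq]; exact Ne.symm hl)]; ring
    · intro q i l hq _ hl
      rw [L.compat i q l (by rw [hmσ q hq]; exact (hpσ l hl).symm)]; ring
  have c5 : ∑ q, ∑ i, m q * η i * ∑ l, η l * ((L.g i q l - L.g q i l) * L.g l q i) = -2 * A := by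
    have e1 : ∑ a, ∑ b, ∑ e, m a * m b * m e * (L.g b a e * L.g e a b) = -A := by
      simp only [hAdef, ← Finset.sum_neg_distrib]
      rw [sum_swap₁₃]
      refine Finset.sum_congr rfl fun a _ => Finset.sum_congr rfl fun b _ =>
        Finset.sum_congr rfl fun e _ => ?_
      rw [L.antisymm a e b]; ring
    rw [hmmm]
    · have e3 : ∑ q, ∑ i, ∑ l, m q * m i * m l * ((L.g i q l - L.g q i l) * L.g l q i)
          = ∑ a, ∑ b, ∑ e, m a * m b * m e * (L.g b a e * L.g e a b)
            - ∑ a, ∑ b, ∑ e, m a * m b * m e * (L.g a b e * L.g e a b) := by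
        simp only [← Finset.sum_sub_distrib]
        refine Finset.sum_congr rfl fun a _ => Finset.sum_congr rfl fun b _ =>
          Finset.sum_congr rfl fun e _ => ?_
        ring
      rw [e3, e1, cA]; ring
    · intro q i l hq hi
      rw [L.compat l q i (by rw [hmσ q hq]; exact (hpσ i hi).symm)]; ring
    · intro q i l hq hi hl
      rw [L.compat i q l (by rw [hmσ q hq]; exact (hpσ l hl).symm),
        L.compat q i l (by rw [hmσ i hi]; exact (hpσ l hl).symm)]; ring
  -- The index l of the differentiating section is the only one not tied to the eigenbundle. Inside
  -- it contributes B; outside it the coefficient is mixed and equals c.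
  have c6 : ∑ q, ∑ i, ∑ l, m q * η i * η l * (L.g l q i * L.g l q i)
      = B + ∑ a, ∑ b, ∑ e, p a * m b * m e * (J.c a b e * J.c a b e) := by
    have e1 : ∀ q i l, m q * η i * η l * (L.g l q i * L.g l q i)
        = m q * m i * m l * (L.g l q i * L.g l q i)
          + m q * m i * p l * (J.c l q i * J.c l q i) := by
      intro q i l
      have h1 : m q * η i * η l * (L.g l q i * L.g l q i)
          = m q * m i * η l * (L.g l q i * L.g l q i) := by
        linear_combination η l * hlink (L.g l q i) l q i
      rw [h1, hη l]
      by_cases hq : m q = 0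
      · rw [hq]; ring
      by_cases hi : m i = 0
      · rw [hi]; ring
      by_cases hl : p l = 0
      · rw [hl]; ring
      · rw [L.g_eq_c (by rw [hmσ q hq]; exact hpσ l hl) (by rw [hmσ q hq, hmσ i hi])]
        ring
    simp only [e1, Finset.sum_add_distrib]
    congr 1
    · rw [sum_swap₁₂, sum_swap₁₃]
      refine Finset.sum_congr rfl fun a _ => Finset.sum_congr rfl fun b _ =>
        Finset.sum_congr rfl fun e _ => ?_
      ring
    · rw [sum_swap₁₂, sum_swap₁₃]
      refine Finset.sum_congr rfl fun a _ => Finset.sum_congr rfl fun b _ =>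
        Finset.sum_congr rfl fun e _ => ?_
      ring
  have c7 : ∑ a, ∑ b, ∑ e, m a * m b * m e * (J.c a b e * J.c a b e) = 3 * B + 6 * A := by
    have hrot : ∀ X : ι → ι → ι → ℝ, ∑ a, ∑ b, ∑ e, m a * m b * m e * X b e a
        = ∑ a, ∑ b, ∑ e, m a * m b * m e * X a b e := by
      intro X
      rw [sum_swap₁₃, sum_swap₁₂]
      refine Finset.sum_congr rfl fun a _ => Finset.sum_congr rfl fun b _ =>
        Finset.sum_congr rfl fun e _ => ?_
      ring
    have e1 := hrot fun a b e => L.g a b e * L.g a b e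
    have e2 := hrot fun a b e => L.g b e a * L.g b e a
    have e3 := hrot fun a b e => L.g a b e * L.g b e a
    have e4 : ∑ a, ∑ b, ∑ e, m a * m b * m e * (J.c a b e * J.c a b e)
        = ∑ a, ∑ b, ∑ e, m a * m b * m e * (L.g a b e * L.g a b e)
          + ∑ a, ∑ b, ∑ e, m a * m b * m e * (L.g b e a * L.g b e a)
          + ∑ a, ∑ b, ∑ e, m a * m b * m e * (L.g e a b * L.g e a b)
          + 2 * ∑ a, ∑ b, ∑ e, m a * m b * m e * (L.g a b e * L.g b e a)
          + 2 * ∑ a, ∑ b, ∑ e, m a * m b * m e * (L.g b e a * L.g e a b)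
          + 2 * ∑ a, ∑ b, ∑ e, m a * m b * m e * (L.g a b e * L.g e a b) := by
      simp only [Finset.mul_sum, ← Finset.sum_add_distrib]
      refine Finset.sum_congr rfl fun a _ => Finset.sum_congr rfl fun b _ =>
        Finset.sum_congr rfl fun e _ => ?_
      rw [L.torsion]; ring
    rw [e4, cA]
    linarith
  rw [hA, c6]
  have c8 : ∑ q, ∑ i, m q * η i * L.curv i q q i
      = ∑ q, ∑ i, m q * η i * L.dg i q q i - ∑ q, ∑ i, m q * η i * L.dg q i q i
        - ∑ q, ∑ i, m q * η i * ∑ l, η l * (L.g q q l * L.g i i l)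
        + ∑ q, ∑ i, m q * η i * ∑ l, η l * (L.g i q l * L.g q i l)
        - ∑ q, ∑ i, m q * η i * ∑ l, η l * ((L.g i q l - L.g q i l) * L.g l q i) := by
    simp only [curv, mul_add, mul_sub, Finset.sum_add_distrib, Finset.sum_sub_distrib]
  rw [c8, u1, u2, u3, c4, c5]
  linarith

end LeviCivita
end Jet
end FrameAlgebra

/-! ### Derivatives along the anchor and structure functions of an adapted frame. -/

section FrameCalculus

variable {n : ℕ} {M : Type*} [TopologicalSpace M] [T2Space M]
  [ChartedSpace (EuclideanSpace ℝ (Fin n)) M] [IsManifold (𝓡 n) ∞ M]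
  {F : Type*} [NormedAddCommGroup F] [NormedSpace ℝ F] [FiniteDimensional ℝ F]
  {E : M → Type*} [TopologicalSpace (TotalSpace F E)]
  [∀ x, TopologicalSpace (E x)] [FiberBundle F E]
  [∀ x, AddCommGroup (E x)] [∀ x, Module ℝ (E x)] [VectorBundle ℝ F E]
  [ContMDiffVectorBundle ∞ F E (𝓡 n)]

theorem fun_add_apply (f g : C^∞⟮𝓡 n, M; ℝ⟯) (y : M) : (f + g) y = f y + g y := rfl

theorem fun_sub_apply (f g : C^∞⟮𝓡 n, M; ℝ⟯) (y : M) : (f - g) y = f y - g y := rfl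

theorem fun_neg_apply (f : C^∞⟮𝓡 n, M; ℝ⟯) (y : M) : (-f) y = -f y := rfl

theorem fun_mul_apply (f g : C^∞⟮𝓡 n, M; ℝ⟯) (y : M) : (f * g) y = f y * g y := rfl

theorem fun_smul_apply (c : ℝ) (f : C^∞⟮𝓡 n, M; ℝ⟯) (y : M) : (c • f) y = c * f y := rfl

theorem fun_sum_apply {ι : Type*} (s : Finset ι) (f : ι → C^∞⟮𝓡 n, M; ℝ⟯) (y : M) :
    (∑ i ∈ s, f i) y = ∑ i ∈ s, f i y :=
  map_sum (ContMDiffMap.evalRingHom (I := 𝓡 n) (I' := 𝓘(ℝ, ℝ)) (R := ℝ) (n := ∞) y) f s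

namespace CourantAlgebroid

variable {A : CourantAlgebroid n F E}

theorem rho_add (u : Cₛ^∞⟮𝓡 n; F, E⟯) (f g : C^∞⟮𝓡 n, M; ℝ⟯) :
    A.rho u (f + g) = A.rho u f + A.rho u g := by
  ext y
  have h := mfderiv_add (f.contMDiff.mdifferentiableAt (x := y) (by simp))
    (g.contMDiff.mdifferentiableAt (x := y) (by simp))
  exact congrArg (fun T => T (A.anchor y (u y))) h

theorem rho_mul (u : Cₛ^∞⟮𝓡 n; F, E⟯) (f g : C^∞⟮𝓡 n, M; ℝ⟯) :
    A.rho u (f * g) = f * A.rho u g + g * A.rho u f := by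
  ext y
  have h := ((f.contMDiff.mdifferentiableAt (x := y) (by simp)).hasMFDerivAt.mul
    (g.contMDiff.mdifferentiableAt (x := y) (by simp)).hasMFDerivAt).mfderiv
  exact congrArg (fun T => T (A.anchor y (u y))) h

theorem rho_smul (u : Cₛ^∞⟮𝓡 n; F, E⟯) (c : ℝ) (f : C^∞⟮𝓡 n, M; ℝ⟯) :
    A.rho u (c • f) = c • A.rho u f := by
  ext y
  have h := const_smul_mfderiv (f.contMDiff.mdifferentiableAt (x := y) (by simp)) c
  exact congrArg (fun T => T (A.anchor y (u y))) h

theorem rho_neg (u : Cₛ^∞⟮𝓡 n; F, E⟯) (f : C^∞⟮𝓡 n, M; ℝ⟯) : A.rho u (-f) = -A.rho u f := by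
  rw [← neg_one_smul ℝ f, rho_smul, neg_one_smul]

theorem rho_sub (u : Cₛ^∞⟮𝓡 n; F, E⟯) (f g : C^∞⟮𝓡 n, M; ℝ⟯) :
    A.rho u (f - g) = A.rho u f - A.rho u g := by
  rw [sub_eq_add_neg, rho_add, rho_neg, sub_eq_add_neg]

theorem rho_sum (u : Cₛ^∞⟮𝓡 n; F, E⟯) {ι : Type*} (s : Finset ι) (f : ι → C^∞⟮𝓡 n, M; ℝ⟯) :
    A.rho u (∑ i ∈ s, f i) = ∑ i ∈ s, A.rho u (f i) :=
  map_sum (AddMonoidHom.mk' (A.rho u) (rho_add u)) f s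

theorem rho_congr (u : Cₛ^∞⟮𝓡 n; F, E⟯) {f g : C^∞⟮𝓡 n, M; ℝ⟯} {U : Set M} (hU : IsOpen U)
    (h : ∀ y ∈ U, f y = g y) {y : M} (hy : y ∈ U) : A.rho u f y = A.rho u g y := by
  have e : (f : M → ℝ) =ᶠ[𝓝 y] g := Filter.eventuallyEq_of_mem (hU.mem_nhds hy) h
  have h1 := e.mfderiv_eq (I := 𝓡 n) (I' := 𝓘(ℝ, ℝ))
  exact congrArg (fun T => T (A.anchor y (u y))) h1

theorem rho_eq_zero_of_const (u : Cₛ^∞⟮𝓡 n; F, E⟯) {f : C^∞⟮𝓡 n, M; ℝ⟯} {U : Set M}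
    (hU : IsOpen U) {c : ℝ} (h : ∀ y ∈ U, f y = c) {y : M} (hy : y ∈ U) : A.rho u f y = 0 := by
  have e : (f : M → ℝ) =ᶠ[𝓝 y] fun _ => c := Filter.eventuallyEq_of_mem (hU.mem_nhds hy) h
  have h1 := e.mfderiv_eq (I := 𝓡 n) (I' := 𝓘(ℝ, ℝ))
  rw [mfderiv_const] at h1
  exact congrArg (fun T => T (A.anchor y (u y))) h1

theorem rho_pair (u v w : Cₛ^∞⟮𝓡 n; F, E⟯) (y : M) :
    A.rho u (A.pair v w) y = A.pair (A.bracket u v) w y + A.pair v (A.bracket u w) y :=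
  A.invariant u v w y

theorem pair_bracket_swap (u v w : Cₛ^∞⟮𝓡 n; F, E⟯) (y : M) :
    A.pair (A.bracket u v) w y = -A.pair (A.bracket v u) w y + A.rho w (A.pair u v) y := by
  have h := A.symmetric_part u v w y
  change _ = A.rho w (A.pair u v) y at h
  rw [← h, map_add, LinearMap.add_apply, pair_apply, pair_apply]
  ring

theorem Connection.rho_pair (D : A.Connection) (u v w : Cₛ^∞⟮𝓡 n; F, E⟯) (y : M) :
    A.rho u (A.pair v w) y = A.pair (D.cov u v) w y + A.pair v (D.cov u w) y :=
  D.metric u v w y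

namespace AdaptedFrame

variable {G : A.Pseudometric} {x : M} (Fr : AdaptedFrame G x) {y : M}

theorem sum_smul (hy : y ∈ Fr.U) (u : Cₛ^∞⟮𝓡 n; F, E⟯) :
    ∑ i, (Fr.w i * A.pair u (Fr.e i) y) • Fr.e i y = u y := by
  obtain ⟨b, hb⟩ := Fr.basis y hy
  conv_rhs => rw [← b.sum_repr (u y)]
  refine Finset.sum_congr rfl fun j _ => ?_
  rw [hb]
  congr 1
  have h : A.pair u (Fr.e j) y = b.repr (u y) j * (Fr.w j)⁻¹ := by
    conv_lhs => rw [pair_apply, ← b.sum_repr (u y)]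
    simp only [map_sum, _root_.map_smul, LinearMap.sum_apply, LinearMap.smul_apply, smul_eq_mul, hb]
    rw [Finset.sum_eq_single j]
    · rw [← Fr.pair_self j y hy, pair_apply]
    · intro i _ hij
      have := Fr.pair_ne i j hij y hy
      rw [pair_apply] at this
      rw [this, mul_zero]
    · simp
  rw [h]
  field_simp [Fr.w_ne j]

theorem expand {α : Cₛ^∞⟮𝓡 n; F, E⟯ → M → ℝ} (hα : IsTensorial α) (hy : y ∈ Fr.U)
    (u : Cₛ^∞⟮𝓡 n; F, E⟯) :
    α u y = ∑ i, Fr.w i * (A.pair u (Fr.e i) y * α (Fr.e i) y) := by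
  rw [← hα.atPoint_apply, ← Fr.sum_smul hy u]
  simp only [map_sum, _root_.map_smul, hα.atPoint_apply, smul_eq_mul, mul_assoc]

theorem pair_expand (hy : y ∈ Fr.U) (u v : Cₛ^∞⟮𝓡 n; F, E⟯) :
    A.pair u v y = ∑ i, Fr.w i * (A.pair u (Fr.e i) y * A.pair v (Fr.e i) y) := by
  rw [Fr.expand (α := fun u => A.pair u v)
    ⟨fun _ _ _ => A.pair_add_left _ _ _ _, fun _ _ _ => A.pair_smul_left _ _ _ _⟩ hy u]
  simp only [A.pair_symm v]

theorem rho_expand (hy : y ∈ Fr.U) (u : Cₛ^∞⟮𝓡 n; F, E⟯) (f : C^∞⟮𝓡 n, M; ℝ⟯) :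
    A.rho u f y = ∑ i, Fr.w i * (A.pair u (Fr.e i) y * A.rho (Fr.e i) f y) := by
  refine Fr.expand (α := fun u => A.rho u f) ⟨fun u v z => ?_, fun g u z => ?_⟩ hy u
  · change dirDeriv f z (A.anchor z (u z + v z)) = _
    rw [map_add, map_add]; rfl
  · change dirDeriv f z (A.anchor z (g z • u z)) = _
    rw [_root_.map_smul, _root_.map_smul]; rfl

theorem cov_expand (D : A.Connection) (hy : y ∈ Fr.U) (u v v' : Cₛ^∞⟮𝓡 n; F, E⟯) :
    A.pair (D.cov u v) v' y
      = ∑ i, Fr.w i * (A.pair u (Fr.e i) y * A.pair (D.cov (Fr.e i) v) v' y) := by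
  refine Fr.expand (α := fun u => A.pair (D.cov u v) v') ⟨fun u v z => ?_, fun g u z => ?_⟩ hy u
  · rw [map_add, LinearMap.add_apply, pair_add_left]
  · rw [D.smul_left, pair_smul_left]

/-- Contractions do not depend on the basis, by `sum_dualBasis`, and here the Gram matrix is
diagonal with inverse entries w_i. -/
theorem contract_eq {T : Cₛ^∞⟮𝓡 n; F, E⟯ → Cₛ^∞⟮𝓡 n; F, E⟯ → M → ℝ}
    (h1 : ∀ v, IsTensorial fun u => T u v) (h2 : ∀ u, IsTensorial (T u)) (hy : y ∈ Fr.U) :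
    A.contract T y = ∑ i, Fr.w i * T (Fr.e i) (Fr.e i) y := by
  obtain ⟨b, hb⟩ := Fr.basis y hy
  let t : E y →ₗ[ℝ] E y →ₗ[ℝ] ℝ := LinearMap.mk₂ ℝ (fun a b => T (extend y a) (extend y b) y)
    (fun a a' b => by rw [map_add]; exact (h1 _).add _ _ _)
    (fun c a b => by rw [_root_.map_smul]; exact (h1 _).const_smul _ _ _)
    (fun a b b' => by rw [map_add]; exact (h2 _).add _ _ _)
    (fun c a b => by rw [_root_.map_smul]; exact (h2 _).const_smul _ _ _)
  have ht : ∀ u v : Cₛ^∞⟮𝓡 n; F, E⟯, t (u y) (v y) = T u v y := fun u v =>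
    ((h1 _).pointwise (extend_apply y (u y))).trans ((h2 u).pointwise (extend_apply y (v y)))
  have h := (sum_dualBasis (A.pairing y) (A.pairing_nondegenerate y) (fiberBasis F E y) b t).2
  have hg : (Matrix.of fun i j => A.pairing y (b i) (b j)) = Matrix.diagonal fun i => (Fr.w i)⁻¹ := by
    ext i j
    rw [Matrix.of_apply, hb, hb]
    by_cases hij : i = j
    · subst hij
      rw [Matrix.diagonal_apply_eq]
      exact Fr.pair_self i y hy
    · rw [Matrix.diagonal_apply_ne _ hij]
      exact Fr.pair_ne i j hij y hy
  have hi : (Matrix.diagonal fun i => (Fr.w i)⁻¹)⁻¹ = Matrix.diagonal Fr.w := by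
    refine Matrix.inv_eq_left_inv ?_
    rw [Matrix.diagonal_mul_diagonal, ← Matrix.diagonal_one]
    exact congrArg _ (funext fun i => mul_inv_cancel₀ (Fr.w_ne i))
  rw [hg, hi] at h
  refine Eq.trans h ?_
  refine Finset.sum_congr rfl fun k _ => ?_
  rw [Finset.sum_eq_single k]
  · rw [Matrix.diagonal_apply_eq, hb, ht, smul_eq_mul]
  · intro j _ hjk
    rw [Matrix.diagonal_apply_ne _ (Ne.symm hjk), zero_smul]
  · simp

/-- The structure functions `⟨[e_i, e_j], e_k⟩`. -/
def c (i j k : Fin (Module.finrank ℝ F)) : C^∞⟮𝓡 n, M; ℝ⟯ :=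
  A.pair (A.bracket (Fr.e i) (Fr.e j)) (Fr.e k)

theorem pair_const (i j : Fin (Module.finrank ℝ F)) :
    ∃ c : ℝ, ∀ z ∈ Fr.U, A.pair (Fr.e i) (Fr.e j) z = c := by
  by_cases hij : i = j
  · subst hij
    exact ⟨_, Fr.pair_self i⟩
  · exact ⟨_, Fr.pair_ne i j hij⟩

theorem rho_pair_eq_zero (hy : y ∈ Fr.U) (u : Cₛ^∞⟮𝓡 n; F, E⟯)
    (i j : Fin (Module.finrank ℝ F)) : A.rho u (A.pair (Fr.e i) (Fr.e j)) y = 0 := by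
  obtain ⟨c, hc⟩ := Fr.pair_const i j
  exact rho_eq_zero_of_const u Fr.isOpen hc hy

/-- The pairings of the frame are constant on U, so 𝒟⟨e_i, e_j⟩ = 0 gives antisymmetry in the first
two indices, and invariance of the pairing gives it in the last two. -/
theorem c_alt (hy : y ∈ Fr.U) : FrameAlgebra.Alternating fun i j k => Fr.c i j k y where
  swap₁₂ i j k := by
    have := A.pair_bracket_swap (Fr.e i) (Fr.e j) (Fr.e k) y
    rw [Fr.rho_pair_eq_zero hy, add_zero] at this
    exact this
  swap₂₃ i j k := by
    have := A.rho_pair (Fr.e i) (Fr.e j) (Fr.e k) y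
    rw [Fr.rho_pair_eq_zero hy, A.pair_symm (Fr.e j)] at this
    simp only [c]
    linarith

theorem rho_alt {c : Fin (Module.finrank ℝ F) → Fin (Module.finrank ℝ F) →
    Fin (Module.finrank ℝ F) → C^∞⟮𝓡 n, M; ℝ⟯}
    (hc : ∀ y ∈ Fr.U, FrameAlgebra.Alternating fun i j k => c i j k y) (u : Cₛ^∞⟮𝓡 n; F, E⟯)
    (hy : y ∈ Fr.U) : FrameAlgebra.Alternating fun i j k => A.rho u (c i j k) y where
  swap₁₂ i j k := by
    rw [← fun_neg_apply, ← rho_neg]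
    exact rho_congr u Fr.isOpen (fun z hz => (hc z hz).swap₁₂ i j k) hy
  swap₂₃ i j k := by
    rw [← fun_neg_apply, ← rho_neg]
    exact rho_congr u Fr.isOpen (fun z hz => (hc z hz).swap₂₃ i j k) hy

theorem rho_comm (hy : y ∈ Fr.U) (i j : Fin (Module.finrank ℝ F)) (f : C^∞⟮𝓡 n, M; ℝ⟯) :
    A.rho (Fr.e i) (A.rho (Fr.e j) f) y - A.rho (Fr.e j) (A.rho (Fr.e i) f) y
      = ∑ m, Fr.w m * (Fr.c i j m y * A.rho (Fr.e m) f y) := by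
  rw [← A.rho_bracket, Fr.rho_expand hy]
  rfl

theorem pair_bracket_bracket (hy : y ∈ Fr.U) (i j k l : Fin (Module.finrank ℝ F)) :
    A.pair (A.bracket (Fr.e i) (A.bracket (Fr.e j) (Fr.e k))) (Fr.e l) y
      = A.rho (Fr.e i) (Fr.c j k l) y - ∑ m, Fr.w m * (Fr.c j k m y * Fr.c i l m y) := by
  have h := A.rho_pair (Fr.e i) (A.bracket (Fr.e j) (Fr.e k)) (Fr.e l) y
  rw [Fr.pair_expand hy (A.bracket (Fr.e j) (Fr.e k))] at h
  simp only [c] at h ⊢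
  linarith

/-- The term [[e_k, e_a], e_b] is rewritten through [e_b, [e_k, e_a]]. The bracket is not
antisymmetric on such sections, and the correction 𝒟 c_kab supplies the fourth derivative term. -/
theorem jacobi_frame (hy : y ∈ Fr.U) (k a b e : Fin (Module.finrank ℝ F)) :
    A.rho (Fr.e k) (Fr.c a b e) y - A.rho (Fr.e a) (Fr.c k b e) y
        + A.rho (Fr.e b) (Fr.c k a e) y - A.rho (Fr.e e) (Fr.c k a b) y
      = ∑ n, Fr.w n * (Fr.c a b n y * Fr.c k e n y + Fr.c k a n y * Fr.c b e n y
        - Fr.c k b n y * Fr.c a e n y) := by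
  have h := congrArg (fun u => A.pair u (Fr.e e) y) (A.jacobi (Fr.e k) (Fr.e a) (Fr.e b))
  simp only [pair_add_left] at h
  rw [A.pair_bracket_swap (A.bracket (Fr.e k) (Fr.e a)), Fr.pair_bracket_bracket hy,
    Fr.pair_bracket_bracket hy, Fr.pair_bracket_bracket hy] at h
  change _ = -_ + A.rho (Fr.e e) (Fr.c k a b) y + _ at h
  simp only [mul_add, mul_sub, Finset.sum_add_distrib, Finset.sum_sub_distrib]
  linarith

end AdaptedFrame
end CourantAlgebroid
end FrameCalculus

/-! ### Connection coefficients and divergences in an adapted frame. -/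

section FrameConnection

variable {n : ℕ} {M : Type*} [TopologicalSpace M] [T2Space M]
  [ChartedSpace (EuclideanSpace ℝ (Fin n)) M] [IsManifold (𝓡 n) ∞ M]
  {F : Type*} [NormedAddCommGroup F] [NormedSpace ℝ F] [FiniteDimensional ℝ F]
  {E : M → Type*} [TopologicalSpace (TotalSpace F E)]
  [∀ x, TopologicalSpace (E x)] [FiberBundle F E]
  [∀ x, AddCommGroup (E x)] [∀ x, Module ℝ (E x)] [VectorBundle ℝ F E]
  [ContMDiffVectorBundle ∞ F E (𝓡 n)]

namespace CourantAlgebroid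
namespace AdaptedFrame

variable {A : CourantAlgebroid n F E} {G : A.Pseudometric} {x : M} (Fr : AdaptedFrame G x)
  (D : A.Connection) {y : M}

/-- The connection coefficients `⟨D_i e_j, e_k⟩`. -/
def gam (i j k : Fin (Module.finrank ℝ F)) : C^∞⟮𝓡 n, M; ℝ⟯ :=
  A.pair (D.cov (Fr.e i) (Fr.e j)) (Fr.e k)

/-- The divergences of the sections of the frame. -/
def dv (k : Fin (Module.finrank ℝ F)) : C^∞⟮𝓡 n, M; ℝ⟯ := ∑ i, Fr.w i • Fr.gam D i k i

theorem dv_apply (k : Fin (Module.finrank ℝ F)) :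
    Fr.dv D k y = ∑ i, Fr.w i * Fr.gam D i k i y :=
  fun_sum_apply _ _ _

theorem rho_dv_apply (u : Cₛ^∞⟮𝓡 n; F, E⟯) (k : Fin (Module.finrank ℝ F)) :
    A.rho u (Fr.dv D k) y = ∑ i, Fr.w i * A.rho u (Fr.gam D i k i) y := by
  rw [dv, rho_sum, fun_sum_apply]
  exact Finset.sum_congr rfl fun i _ => by rw [rho_smul, fun_smul_apply]

theorem gam_antisymm (hy : y ∈ Fr.U) (i j k : Fin (Module.finrank ℝ F)) :
    Fr.gam D i j k y = -Fr.gam D i k j y := by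
  have := D.rho_pair (Fr.e i) (Fr.e j) (Fr.e k) y
  rw [Fr.rho_pair_eq_zero hy, A.pair_symm (Fr.e j)] at this
  simp only [gam]
  linarith

theorem div_eq_contract (hy : y ∈ Fr.U) (u : Cₛ^∞⟮𝓡 n; F, E⟯) :
    D.div u y = ∑ i, Fr.w i * A.pair (Fr.e i) (D.cov (Fr.e i) u) y := by
  refine Fr.contract_eq (fun v => ⟨fun a b z => A.pair_add_left _ _ _ _,
    fun f a z => A.pair_smul_left _ _ _ _⟩) (fun v => ⟨fun a b z => ?_, fun f a z => ?_⟩) hy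
  · rw [map_add, LinearMap.add_apply, pair_add]
  · rw [D.smul_left, pair_smul]

theorem div_eq (hy : y ∈ Fr.U) (u : Cₛ^∞⟮𝓡 n; F, E⟯) :
    D.div u y = ∑ m, Fr.w m * (A.rho (Fr.e m) (A.pair u (Fr.e m)) y
      + A.pair u (Fr.e m) y * Fr.dv D m y) := by
  have h : ∀ i, A.pair (Fr.e i) (D.cov (Fr.e i) u) y = A.rho (Fr.e i) (A.pair u (Fr.e i)) y
      - ∑ m, Fr.w m * (A.pair u (Fr.e m) y * Fr.gam D i i m y) := by
    intro i
    rw [D.rho_pair, Fr.pair_expand hy u, A.pair_symm (Fr.e i)]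
    simp only [gam]
    ring
  simp only [Fr.div_eq_contract D hy, h, mul_sub, mul_add, Finset.sum_sub_distrib,
    Finset.sum_add_distrib, Finset.mul_sum, dv_apply]
  rw [Finset.sum_comm, sub_eq_add_neg, ← Finset.sum_neg_distrib]
  refine congrArg _ (Finset.sum_congr rfl fun m _ => ?_)
  rw [← Finset.sum_neg_distrib]
  refine Finset.sum_congr rfl fun i _ => ?_
  rw [Fr.gam_antisymm D hy i i m]
  ring

theorem div_e (hy : y ∈ Fr.U) (k : Fin (Module.finrank ℝ F)) :
    D.div (Fr.e k) y = Fr.dv D k y := by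
  rw [Fr.div_eq_contract D hy, dv_apply]
  exact Finset.sum_congr rfl fun i _ => by rw [A.pair_symm]; rfl

/-- The structure functions and the divergences of the frame at `y`, with their derivatives. -/
def jet (hy : y ∈ Fr.U) : FrameAlgebra.Jet Fr.w where
  c i j k := Fr.c i j k y
  dc l i j k := A.rho (Fr.e l) (Fr.c i j k) y
  ddc a b i j k := A.rho (Fr.e a) (A.rho (Fr.e b) (Fr.c i j k)) y
  d k := Fr.dv D k y
  dd l k := A.rho (Fr.e l) (Fr.dv D k) y
  ddd a b k := A.rho (Fr.e a) (A.rho (Fr.e b) (Fr.dv D k)) y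
  alt := Fr.c_alt hy
  alt_dc _ := Fr.rho_alt (fun _ hz => Fr.c_alt hz) _ hy
  alt_ddc _ _ := Fr.rho_alt (fun _ hz => Fr.rho_alt (fun _ hz => Fr.c_alt hz) _ hz) _ hy
  comm_c i j _ _ _ := Fr.rho_comm hy i j _
  comm_d i j _ := Fr.rho_comm hy i j _
  jacobi := Fr.jacobi_frame hy

section LeviCivita

variable {D}
theorem gam_compat (hD : D.IsLeviCivita G) (i : Fin (Module.finrank ℝ F))
    {j k : Fin (Module.finrank ℝ F)}
    (hjk : Fr.s j ≠ Fr.s k) : Fr.gam D i j k y = 0 := by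
  have h := hD.compatible (Fr.e i) (Fr.e j)
  rw [Connection.covEnd, Fr.act, _root_.map_smul, sub_eq_zero] at h
  have h1 := congrArg (fun u => A.pair (Fr.e k) u y) h
  simp only [pair_smul_const, ← G.pair_act_left, Fr.act] at h1
  rw [A.pair_symm (Fr.s k • _), pair_smul_const, A.pair_symm (Fr.e k)] at h1
  have h2 : (Fr.s j - Fr.s k) * Fr.gam D i j k y = 0 := by
    rw [sub_mul, sub_eq_zero]; exact h1
  exact (mul_eq_zero.1 h2).resolve_left (sub_ne_zero.2 hjk)

/-- The term ⟨D u, v⟩ of the generalized torsion is what completes the cyclic sum. -/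
theorem c_eq_gam (hD : D.IsLeviCivita G) (hy : y ∈ Fr.U) (i j k : Fin (Module.finrank ℝ F)) :
    Fr.c i j k y = Fr.gam D i j k y + Fr.gam D j k i y + Fr.gam D k i j y := by
  have h := hD.torsionFree.pair_cov (Fr.e i) (Fr.e j) (Fr.e k) y
  rw [pair_add_left, pair_sub_left] at h
  have h1 := Fr.gam_antisymm D hy j i k
  simp only [gam, c] at h1 ⊢
  linarith

/-- The connection coefficients at `y` with their derivatives. -/
def leviCivita (hD : D.IsLeviCivita G) (hy : y ∈ Fr.U) : (Fr.jet D hy).LeviCivita Fr.s where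
  g i j k := Fr.gam D i j k y
  dg l i j k := A.rho (Fr.e l) (Fr.gam D i j k) y
  antisymm := Fr.gam_antisymm D hy
  dantisymm l i j k := by
    rw [← fun_neg_apply, ← rho_neg]
    exact rho_congr _ Fr.isOpen (fun z hz => Fr.gam_antisymm D hz i j k) hy
  compat i _ _ := Fr.gam_compat hD i
  dcompat _ i _ _ hjk := rho_eq_zero_of_const _ Fr.isOpen (fun _ _ => Fr.gam_compat hD i hjk) hy
  torsion := Fr.c_eq_gam hD hy
  dtorsion l i j k := by
    simp only [← fun_add_apply, ← rho_add]
    exact rho_congr _ Fr.isOpen (fun z hz => Fr.c_eq_gam hD hz i j k) hy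
  d_eq _ := Fr.dv_apply D _
  dd_eq _ _ := Fr.rho_dv_apply D _ _

theorem pair_comm (hD : D.IsLeviCivita G) (hy : y ∈ Fr.U) (i j k l : Fin (Module.finrank ℝ F)) :
    A.pair (Fr.e l) (D.comm (Fr.e i) (Fr.e j) (Fr.e k)) y
      = (Fr.leviCivita hD hy).curv i j k l := by
  have h : ∀ i j, A.pair (D.cov (Fr.e i) (D.cov (Fr.e j) (Fr.e k))) (Fr.e l) y
      = A.rho (Fr.e i) (Fr.gam D j k l) y
        - ∑ m, Fr.w m * (Fr.gam D j k m y * Fr.gam D i l m y) := by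
    intro i j
    have h := D.rho_pair (Fr.e i) (D.cov (Fr.e j) (Fr.e k)) (Fr.e l) y
    rw [Fr.pair_expand hy (D.cov (Fr.e j) (Fr.e k))] at h
    simp only [gam] at h ⊢
    linarith
  rw [A.pair_symm, Connection.comm]
  simp only [pair_sub_left, h, Fr.cov_expand D hy (D.cov _ _)]
  simp only [FrameAlgebra.Jet.LeviCivita.curv, leviCivita, sub_mul, mul_sub,
    Finset.sum_sub_distrib, gam]
  ring

theorem fullRicciForm_eq (hD : D.IsLeviCivita G) (hy : y ∈ Fr.U) (q r : Fin (Module.finrank ℝ F)) :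
    D.fullRicciForm (Fr.e q) (Fr.e r) y = (Fr.leviCivita hD hy).ricci q r := by
  rw [Connection.fullRicciForm, Fr.contract_eq
    (fun _ => D.isTensorial_riemann_first _ _ _)
    (fun _ => D.isTensorial_riemann_third hD.torsionFree _ _ _) hy]
  refine Finset.sum_congr rfl fun i _ => ?_
  rw [Connection.riemann, Fr.pair_comm hD hy, Fr.pair_comm hD hy, Fr.contract_eq
    (fun v => ⟨fun s s' p => ?_, fun f s p => ?_⟩) (fun v => ⟨fun s s' p => ?_, fun f s p => ?_⟩) hy]
  · rfl
  · simp only [map_add, LinearMap.add_apply, pair_add_left, mul_add]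
  · simp only [D.smul_left, pair_smul_left]; ring
  · simp only [map_add, LinearMap.add_apply, pair_add_left, add_mul]
  · simp only [D.smul_left, pair_smul_left]; ring

end LeviCivita

section Divergence

variable {D} {σ : PositiveHalfDensity n M}
-- All the properties of the half-density that the argument needs are contained in this relation.
theorem div_bracket (hdiv : ∀ u, D.div u = A.divOf σ u)
    (u v : Cₛ^∞⟮𝓡 n; F, E⟯) :
    D.div (A.bracket u v) y = dirDeriv (D.div v) y (A.anchor y (u y))
      - dirDeriv (D.div u) y (A.anchor y (v y)) := by
  simp only [hdiv, A.divOf_bracket σ]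

theorem rho_dv_sub (hdiv : ∀ u, D.div u = A.divOf σ u)
    (hy : y ∈ Fr.U) (i j : Fin (Module.finrank ℝ F)) :
    A.rho (Fr.e i) (Fr.dv D j) y - A.rho (Fr.e j) (Fr.dv D i) y
      = ∑ m, Fr.w m * (A.rho (Fr.e m) (Fr.c i j m) y + Fr.c i j m y * Fr.dv D m y) := by
  have h := div_bracket (y := y) hdiv (Fr.e i) (Fr.e j)
  have h1 : ∀ k (u : Cₛ^∞⟮𝓡 n; F, E⟯),
      dirDeriv (D.div (Fr.e k)) y (A.anchor y (u y)) = A.rho u (Fr.dv D k) y := by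
    intro k u
    have e : D.div (Fr.e k) =ᶠ[𝓝 y] Fr.dv D k :=
      Filter.eventuallyEq_of_mem (Fr.isOpen.mem_nhds hy) fun z hz => Fr.div_e D hz k
    exact congrArg (fun T => T (A.anchor y (u y))) (e.mfderiv_eq (I := 𝓡 n) (I' := 𝓘(ℝ, ℝ)))
  rw [h1, h1, Fr.div_eq D hy] at h
  exact h.symm

/-- `rho_dv_sub` holds on the whole open set U, so it may be differentiated along e_l. -/
theorem rho_rho_dv_sub (hdiv : ∀ u, D.div u = A.divOf σ u)
    (hy : y ∈ Fr.U) (l i j : Fin (Module.finrank ℝ F)) :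
    A.rho (Fr.e l) (A.rho (Fr.e i) (Fr.dv D j)) y - A.rho (Fr.e l) (A.rho (Fr.e j) (Fr.dv D i)) y
      = ∑ m, Fr.w m * (A.rho (Fr.e l) (A.rho (Fr.e m) (Fr.c i j m)) y
        + (A.rho (Fr.e l) (Fr.c i j m) y * Fr.dv D m y
          + Fr.c i j m y * A.rho (Fr.e l) (Fr.dv D m) y)) := by
  rw [← fun_sub_apply, ← rho_sub, rho_congr (g := ∑ m, Fr.w m • (A.rho (Fr.e m) (Fr.c i j m)
    + Fr.c i j m * Fr.dv D m)) _ Fr.isOpen (fun z hz => ?_) hy]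
  · rw [rho_sum, fun_sum_apply]
    refine Finset.sum_congr rfl fun m _ => ?_
    simp only [rho_smul, rho_add, rho_mul, fun_smul_apply, fun_add_apply, fun_mul_apply]
    ring
  · rw [fun_sum_apply]
    exact Fr.rho_dv_sub hdiv hz i j

/-- The operator `∑ w_m (∂_m ∂_m + d_m ∂_m)` vanishes, since the divergence vanishes on
`𝒟 f`. -/
theorem laplacian_eq_zero (hdiv : ∀ u, D.div u = A.divOf σ u)
    (hy : y ∈ Fr.U) (k : Fin (Module.finrank ℝ F)) (f : C^∞⟮𝓡 n, M; ℝ⟯) :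
    ∑ m, Fr.w m * (A.rho (Fr.e m) (A.rho (Fr.e m) f) y + Fr.dv D m y * A.rho (Fr.e m) f y) = 0 := by
  -- The pair is chosen so that ⟨u, v⟩ = f on U, whence [u, v] + [v, u] = 𝒟f there. The divergences
  -- of the two brackets are opposite by `div_bracket`; e_k only serves as a section of nonzero
  -- norm.
  let u : Cₛ^∞⟮𝓡 n; F, E⟯ := f • Fr.e k
  let v : Cₛ^∞⟮𝓡 n; F, E⟯ := Fr.w k • Fr.e k
  have huv : ∀ z ∈ Fr.U, A.pair u v z = f z := by
    intro z hz
    rw [pair_smul_const, pair_smul_left, Fr.pair_self k z hz]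
    field_simp [Fr.w_ne k]
  have hp : ∀ m, ∀ z ∈ Fr.U, A.pair (A.bracket u v) (Fr.e m) z + A.pair (A.bracket v u) (Fr.e m) z
      = A.rho (Fr.e m) f z := by
    intro m z hz
    rw [A.pair_bracket_swap u v, rho_congr (Fr.e m) Fr.isOpen huv hz]
    ring
  have h1 : D.div (A.bracket u v) y + D.div (A.bracket v u) y = 0 := by
    rw [div_bracket hdiv, div_bracket hdiv]; ring
  rw [Fr.div_eq D hy, Fr.div_eq D hy, ← Finset.sum_add_distrib] at h1
  rw [← h1]
  refine Finset.sum_congr rfl fun m _ => ?_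
  have h2 : A.rho (Fr.e m) (A.rho (Fr.e m) f) y
      = A.rho (Fr.e m) (A.pair (A.bracket u v) (Fr.e m)) y
        + A.rho (Fr.e m) (A.pair (A.bracket v u) (Fr.e m)) y := by
    rw [← fun_add_apply, ← rho_add]
    exact (rho_congr _ Fr.isOpen (fun z hz => hp m z hz) hy).symm
  rw [h2, ← hp m y hy]
  ring

end Divergence

end AdaptedFrame
end CourantAlgebroid
end FrameConnection

/-! ### The covariant divergence of the Ricci tensor in components. -/

namespace FrameAlgebra.Jet.LeviCivita

variable {ι : Type*} [Fintype ι] {η s : ι → ℝ} {J : Jet η} (L : J.LeviCivita s)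

/-- The components of half the Ricci tensor `Ric - G Ric G`. -/
def offDiagRicci (J : Jet η) (s : ι → ℝ) (a b : ι) : ℝ :=
  if s a = s b then 0 else J.mixedRicci (weight η s (s b)) (weight η s (s a)) a b

/-- The derivative of `offDiagRicci` along the frame. -/
def derivOffDiagRicci (J : Jet η) (s : ι → ℝ) (l a b : ι) : ℝ :=
  if s a = s b then 0 else J.derivMixedRicci (weight η s (s b)) (weight η s (s a)) l a b

theorem eq_neg_of_ne (hs : ∀ i, s i * s i = 1) {i j : ι} (h : s i ≠ s j) : s i = -s j :=
  (mul_self_eq_mul_self_iff.1 ((hs i).trans (hs j).symm)).resolve_left h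

theorem ne_neg (hs : ∀ i, s i * s i = 1) (i : ι) : s i ≠ -s i := by
  intro h
  have h0 : s i = 0 := by linarith
  have := hs i
  rw [h0] at this
  simp at this

theorem eq_weight_add (hs : ∀ i, s i * s i = 1) (k i : ι) :
    η i = weight η s (s k) i + weight η s (-s k) i := by
  by_cases h : s i = s k
  · rw [weight, weight, if_pos h, if_neg, add_zero]
    rw [h]; exact ne_neg hs k
  · rw [weight, weight, if_neg h, if_pos (eq_neg_of_ne hs h), zero_add]

/-- The divergence of the Ricci tensor, contracted with the involution. -/
theorem div_offDiagRicci (hs : ∀ i, s i * s i = 1) (k : ι) :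
    2 * ∑ t, η t * (s t * (derivOffDiagRicci J s t t k
        - ∑ r, η r * (L.g t t r * offDiagRicci J s r k)
        - ∑ r, η r * (L.g t k r * offDiagRicci J s t r)))
      = -s k * J.derivScalar (weight η s (s k)) (weight η s (-s k)) k := by
  rw [← J.div_mixedRicci (eq_weight_add hs k)]
  have h1 : ∑ t, η t * (s t * derivOffDiagRicci J s t t k)
      = -s k * ∑ a, weight η s (-s k) a
        * J.derivMixedRicci (weight η s (s k)) (weight η s (-s k)) a a k := by
    rw [Finset.mul_sum]
    refine Finset.sum_congr rfl fun t _ => ?_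
    rw [derivOffDiagRicci]
    by_cases h : s t = s k
    · rw [if_pos h, weight, if_neg (by rw [h]; exact ne_neg hs k)]; ring
    · rw [if_neg h, eq_neg_of_ne hs h, weight, if_pos (eq_neg_of_ne hs h)]; ring
  have h2 : ∑ t, η t * (s t * ∑ r, η r * (L.g t t r * offDiagRicci J s r k))
      = s k * ∑ a, weight η s (-s k) a * J.d a
        * J.mixedRicci (weight η s (s k)) (weight η s (-s k)) a k := by
    simp only [Finset.mul_sum]
    rw [Finset.sum_comm]
    refine Finset.sum_congr rfl fun r _ => ?_
    rw [offDiagRicci]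
    by_cases h : s r = s k
    · rw [if_pos h, weight, if_neg (by rw [h]; exact ne_neg hs k)]; simp
    · rw [if_neg h, eq_neg_of_ne hs h]
      have h3 := L.sum_g_self r
      -- Only t in the eigenbundle of e_r contributes, so s_t is the constant -s_k. The remaining
      -- trace of g is -d_r.
      calc _ = ∑ t, -s k * η r * J.mixedRicci (weight η s (s k)) (weight η s (-s k)) r k
              * (η t * L.g t t r) := by
            refine Finset.sum_congr rfl fun t _ => ?_
            by_cases ht : s t = s r
            · rw [ht, eq_neg_of_ne hs h]; ring
            · rw [L.compat t t r ht]; ring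
        _ = _ := by
            rw [← Finset.mul_sum, h3, weight, if_pos (eq_neg_of_ne hs h)]; ring
  have h3 : ∑ t, η t * (s t * ∑ r, η r * (L.g t k r * offDiagRicci J s t r))
      = -s k * ∑ a, ∑ b, weight η s (-s k) a * weight η s (s k) b * J.c a k b
        * J.mixedRicci (weight η s (s k)) (weight η s (-s k)) a b := by
    simp only [Finset.mul_sum]
    refine Finset.sum_congr rfl fun t _ => Finset.sum_congr rfl fun r _ => ?_
    rw [offDiagRicci]
    -- D_t e_k stays in the eigenbundle of e_k, and the Ricci factor then requires e_t to lie in the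
    -- other one; the coefficient is mixed and equals c.
    by_cases hr : s r = s k
    · rw [hr]
      by_cases h : s t = s k
      · rw [if_pos h, weight, if_neg (by rw [h]; exact ne_neg hs k)]; ring
      · rw [if_neg h, L.g_eq_c h hr.symm, eq_neg_of_ne hs h, weight,
          if_pos (eq_neg_of_ne hs h), weight, if_pos hr]
        ring
    · rw [L.compat t k r (Ne.symm hr), weight, weight, if_neg hr]; ring
  simp only [mul_sub, Finset.sum_sub_distrib]
  rw [h1, h2, h3]
  ring

end FrameAlgebra.Jet.LeviCivita

open FrameAlgebra.Jet (weight)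
open FrameAlgebra.Jet.LeviCivita (offDiagRicci derivOffDiagRicci)

/-! ### From components back to the Ricci tensor and the scalar curvature. -/

section DivRicci

variable {n : ℕ} {M : Type*} [TopologicalSpace M] [T2Space M]
  [ChartedSpace (EuclideanSpace ℝ (Fin n)) M] [IsManifold (𝓡 n) ∞ M]
  {F : Type*} [NormedAddCommGroup F] [NormedSpace ℝ F] [FiniteDimensional ℝ F]
  {E : M → Type*} [TopologicalSpace (TotalSpace F E)]
  [∀ x, TopologicalSpace (E x)] [FiberBundle F E]
  [∀ x, AddCommGroup (E x)] [∀ x, Module ℝ (E x)] [VectorBundle ℝ F E]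
  [ContMDiffVectorBundle ∞ F E (𝓡 n)]

namespace CourantAlgebroid

variable {A : CourantAlgebroid n F E} {G : A.Pseudometric} {D : A.Connection}

theorem Connection.fullRicci_add (hD : D.IsTorsionFree) (u v : Cₛ^∞⟮𝓡 n; F, E⟯) :
    D.fullRicci hD (u + v) = D.fullRicci hD u + D.fullRicci hD v := by
  ext y
  change A.sharp (fun w => D.fullRicciForm w (u + v)) y
    = A.sharp (fun w => D.fullRicciForm w u) y + A.sharp (fun w => D.fullRicciForm w v) y
  simp only [sharp, (D.isTensorial_fullRicciForm_right _).add, add_smul, Finset.sum_add_distrib]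

theorem Connection.fullRicci_smul (hD : D.IsTorsionFree) (f : C^∞⟮𝓡 n, M; ℝ⟯)
    (u : Cₛ^∞⟮𝓡 n; F, E⟯) : D.fullRicci hD (f • u) = f • D.fullRicci hD u := by
  ext y
  change A.sharp (fun w => D.fullRicciForm w (f • u)) y
    = f y • A.sharp (fun w => D.fullRicciForm w u) y
  simp only [sharp, (D.isTensorial_fullRicciForm_right _).smul, mul_smul, Finset.smul_sum]

theorem smul_sub_section (f : C^∞⟮𝓡 n, M; ℝ⟯) (u v : Cₛ^∞⟮𝓡 n; F, E⟯) :
    f • (u - v) = f • u - f • v := by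
  ext y
  exact smul_sub _ _ _

theorem Connection.ricci_add (hD : D.IsTorsionFree) (u v : Cₛ^∞⟮𝓡 n; F, E⟯) :
    D.ricci hD G (u + v) = D.ricci hD G u + D.ricci hD G v := by
  simp only [ricci, G.act_add, fullRicci_add]
  abel

theorem Connection.ricci_smul (hD : D.IsTorsionFree) (f : C^∞⟮𝓡 n, M; ℝ⟯)
    (u : Cₛ^∞⟮𝓡 n; F, E⟯) : D.ricci hD G (f • u) = f • D.ricci hD G u := by
  simp only [ricci, G.act_smul, fullRicci_smul, smul_sub_section]

/-- The terms with ρ(t) f cancel in D_t(Rc(f v)) - Rc(D_t(f v)). This permits replacing v by the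
sections of a frame. -/
theorem Connection.isTensorial_divRicci (hD : D.IsTorsionFree) :
    IsTensorial fun v => A.contract fun s t => A.pair s (G.act (D.covEnd (D.ricci hD G) t v)) where
  add u v y := by
    have h : ∀ t, D.covEnd (D.ricci hD G) t (u + v)
        = D.covEnd (D.ricci hD G) t u + D.covEnd (D.ricci hD G) t v := by
      intro t
      simp only [covEnd, ricci_add, map_add]
      abel
    simp only [contract, h, G.act_add, pair_add, Finset.sum_add_distrib]
  smul f v y := by
    have h : ∀ t, D.covEnd (D.ricci hD G) t (f • v) = f • D.covEnd (D.ricci hD G) t v := by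
      intro t
      simp only [covEnd, ricci_add, ricci_smul, D.map_smul, smul_sub_section]
      abel
    simp only [contract, h, G.act_smul, pair_smul, Finset.mul_sum]

namespace AdaptedFrame

variable {x : M} (Fr : AdaptedFrame G x) {y : M} (hD : D.IsLeviCivita G)

theorem pair_act (i : Fin (Module.finrank ℝ F)) (u : Cₛ^∞⟮𝓡 n; F, E⟯) :
    A.pair (Fr.e i) (G.act u) y = Fr.s i * A.pair (Fr.e i) u y := by
  rw [← G.pair_act_left, Fr.act, A.pair_symm, pair_smul_const, A.pair_symm]

theorem divRicci_eq (hy : y ∈ Fr.U) (k : Fin (Module.finrank ℝ F)) :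
    A.contract (fun s t => A.pair s (G.act (D.covEnd (D.ricci hD.torsionFree G) t (Fr.e k)))) y
      = ∑ t, Fr.w t * (Fr.s t * (A.rho (Fr.e t) (A.pair (Fr.e t)
            (D.ricci hD.torsionFree G (Fr.e k))) y
          - ∑ r, Fr.w r * (Fr.gam D t t r y
              * A.pair (Fr.e r) (D.ricci hD.torsionFree G (Fr.e k)) y)
          - ∑ r, Fr.w r * (Fr.gam D t k r y
              * A.pair (Fr.e t) (D.ricci hD.torsionFree G (Fr.e r)) y))) := by
  rw [Fr.contract_eq (fun v => ⟨fun s s' p => A.pair_add_left _ _ _ _,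
    fun f s p => A.pair_smul_left _ _ _ _⟩) (fun v => ⟨fun s s' p => ?_, fun f s p => ?_⟩) hy]
  · refine Finset.sum_congr rfl fun t _ => ?_
    rw [Fr.pair_act, Connection.covEnd, pair_sub]
    have h1 := D.rho_pair (Fr.e t) (Fr.e t) (D.ricci hD.torsionFree G (Fr.e k)) y
    rw [Fr.pair_expand hy (D.cov (Fr.e t) (Fr.e t))] at h1
    have h2 := Fr.expand (α := fun u => A.pair (Fr.e t) (D.ricci hD.torsionFree G u))
      ⟨fun u v z => by rw [Connection.ricci_add, pair_add],
        fun f u z => by rw [Connection.ricci_smul, pair_smul]⟩ hy (D.cov (Fr.e t) (Fr.e k))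
    simp only [A.pair_symm (D.ricci hD.torsionFree G (Fr.e k))] at h1
    rw [h2, h1]
    simp only [gam]
    ring
  · have h : D.covEnd (D.ricci hD.torsionFree G) (s + s') (Fr.e k)
        = D.covEnd (D.ricci hD.torsionFree G) s (Fr.e k)
          + D.covEnd (D.ricci hD.torsionFree G) s' (Fr.e k) := by
      simp only [Connection.covEnd, map_add, LinearMap.add_apply, Connection.ricci_add]
      abel
    rw [h, G.act_add, pair_add]
  · have h : D.covEnd (D.ricci hD.torsionFree G) (f • s) (Fr.e k)
        = f • D.covEnd (D.ricci hD.torsionFree G) s (Fr.e k) := by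
      simp only [Connection.covEnd, D.smul_left, Connection.ricci_smul, smul_sub_section]
    rw [h, G.act_smul, pair_smul]

theorem pair_fullRicci_eq (hy : y ∈ Fr.U) (q r : Fin (Module.finrank ℝ F)) :
    A.pair (Fr.e q) (D.fullRicci hD.torsionFree (Fr.e r)) y = (Fr.leviCivita hD hy).ricci q r := by
  rw [D.pair_fullRicci, Fr.fullRicciForm_eq hD hy]

theorem scalar_eq (hy : y ∈ Fr.U) :
    D.scalar hD.torsionFree G y
      = ∑ i, Fr.w i * (Fr.s i * (Fr.leviCivita hD hy).ricci i i) := by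
  change A.contract (fun s t => A.pair s (G.act (D.fullRicci hD.torsionFree t))) y = _
  rw [Fr.contract_eq (fun v => ⟨fun s s' p => A.pair_add_left _ _ _ _,
    fun f s p => A.pair_smul_left _ _ _ _⟩) (fun v => ⟨fun s s' p => ?_, fun f s p => ?_⟩) hy]
  · simp only [Fr.pair_act, Fr.pair_fullRicci_eq hD hy]
  · rw [Connection.fullRicci_add, G.act_add, pair_add]
  · rw [Connection.fullRicci_smul, G.act_smul, pair_smul]

/-- The partial scalar curvature, as a function. -/
def partialScalar (D : A.Connection) (p m : Fin (Module.finrank ℝ F) → ℝ) : C^∞⟮𝓡 n, M; ℝ⟯ :=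
  (-2 : ℝ) • ∑ a, m a • A.rho (Fr.e a) (Fr.dv D a) - ∑ a, m a • (Fr.dv D a * Fr.dv D a)
    + (1 / 6 : ℝ) • ∑ a, ∑ b, ∑ e, (m a * m b * m e) • (Fr.c a b e * Fr.c a b e)
    + (1 / 2 : ℝ) • ∑ a, ∑ b, ∑ e, (p a * m b * m e) • (Fr.c a b e * Fr.c a b e)

theorem rho_partialScalar (hy : y ∈ Fr.U) (p m : Fin (Module.finrank ℝ F) → ℝ)
    (k : Fin (Module.finrank ℝ F)) :
    A.rho (Fr.e k) (Fr.partialScalar D p m) y = (Fr.jet D hy).derivScalar p m k := by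
  simp only [partialScalar, rho_add, rho_sub, rho_smul, rho_sum, rho_mul, fun_add_apply,
    fun_sub_apply, fun_smul_apply, fun_sum_apply, fun_mul_apply, FrameAlgebra.Jet.derivScalar, jet]
  congr 1
  · congr 1
    · congr 1
      rw [Finset.mul_sum]
      exact Finset.sum_congr rfl fun a _ => by ring
    · simp only [Finset.mul_sum]
      exact Finset.sum_congr rfl fun a _ => Finset.sum_congr rfl fun b _ =>
        Finset.sum_congr rfl fun e _ => by ring
  · simp only [Finset.mul_sum]
    exact Finset.sum_congr rfl fun a _ => Finset.sum_congr rfl fun b _ =>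
      Finset.sum_congr rfl fun e _ => by ring

/-- It identifies the pointwise partial traces with a smooth function of c and d, which can be
differentiated along the frame. -/
theorem sum_ricci_eq_partialScalar (hy : y ∈ Fr.U) {τ : ℝ} {p m : Fin (Module.finrank ℝ F) → ℝ}
    (hm : m = weight Fr.w Fr.s τ) (hp : ∀ i, Fr.w i = p i + m i) :
    ∑ q, m q * (Fr.leviCivita hD hy).ricci q q = Fr.partialScalar D p m y := by
  rw [(Fr.leviCivita hD hy).sum_ricci_self (p := p) hm (funext fun i => by simp [hp i])]
  simp only [partialScalar, fun_add_apply, fun_sub_apply, fun_smul_apply, fun_sum_apply,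
    fun_mul_apply, jet]

/-- G weights the trace of the full Ricci tensor by s_i, so on U the scalar curvature is s_k times
the difference of the partial scalar curvatures for s_k and -s_k. -/
theorem rho_scalar (hy : y ∈ Fr.U) (k : Fin (Module.finrank ℝ F)) :
    A.rho (Fr.e k) (D.scalar hD.torsionFree G) y
      = Fr.s k * ((Fr.jet D hy).derivScalar (weight Fr.w Fr.s (-Fr.s k))
          (weight Fr.w Fr.s (Fr.s k)) k
        - (Fr.jet D hy).derivScalar (weight Fr.w Fr.s (Fr.s k))
          (weight Fr.w Fr.s (-Fr.s k)) k) := by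
  have hw := FrameAlgebra.Jet.LeviCivita.eq_weight_add (η := Fr.w) Fr.s_mul_self k
  rw [← Fr.rho_partialScalar hy, ← Fr.rho_partialScalar hy, ← fun_sub_apply, ← rho_sub,
    ← fun_smul_apply, ← rho_smul]
  refine rho_congr _ Fr.isOpen (fun z hz => ?_) hy
  rw [fun_smul_apply, fun_sub_apply, Fr.scalar_eq hD hz,
    ← Fr.sum_ricci_eq_partialScalar hD hz rfl (fun i => (hw i).trans (add_comm _ _)),
    ← Fr.sum_ricci_eq_partialScalar hD hz rfl hw, ← Finset.sum_sub_distrib, Finset.mul_sum]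
  refine Finset.sum_congr rfl fun i _ => ?_
  rw [weight, weight]
  by_cases h : Fr.s i = Fr.s k
  · rw [if_pos h, if_neg (by rw [h]; exact FrameAlgebra.Jet.LeviCivita.ne_neg Fr.s_mul_self k), h]
    ring
  · have h' := FrameAlgebra.Jet.LeviCivita.eq_neg_of_ne Fr.s_mul_self h
    rw [if_neg h, if_pos h', h']
    ring

/-- `mixedRicci` as a function. -/
def mixedRicciFun (D : A.Connection) (p m : Fin (Module.finrank ℝ F) → ℝ)
    (a b : Fin (Module.finrank ℝ F)) : C^∞⟮𝓡 n, M; ℝ⟯ :=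
  -A.rho (Fr.e b) (Fr.dv D a) + ∑ e, m e • A.rho (Fr.e e) (Fr.c b a e)
    + ∑ e, m e • (Fr.c b a e * Fr.dv D e)
    + ∑ e, ∑ f, (m e * p f) • (Fr.c b e f * Fr.c a e f)

theorem mixedRicciFun_apply (hy : y ∈ Fr.U) (p m : Fin (Module.finrank ℝ F) → ℝ)
    (a b : Fin (Module.finrank ℝ F)) :
    Fr.mixedRicciFun D p m a b y = (Fr.jet D hy).mixedRicci p m a b := by
  simp only [mixedRicciFun, fun_add_apply, fun_neg_apply, fun_smul_apply, fun_sum_apply,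
    fun_mul_apply, FrameAlgebra.Jet.mixedRicci, jet]

theorem rho_mixedRicciFun (hy : y ∈ Fr.U) (p m : Fin (Module.finrank ℝ F) → ℝ)
    (l a b : Fin (Module.finrank ℝ F)) :
    A.rho (Fr.e l) (Fr.mixedRicciFun D p m a b) y = (Fr.jet D hy).derivMixedRicci p m l a b := by
  simp only [mixedRicciFun, rho_add, rho_neg, rho_smul, rho_sum, rho_mul, fun_add_apply,
    fun_neg_apply, fun_smul_apply, fun_sum_apply, fun_mul_apply,
    FrameAlgebra.Jet.derivMixedRicci, jet]
  congr 1
  · congr 1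
    exact Finset.sum_congr rfl fun e _ => by ring
  · exact Finset.sum_congr rfl fun e _ => Finset.sum_congr rfl fun f _ => by ring

section Divergence

variable {σ : PositiveHalfDensity n M}
-- Conjugation by G multiplies the component (q, r) by s_q s_r, so Rc carries the factor 1 - s_q
-- s_r, which is 0 within an eigenbundle and 2 between them.
theorem pair_ricci (hdiv : ∀ u, D.div u = A.divOf σ u)
    (hy : y ∈ Fr.U) (q r : Fin (Module.finrank ℝ F)) :
    A.pair (Fr.e q) (D.ricci hD.torsionFree G (Fr.e r)) y
      = 2 * offDiagRicci (Fr.jet D hy) Fr.s q r := by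
  have h : A.pair (Fr.e q) (D.fullRicci hD.torsionFree (Fr.s r • Fr.e r)) y
      = Fr.s r * (Fr.leviCivita hD hy).ricci q r := by
    rw [D.pair_fullRicci, (D.isTensorial_fullRicciForm_right _).const_smul,
      Fr.fullRicciForm_eq hD hy]
  rw [Connection.ricci, pair_sub, Fr.pair_act, Fr.act, h, Fr.pair_fullRicci_eq hD hy, offDiagRicci]
  split_ifs with hqr
  · rw [hqr, ← mul_assoc, Fr.s_mul_self]; ring
  · have hs := FrameAlgebra.Jet.LeviCivita.eq_neg_of_ne Fr.s_mul_self hqr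
    rw [(Fr.leviCivita hD hy).ricci_mixed hqr, hs, ← mul_assoc, neg_mul, Fr.s_mul_self]
    · ring
    · rw [hs]; exact FrameAlgebra.Jet.LeviCivita.eq_weight_add Fr.s_mul_self r
    · exact Fr.rho_dv_sub hdiv hy

theorem rho_pair_ricci (hdiv : ∀ u, D.div u = A.divOf σ u)
    (hy : y ∈ Fr.U) (l q r : Fin (Module.finrank ℝ F)) :
    A.rho (Fr.e l) (A.pair (Fr.e q) (D.ricci hD.torsionFree G (Fr.e r))) y
      = 2 * derivOffDiagRicci (Fr.jet D hy) Fr.s l q r := by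
  by_cases h : Fr.s q = Fr.s r
  · rw [derivOffDiagRicci, if_pos h, mul_zero]
    refine rho_eq_zero_of_const _ Fr.isOpen (c := 0) (fun z hz => ?_) hy
    rw [Fr.pair_ricci hD hdiv hz, offDiagRicci, if_pos h, mul_zero]
  · rw [derivOffDiagRicci, if_neg h, ← Fr.rho_mixedRicciFun hy, ← fun_smul_apply, ← rho_smul]
    refine rho_congr _ Fr.isOpen (fun z hz => ?_) hy
    rw [Fr.pair_ricci hD hdiv hz, offDiagRicci, if_neg h, fun_smul_apply,
      Fr.mixedRicciFun_apply hz]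

/-- The sum of the partial scalar curvatures has zero derivative, so half the derivative of their
signed difference is -s_k times the derivative of the one for -s_k. This is also the value given by
`div_offDiagRicci`, the factor 2 there being the one between Rc and its mixed components. -/
theorem divRicci_frame (hdiv : ∀ u, D.div u = A.divOf σ u)
    (hy : y ∈ Fr.U) (k : Fin (Module.finrank ℝ F)) :
    A.contract (fun s t => A.pair s (G.act (D.covEnd (D.ricci hD.torsionFree G) t (Fr.e k)))) y
      = 1 / 2 * A.rho (Fr.e k) (D.scalar hD.torsionFree G) y := by
  have h1 := (Fr.jet D hy).derivScalar_total k (Fr.rho_dv_sub hdiv hy)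
    (Fr.rho_rho_dv_sub hdiv hy) (Fr.laplacian_eq_zero hdiv hy k _)
  rw [← FrameAlgebra.Jet.derivScalar_add_swap _
    (FrameAlgebra.Jet.LeviCivita.eq_weight_add Fr.s_mul_self k)] at h1
  have h2 := (Fr.leviCivita hD hy).div_offDiagRicci Fr.s_mul_self k
  rw [Fr.divRicci_eq hD hy, Fr.rho_scalar hD hy, ← sub_eq_zero]
  simp only [Fr.rho_pair_ricci hD hdiv hy, Fr.pair_ricci hD hdiv hy]
  have h3 : ∀ X Y : ℝ, Y + X = 0 → 1 / 2 * (Fr.s k * (X - Y)) = -Fr.s k * Y := by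
    intro X Y h
    rw [eq_neg_of_add_eq_zero_right h]; ring
  rw [h3 _ _ h1, ← h2, Finset.mul_sum, sub_eq_zero]
  refine Finset.sum_congr rfl fun t _ => ?_
  have e : ∀ f g : Fin (Module.finrank ℝ F) → ℝ,
      ∑ r, Fr.w r * (f r * (2 * g r)) = 2 * ∑ r, Fr.w r * (f r * g r) := by
    intro f g
    rw [Finset.mul_sum]
    exact Finset.sum_congr rfl fun r _ => by ring
  rw [e, e]
  change _ = 2 * (_ * (_ * (_ - ∑ r, Fr.w r * (Fr.gam D t t r y * _)
    - ∑ r, Fr.w r * (Fr.gam D t k r y * _))))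
  ring

end Divergence

end AdaptedFrame
end CourantAlgebroid
end DivRicci

end Courant

end

/-! ### The contracted identity for an arbitrary section. -/

theorem mainTheorem8 {n : ℕ} {M : Type*} [TopologicalSpace M] [T2Space M]
    [ChartedSpace (EuclideanSpace ℝ (Fin n)) M] [IsManifold (𝓡 n) ∞ M]
    {F : Type*} [NormedAddCommGroup F] [NormedSpace ℝ F] [FiniteDimensional ℝ F]
    {E : M → Type*} [TopologicalSpace (TotalSpace F E)]
    [∀ x, TopologicalSpace (E x)] [FiberBundle F E]
    [∀ x, AddCommGroup (E x)] [∀ x, Module ℝ (E x)] [VectorBundle ℝ F E]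
    [ContMDiffVectorBundle ∞ F E (𝓡 n)]
    (A : Courant.CourantAlgebroid n F E) (G : A.Pseudometric) (σ : Courant.PositiveHalfDensity n M)
    (D : A.Connection) (hD : D.IsLeviCivita G) (hdiv : ∀ u, D.div u = A.divOf σ u)
    (v : Cₛ^∞⟮𝓡 n; F, E⟯) (x : M) :
    A.contract (fun s t => A.pair s (G.act (D.covEnd (D.ricci hD.torsionFree G) t v))) x
      = 1 / 2 * A.rho v (D.scalar hD.torsionFree G) x := by
  obtain ⟨Fr⟩ := Courant.CourantAlgebroid.exists_adaptedFrame G x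
  -- Both sides are linear in v over smooth functions, hence determined at x by the components of v
  -- in the adapted frame.
  rw [Fr.expand (Courant.CourantAlgebroid.Connection.isTensorial_divRicci hD.torsionFree) Fr.mem v,
    Fr.rho_expand Fr.mem, Finset.mul_sum]
  refine Finset.sum_congr rfl fun k _ => ?_
  rw [Fr.divRicci_frame hD hdiv Fr.mem]
  ring
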